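/- **Theorem 1.2.** Let $n\ge 0$, let $X$ be a connected CW-complex of dimension $2n$, and let $F$ be a field with $\operatorname{char}(F)\neq 2$. Suppose there are classes $u_1,\dots,u_n\in H^2(X;F)$ in singular cohomology such that each $u_j$ is atoroidal (i.e. $f^*u_j=0\in H^2(T^2;F)$ for every continuous map $f\colon T^2\to X$ from the $2$-torus), $u_j^2=u_j\cup u_j=0$ for each $j$, and $u_1\cup\dots\cup u_n\neq 0\in H^{2n}(X;F)$. Then $$\operatorname{TC}(X)=2\dim(X)=4n.$$ Here the topological complexity $\operatorname{TC}(X)$ is the minimal $k\ge 0$ for which $X\times X$ has an open cover $U_0,\dots,U_k$ such that for each $j$ there is a continuous map $s_j\colon U_j\to C([0,1],X)$ (compact-open topology) with $(s_j(x,y)(0),s_j(x,y)(1))=(x,y)$ for all $(x,y)\in U_j$, and $\operatorname{TC}(X)=\infty$ if no such $k$ exists. -/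

import Mathlib

noncomputable section

/-! ### Singular cochains -/

namespace SingCoh

universe u v w

/-- Singular `k`-simplices of `X`: continuous maps from the standard `k`-simplex to `X`. -/
abbrev Simplex (X : Type u) [TopologicalSpace X] (k : ℕ) : Type u :=
  C(stdSimplex ℝ (Fin (k + 1)), X)

/-- Precomposition of a singular simplex with the affine map of standard simplices which is given
on the vertices by `f`. -/
def Simplex.restrict {X : Type u} [TopologicalSpace X] {m k : ℕ}
    (f : Fin (m + 1) → Fin (k + 1)) (σ : Simplex X k) : Simplex X m :=
  σ.comp ⟨stdSimplex.map f, stdSimplex.continuous_map f⟩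

/-- Singular `k`-cochains of `X` with coefficients in `R`, i.e. functions on the set of singular
`k`-simplices. -/
abbrev Cochain (X : Type u) [TopologicalSpace X] (R : Type v) (k : ℕ) : Type (max u v) :=
  Simplex X k → R

section

variable (X : Type u) [TopologicalSpace X] (R : Type v) [CommRing R]

/-- The singular coboundary `(d φ)(σ) = ∑ i, (-1)^i φ(i-th face of σ)`. -/
def coboundary (k : ℕ) : Cochain X R k →ₗ[R] Cochain X R (k + 1) where
  toFun φ σ := ∑ i : Fin (k + 2), (-1 : R) ^ (i : ℕ) * φ (σ.restrict i.succAbove)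
  map_add' φ ψ := by
    funext σ
    simp [mul_add, Finset.sum_add_distrib]
  map_smul' r φ := by
    funext σ
    simp [Finset.mul_sum, mul_left_comm]

/-- Singular cocycles. -/
def cocycles (k : ℕ) : Submodule R (Cochain X R k) :=
  LinearMap.ker (coboundary X R k)

/-- Singular coboundaries; there are none (but zero) in degree `0`. -/
def coboundaries : (k : ℕ) → Submodule R (Cochain X R k)
  | 0 => ⊥
  | k + 1 => LinearMap.range (coboundary X R k)

/-- Singular cohomology `H^k(X; R)`: cocycles modulo coboundaries. -/
abbrev Cohomology (k : ℕ) : Type (max u v) :=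
  cocycles X R k ⧸ (coboundaries X R k).submoduleOf (cocycles X R k)

end

variable {X : Type u} [TopologicalSpace X] {Y : Type w} [TopologicalSpace Y]
variable {R : Type v} [CommRing R]

lemma Simplex.restrict_restrict {l m k : ℕ} (f : Fin (l + 1) → Fin (m + 1))
    (g : Fin (m + 1) → Fin (k + 1)) (σ : Simplex X k) :
    (σ.restrict g).restrict f = σ.restrict (g ∘ f) := by
  ext x
  simp [Simplex.restrict, stdSimplex.map_comp_apply]

lemma coboundary_apply {k : ℕ} (φ : Cochain X R k) (σ : Simplex X (k + 1)) :
    coboundary X R k φ σ =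
      ∑ i : Fin (k + 2), (-1 : R) ^ (i : ℕ) * φ (σ.restrict i.succAbove) := rfl

/-- The coboundary squares to zero. -/
lemma coboundary_coboundary {k : ℕ} (φ : Cochain X R k) :
    coboundary X R (k + 1) (coboundary X R k φ) = 0 := by
  funext σ
  simp only [coboundary_apply, Finset.mul_sum, Simplex.restrict_restrict, Pi.zero_apply]
  rw [← Finset.sum_product', Finset.univ_product_univ]
  let P := Fin (k + 3) × Fin (k + 2)
  let S : Finset P := {ij : P | (ij.1 : ℕ) ≤ (ij.2 : ℕ)}
  rw [← Finset.sum_add_sum_compl S, ← eq_neg_iff_add_eq_zero, ← Finset.sum_neg_distrib]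
  refine Finset.sum_bij' (fun ij hij => (ij.2.succ,
      Fin.castLT ij.1 (lt_of_le_of_lt (Finset.mem_filter.mp hij).right (Fin.is_lt ij.2))))
    (fun ij hij => (ij.2.castSucc, ij.1.pred (by
      rintro h
      simp [S, h] at hij))) ?_ ?_ ?_ ?_ ?_
  · rintro ⟨i, j⟩ hij
    simp [S] at hij ⊢
    omega
  · rintro ⟨i, j⟩ hij
    simp [S] at hij ⊢
    omega
  · rintro ⟨i, j⟩ hij
    simp
  · rintro ⟨i, j⟩ hij
    simp
  · rintro ⟨i, j⟩ hij
    have hij' : (i : ℕ) ≤ j := by simpa [S] using hij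
    have hf : i.succAbove ∘ j.succAbove = j.succ.succAbove ∘
        (Fin.castLT i (lt_of_le_of_lt hij' j.is_lt)).succAbove := by
      funext x
      ext
      simp only [Function.comp, Fin.succAbove, Fin.lt_def]
      split_ifs <;> simp_all <;> omega
    simp only [hf, Fin.val_succ, Fin.val_castLT, pow_succ]
    ring

lemma coboundaries_le_cocycles (k : ℕ) : coboundaries X R k ≤ cocycles X R k := by
  cases k with
  | zero => exact bot_le
  | succ k =>
    rintro _ ⟨φ, rfl⟩
    exact coboundary_coboundary φ

/-! ### Functoriality -/

/-- Pullback of cochains along a continuous map. -/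
def cochainPullback (f : C(X, Y)) (k : ℕ) : Cochain Y R k →ₗ[R] Cochain X R k where
  toFun φ σ := φ (f.comp σ)
  map_add' _ _ := rfl
  map_smul' _ _ := rfl

lemma coboundary_cochainPullback (f : C(X, Y)) {k : ℕ} (φ : Cochain Y R k) :
    coboundary X R k (cochainPullback f k φ) =
      cochainPullback f (k + 1) (coboundary Y R k φ) := rfl

lemma cochainPullback_mem_cocycles (f : C(X, Y)) (k : ℕ) :
    ∀ φ ∈ cocycles Y R k, cochainPullback f k φ ∈ cocycles X R k := by
  intro φ hφ
  rw [cocycles, LinearMap.mem_ker] at hφ ⊢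
  rw [coboundary_cochainPullback, hφ, map_zero]

lemma cochainPullback_mem_coboundaries (f : C(X, Y)) (k : ℕ) :
    ∀ φ ∈ coboundaries Y R k, cochainPullback f k φ ∈ coboundaries X R k := by
  cases k with
  | zero =>
    intro φ hφ
    have h : φ = 0 := hφ
    rw [h, map_zero]
    exact Submodule.zero_mem _
  | succ k =>
    rintro _ ⟨φ, rfl⟩
    exact ⟨cochainPullback f k φ, coboundary_cochainPullback f φ⟩

variable (R) in
/-- The homomorphism `f^* : H^k(Y; R) → H^k(X; R)` induced by a continuous map `f : X → Y`. -/
def pullback (f : C(X, Y)) (k : ℕ) : Cohomology Y R k →ₗ[R] Cohomology X R k :=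
  Submodule.mapQ _ _
    ((cochainPullback f k).restrict (cochainPullback_mem_cocycles f k))
    (fun φ hφ => cochainPullback_mem_coboundaries f k φ.1 hφ)

/-! ### Cup product -/

/-- The inclusion of the first `p + 1` vertices of the `n`-simplex, where `n = p + q`. -/
def frontVertices {p q n : ℕ} (h : p + q = n) (i : Fin (p + 1)) : Fin (n + 1) :=
  ⟨i, by omega⟩

/-- The inclusion of the last `q + 1` vertices of the `n`-simplex, where `n = p + q`. -/
def backVertices {p q n : ℕ} (h : p + q = n) (i : Fin (q + 1)) : Fin (n + 1) :=
  ⟨p + i, by omega⟩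

/-- The cup product of cochains: `(φ ∪ ψ)(σ) = φ(front p-face of σ) ψ(back q-face of σ)`. -/
def cochainCup {p q n : ℕ} (h : p + q = n) :
    Cochain X R p →ₗ[R] Cochain X R q →ₗ[R] Cochain X R n :=
  LinearMap.mk₂ R
    (fun φ ψ σ => φ (σ.restrict (frontVertices h)) * ψ (σ.restrict (backVertices h)))
    (fun _ _ _ => funext fun _ => add_mul _ _ _)
    (fun _ _ _ => funext fun _ => mul_assoc _ _ _)
    (fun _ _ _ => funext fun _ => mul_add _ _ _)
    (fun _ _ _ => funext fun _ => mul_left_comm _ _ _)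

lemma cochainCup_apply {p q n : ℕ} (h : p + q = n) (φ : Cochain X R p) (ψ : Cochain X R q)
    (σ : Simplex X n) :
    cochainCup h φ ψ σ =
      φ (σ.restrict (frontVertices h)) * ψ (σ.restrict (backVertices h)) := rfl

/-- The Leibniz rule `d(φ ∪ ψ) = dφ ∪ ψ + (-1)^p φ ∪ dψ`. -/
lemma coboundary_cochainCup {p q n : ℕ} (h : p + q = n) (h₁ : p + 1 + q = n + 1)
    (h₂ : p + (q + 1) = n + 1) (φ : Cochain X R p) (ψ : Cochain X R q) :
    coboundary X R n (cochainCup h φ ψ) =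
      cochainCup h₁ (coboundary X R p φ) ψ +
        (-1 : R) ^ p • cochainCup h₂ φ (coboundary X R q ψ) := by
  subst h
  funext σ
  simp only [Pi.add_apply, Pi.smul_apply, smul_eq_mul, coboundary_apply, cochainCup_apply,
    Simplex.restrict_restrict]
  rw [Fin.sum_univ_castSucc (n := p + 1), Fin.sum_univ_succ (n := q + 1)]
  have key : ∀ G : Fin (p + q + 2) → R, ∑ i, G i =
      ∑ i : Fin (p + 1), G ⟨i, by omega⟩ + ∑ j : Fin (q + 1), G ⟨p + 1 + j, by omega⟩ := by
    intro G
    have e : p + 1 + (q + 1) = p + q + 2 := by omega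
    rw [← (finCongr e).sum_comp, Fin.sum_univ_add]
    rfl
  rw [key, add_mul, mul_add, mul_add, Finset.sum_mul, Finset.mul_sum, Finset.mul_sum]
  have a1 : ∀ i : Fin (p + 1),
      Fin.succAbove (⟨i, by omega⟩ : Fin (p + q + 2)) ∘ frontVertices (rfl : p + q = p + q) =
        frontVertices h₁ ∘ i.castSucc.succAbove := by
    intro i
    funext x
    ext
    simp only [Function.comp, Fin.succAbove, Fin.lt_def, frontVertices, Fin.val_castSucc]
    split_ifs <;> simp
  have a2 : ∀ i : Fin (p + 1),
      Fin.succAbove (⟨i, by omega⟩ : Fin (p + q + 2)) ∘ backVertices (rfl : p + q = p + q) =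
        backVertices h₁ := by
    intro i
    funext x
    ext
    simp only [Function.comp, Fin.succAbove, Fin.lt_def, backVertices, Fin.val_castSucc]
    split_ifs <;> simp <;> omega
  have a3 : ∀ j : Fin (q + 1),
      Fin.succAbove (⟨p + 1 + j, by omega⟩ : Fin (p + q + 2)) ∘
        frontVertices (rfl : p + q = p + q) = frontVertices h₂ := by
    intro j
    funext x
    ext
    simp only [Function.comp, Fin.succAbove, Fin.lt_def, frontVertices, Fin.val_castSucc]
    split_ifs <;> simp <;> omega
  have a4 : ∀ j : Fin (q + 1),
      Fin.succAbove (⟨p + 1 + j, by omega⟩ : Fin (p + q + 2)) ∘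
        backVertices (rfl : p + q = p + q) = backVertices h₂ ∘ j.succ.succAbove := by
    intro j
    funext x
    ext
    simp only [Function.comp, Fin.succAbove, Fin.lt_def, backVertices, Fin.val_castSucc,
      Fin.val_succ]
    split_ifs <;> simp <;> omega
  have a5 : frontVertices h₁ ∘ (Fin.last (p + 1)).succAbove = frontVertices h₂ := by
    funext x
    ext
    simp [frontVertices]
  have a6 : backVertices h₂ ∘ (0 : Fin (q + 1 + 1)).succAbove = backVertices h₁ := by
    funext x
    ext
    simp [backVertices]
    omega
  simp only [a1, a2, a3, a4, a5, a6, Fin.val_castSucc, Fin.val_succ, Fin.val_last, Fin.val_zero]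
  have b1 : ∀ j : Fin (q + 1), ∀ x y : R,
      (-1 : R) ^ (p + 1 + (j : ℕ)) * (x * y) =
        (-1) ^ p * (x * ((-1) ^ ((j : ℕ) + 1) * y)) := by
    intro j x y
    ring
  simp only [b1, mul_assoc]
  ring

lemma cochainCup_mem_cocycles {p q n : ℕ} (h : p + q = n) {φ : Cochain X R p}
    {ψ : Cochain X R q} (hφ : φ ∈ cocycles X R p) (hψ : ψ ∈ cocycles X R q) :
    cochainCup h φ ψ ∈ cocycles X R n := by
  rw [cocycles, LinearMap.mem_ker] at *
  rw [coboundary_cochainCup h (by omega) (by omega), hφ, hψ]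
  simp

lemma cochainCup_mem_coboundaries_left {p q n : ℕ} (h : p + q = n) {φ : Cochain X R p}
    {ψ : Cochain X R q} (hφ : φ ∈ coboundaries X R p) (hψ : ψ ∈ cocycles X R q) :
    cochainCup h φ ψ ∈ coboundaries X R n := by
  cases p with
  | zero =>
    have h0 : φ = 0 := hφ
    rw [h0, map_zero, LinearMap.zero_apply]
    exact Submodule.zero_mem _
  | succ p =>
    obtain ⟨α, rfl⟩ := hφ
    rw [cocycles, LinearMap.mem_ker] at hψ
    cases n with
    | zero => omega
    | succ n =>
      refine ⟨cochainCup (by omega) α ψ, ?_⟩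
      rw [coboundary_cochainCup (by omega) h (by omega), hψ]
      simp

lemma cochainCup_mem_coboundaries_right {p q n : ℕ} (h : p + q = n) {φ : Cochain X R p}
    {ψ : Cochain X R q} (hφ : φ ∈ cocycles X R p) (hψ : ψ ∈ coboundaries X R q) :
    cochainCup h φ ψ ∈ coboundaries X R n := by
  cases q with
  | zero =>
    have h0 : ψ = 0 := hψ
    rw [h0, map_zero]
    exact Submodule.zero_mem _
  | succ q =>
    obtain ⟨β, rfl⟩ := hψ
    rw [cocycles, LinearMap.mem_ker] at hφ
    cases n with
    | zero => omega
    | succ n =>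
      refine ⟨(-1 : R) ^ p • cochainCup (by omega) φ β, ?_⟩
      rw [map_smul, coboundary_cochainCup (by omega) (by omega) h, hφ, map_zero,
        LinearMap.zero_apply, zero_add, smul_smul, ← mul_pow, neg_one_mul, neg_neg, one_pow,
        one_smul]

/-- The cup product on cocycles, with values in cohomology. -/
def cocycleCup (p q : ℕ) :
    cocycles X R p →ₗ[R] cocycles X R q →ₗ[R] Cohomology X R (p + q) :=
  LinearMap.mk₂ R
    (fun φ ψ => Submodule.Quotient.mk
      ⟨cochainCup rfl φ.1 ψ.1, cochainCup_mem_cocycles rfl φ.2 ψ.2⟩)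
    (fun φ φ' ψ => by
      rw [← Submodule.Quotient.mk_add]
      congr 1
      ext1
      simp)
    (fun c φ ψ => by
      rw [← Submodule.Quotient.mk_smul]
      congr 1
      ext1
      simp)
    (fun φ ψ ψ' => by
      rw [← Submodule.Quotient.mk_add]
      congr 1
      ext1
      simp)
    (fun c φ ψ => by
      rw [← Submodule.Quotient.mk_smul]
      congr 1
      ext1
      simp)

lemma cocycleCup_eq_zero_left {p q : ℕ} (φ : cocycles X R p) (ψ : cocycles X R q)
    (hφ : φ.1 ∈ coboundaries X R p) : cocycleCup p q φ ψ = 0 :=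
  (Submodule.Quotient.mk_eq_zero _).2 (cochainCup_mem_coboundaries_left rfl hφ ψ.2)

lemma cocycleCup_eq_zero_right {p q : ℕ} (φ : cocycles X R p) (ψ : cocycles X R q)
    (hψ : ψ.1 ∈ coboundaries X R q) : cocycleCup p q φ ψ = 0 :=
  (Submodule.Quotient.mk_eq_zero _).2 (cochainCup_mem_coboundaries_right rfl φ.2 hψ)

variable (X R) in
/-- The cup product `H^p(X; R) × H^q(X; R) → H^{p+q}(X; R)`. -/
def cup (p q : ℕ) : Cohomology X R p →ₗ[R] Cohomology X R q →ₗ[R] Cohomology X R (p + q) :=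
  Submodule.liftQ _
    (Submodule.liftQ _ (cocycleCup p q).flip (fun ψ hψ =>
      LinearMap.ext fun φ => cocycleCup_eq_zero_right φ ψ hψ)).flip
    (fun φ hφ => LinearMap.ext fun b => by
      induction b using Submodule.Quotient.induction_on with
      | H ψ => exact cocycleCup_eq_zero_left φ ψ hφ)

/-- On representatives, the cup product is the cup product of cocycles. -/
lemma cup_mk {p q : ℕ} (φ : cocycles X R p) (ψ : cocycles X R q) :
    cup X R p q (Submodule.Quotient.mk φ) (Submodule.Quotient.mk ψ) =
      Submodule.Quotient.mk
        ⟨cochainCup rfl φ.1 ψ.1, cochainCup_mem_cocycles rfl φ.2 ψ.2⟩ := rfl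

lemma one_mem_cocycles : (fun _ => 1 : Cochain X R 0) ∈ cocycles X R 0 := by
  rw [cocycles, LinearMap.mem_ker]
  funext σ
  simp [coboundary_apply, Fin.sum_univ_two]

variable (X R) in
/-- The unit `1 ∈ H^0(X; R)`, the class of the constant cochain `1`. -/
def one : Cohomology X R 0 := Submodule.Quotient.mk ⟨fun _ => 1, one_mem_cocycles⟩

/-- The product `u_1 ∪ ⋯ ∪ u_n ∈ H^{2n}(X; R)` of `n` classes of degree two
(the unit of `H^0(X; R)` if `n = 0`). -/
def cupProd : (n : ℕ) → (Fin n → Cohomology X R 2) → Cohomology X R (2 * n)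
  | 0, _ => one X R
  | n + 1, u => cup X R (2 * n) 2 (cupProd n fun i => u i.castSucc) (u (Fin.last n))

/-- A class `u ∈ H^k(X; R)` is atoroidal if it pulls back to zero along every continuous map
from the torus `T^k = (ℝ/ℤ)^k` to `X`. -/
def IsAtoroidal {k : ℕ} (u : Cohomology X R k) : Prop :=
  ∀ f : C(UnitAddTorus (Fin k), X), pullback R f k u = 0

end SingCoh

/-! ### Topological complexity -/

/-- `X × X` is covered by `k + 1` open sets `U_0, …, U_k` such that over each `U_j` there is a
continuous section of the end point map `γ ↦ (γ 0, γ 1)` on the space `C([0,1], X)` of paths with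
its compact-open topology. -/
def HasMotionPlanners (X : Type*) [TopologicalSpace X] (k : ℕ) : Prop :=
  ∃ U : Fin (k + 1) → Set (X × X),
    (∀ j, IsOpen (U j)) ∧ (⋃ j, U j) = Set.univ ∧
      ∀ j, ∃ s : C(U j, C(unitInterval, X)), ∀ p : U j, (s p 0, s p 1) = (p : X × X)

/-- The (reduced) topological complexity `TC(X)`: the minimal `k` such that `X` has motion planners
on `k + 1` open sets covering `X × X`, and `∞` if there is no such `k`. -/
def topologicalComplexity (X : Type*) [TopologicalSpace X] : ℕ∞ :=
  ⨅ (k : ℕ) (_ : HasMotionPlanners X k), (k : ℕ∞)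

/-! ### Dimension of a CW-complex -/

/-- The dimension of a CW-complex: the supremum of the dimensions of its cells. -/
def cwDimension {X : Type*} [TopologicalSpace X] (C : Set X) [Topology.CWComplex C] : ℕ∞ :=
  ⨆ (k : ℕ) (_ : Nonempty (Topology.RelCWComplex.cell C k)), (k : ℕ∞)

end

/-! The lower and the upper bound are independent of each other.

Lower bound (`le_of_hasMotionPlanners`). Put a = p₁*u and b = p₂*u on X × X for one of the given
classes u. Over a set with a motion planner the two projections are homotopic, and the prism
operator gives an explicit primitive of b - a there (`coboundary_prism`). Over an overlap of two
such sets the two primitives differ by a 1-cocycle. Its value on a loop is computed on the torus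
obtained by travelling out along one planner and back along the other, so it is zero because u is
atoroidal (`prism_eq_prism_of_loop`). A 1-cocycle that vanishes on loops is exact
(`mem_coboundaries_of_loops`), so the primitives can be matched: b - a has a representative that
vanishes on simplices in either of the two sets (`exists_sub_coboundary_eq_zero_of_isAtoroidal`).
One factor b - a thus takes care of two sets of the cover, and the product of all (b_j - a_j)² takes
care of 4n sets.

On the other hand u_j² = 0 gives (b_j - a_j)² = -2 a_j b_j, and the product is (-2)ⁿ times the cross
product of u_1 ⋯ u_n with itself (`cupList_flatMap_sub_mem_coboundaries`). Over a field this cross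
product is detected by the square of a cycle (`exists_functional`). Such a pairing sees only
finitely many simplices, so finitely many barycentric subdivisions suffice to show that it kills a
cocycle vanishing on the simplices subordinate to the cover (`exists_sub_coboundary_eq_zero`). Since
2 is invertible, 4n sets are too few. Subdivision and shuffle products are carried out on lists of
vertices, where recursion replaces sums over faces and permutations.

Upper bound (`hasMotionPlanners_of_cwDimension_eq`). Induction over skeleta produces d + 1
continuous functions whose sets of positive values cover X and are contractible in X
(`exists_isCategorical_skeletonLT`). Comparing the functions of both coordinates on X × X, and
grouping the points by the number of functions attaining the maximum, yields 2d + 1 open sets with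
planners (`hasMotionPlanners_of_isCategorical`). Here d = 2n. -/

noncomputable section

namespace SingCoh

universe u v w

/-! ### Chains of vertices

A list of points of an affine space stands for the affine simplex with these vertices, and a function
on lists for a cochain. -/

section Lists

variable {K : Type*} {L : Type*} {R : Type*} [CommRing R]

/-- The coboundary of a function on lists: the alternating sum over the omission of an entry. -/
def bd : (List K → R) → List K → R
  | _, [] => 0
  | Φ, a :: l => Φ l - bd (fun l' => Φ (a :: l')) l

@[simp] lemma bd_nil (Φ : List K → R) : bd Φ [] = 0 := rfl

lemma bd_cons (Φ : List K → R) (a : K) (l : List K) :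
    bd Φ (a :: l) = Φ l - bd (fun l' => Φ (a :: l')) l := rfl

lemma bd_add (Φ Ψ : List K → R) (l : List K) :
    bd (fun l => Φ l + Ψ l) l = bd Φ l + bd Ψ l := by
  induction l generalizing Φ Ψ with
  | nil => simp
  | cons a l ih => simp only [bd_cons, ih]; ring

lemma bd_mul_left (c : R) (Φ : List K → R) (l : List K) :
    bd (fun l => c * Φ l) l = c * bd Φ l := by
  induction l generalizing Φ with
  | nil => simp
  | cons a l ih => simp only [bd_cons, ih]; ring

lemma bd_sub (Φ Ψ : List K → R) (l : List K) :
    bd (fun l => Φ l - Ψ l) l = bd Φ l - bd Ψ l := by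
  induction l generalizing Φ Ψ with
  | nil => simp
  | cons a l ih => simp only [bd_cons, ih]; ring

lemma bd_zero (l : List K) : bd (fun _ => (0 : R)) l = 0 := by
  induction l with
  | nil => simp
  | cons a l ih => simp only [bd_cons, ih]; ring

/-- The complex of lists is augmented: deleting the entry of a one-element list leaves `[]`. This
accounts for the end term in the recursion of `shuffle`. -/
lemma bd_indicator_nil (c : R) (l : List K) [∀ l' : List K, Decidable (l' = [])] :
    bd (fun l' => if l' = [] then c else 0) l = if l.length = 1 then c else 0 := by
  match l with
  | [] => simp
  | [a] => simp [bd_cons]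
  | a :: b :: l => simp [bd_cons, bd_zero]

/-- The coboundary at `l` only involves lists that are shorter by one. -/
lemma bd_congr {Φ Ψ : List K → R} {l : List K}
    (h : ∀ l', l'.length + 1 = l.length → Φ l' = Ψ l') : bd Φ l = bd Ψ l := by
  induction l generalizing Φ Ψ with
  | nil => rfl
  | cons a l ih =>
    rw [bd_cons, bd_cons, h l (by simp), ih fun l' hl' => h (a :: l') (by simpa using hl')]

lemma bd_congr_eraseIdx {Φ Ψ : List K → R} {l : List K}
    (h : ∀ i < l.length, Φ (l.eraseIdx i) = Ψ (l.eraseIdx i)) : bd Φ l = bd Ψ l := by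
  induction l generalizing Φ Ψ with
  | nil => rfl
  | cons a l ih =>
    rw [bd_cons, bd_cons, ih (Φ := fun l' => Φ (a :: l')) (Ψ := fun l' => Ψ (a :: l'))
      fun i hi => h (i + 1) (by simpa using hi)]
    congr 1
    exact h 0 (by simp)

/-- In the cone recursion the terms omitting the head cancel, and the rest is the same identity for
the tail; no pairing of faces is needed. -/
lemma bd_bd (Φ : List K → R) (l : List K) : bd (bd Φ) l = 0 := by
  induction l generalizing Φ with
  | nil => rfl
  | cons a l ih =>
    rw [bd_cons]
    simp only [bd_cons, bd_sub, ih]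
    ring

lemma bd_eq_sum (Φ : List K → R) {n : ℕ} {l : List K} (hl : l.length = n) :
    bd Φ l = ∑ i : Fin n, (-1 : R) ^ (i : ℕ) * Φ (l.eraseIdx i) := by
  induction n generalizing Φ l with
  | zero => simp [List.eq_nil_of_length_eq_zero hl]
  | succ n ih =>
    cases l with
    | nil => simp at hl
    | cons a l =>
      rw [bd_cons, ih _ (by simpa using hl), Fin.sum_univ_succ, sub_eq_add_neg,
        ← Finset.sum_neg_distrib]
      simp [pow_succ]

lemma bd_map (f : K → L) (Φ : List L → R) (l : List K) :
    bd (fun l => Φ (l.map f)) l = bd Φ (l.map f) := by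
  induction l generalizing Φ with
  | nil => rfl
  | cons a l ih =>
    simp only [bd_cons, List.map_cons]
    rw [ih fun l' => Φ (f a :: l')]

/-! ### Subdivision -/

/-- Auxiliary recursion for `subdiv`, on the length of the list. -/
def subdivAux (b : List K → K) : ℕ → (List K → R) → List K → R
  | 0, Φ, l => Φ l
  | n + 1, Φ, l => bd (subdivAux b n fun l' => Φ (b l :: l')) l

/-- Barycentric subdivision: the cone from the barycenter `b l` over the subdivided boundary. -/
def subdiv (b : List K → K) (Φ : List K → R) (l : List K) : R := subdivAux b l.length Φ l

/-- Auxiliary recursion for `subdivHtpy`, on the length of the list. -/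
def subdivHtpyAux (b : List K → K) : ℕ → (List K → R) → List K → R
  | 0, _, _ => 0
  | n + 1, Φ, l => Φ (b l :: l) - bd (subdivHtpyAux b n fun l' => Φ (b l :: l')) l

/-- The homotopy between barycentric subdivision and the identity. -/
def subdivHtpy (b : List K → K) (Φ : List K → R) (l : List K) : R := subdivHtpyAux b l.length Φ l

lemma subdiv_nil (b : List K → K) (Φ : List K → R) : subdiv b Φ [] = Φ [] := rfl

lemma subdivHtpy_nil (b : List K → K) (Φ : List K → R) : subdivHtpy b Φ [] = 0 := rfl

/-- All faces of `l` have the same length, so the length counter in the auxiliary recursion agrees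
with the length on each of them and can be forgotten. -/
lemma subdiv_of_ne_nil (b : List K → K) (Φ : List K → R) {l : List K} (hl : l ≠ []) :
    subdiv b Φ l = bd (subdiv b fun l' => Φ (b l :: l')) l := by
  obtain ⟨n, hn⟩ : ∃ n, l.length = n + 1 :=
    Nat.exists_eq_succ_of_ne_zero (by simpa using hl)
  rw [subdiv, hn]
  exact bd_congr fun l' hl' => by rw [subdiv, show l'.length = n by omega]

lemma subdivHtpy_of_ne_nil (b : List K → K) (Φ : List K → R) {l : List K} (hl : l ≠ []) :
    subdivHtpy b Φ l = Φ (b l :: l) - bd (subdivHtpy b fun l' => Φ (b l :: l')) l := by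
  obtain ⟨n, hn⟩ : ∃ n, l.length = n + 1 :=
    Nat.exists_eq_succ_of_ne_zero (by simpa using hl)
  rw [subdivHtpy, hn, subdivHtpyAux]
  congr 1
  refine bd_congr fun l' hl' => ?_
  obtain rfl : l'.length = n := by omega
  rfl

lemma subdivHtpy_sub (b : List K → K) (Φ Ψ : List K → R) (l : List K) :
    subdivHtpy b (fun l => Φ l - Ψ l) l = subdivHtpy b Φ l - subdivHtpy b Ψ l := by
  induction hn : l.length using Nat.strong_induction_on generalizing Φ Ψ l with
  | _ n ih =>
    by_cases hl : l = []
    · simp [hl, subdivHtpy_nil]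
    · rw [subdivHtpy_of_ne_nil _ _ hl, subdivHtpy_of_ne_nil _ _ hl, subdivHtpy_of_ne_nil _ _ hl,
        bd_congr fun l' hl' => ih l'.length (by omega) _ _ l' rfl, bd_sub]
      ring

lemma subdivHtpy_zero (b : List K → K) (l : List K) :
    subdivHtpy b (fun _ => (0 : R)) l = 0 := by
  simpa using subdivHtpy_sub b (fun _ => (0 : R)) (fun _ => 0) l

/-- The cone from `b l` contracts the list complex. Feeding the identity for the faces of `l` into
the cone formula leaves only a double coboundary, which is zero. Nothing is assumed about `b`. -/
lemma bd_subdivHtpy (b : List K → K) (Φ : List K → R) (l : List K) :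
    bd (subdivHtpy b Φ) l + subdivHtpy b (bd Φ) l = Φ l - subdiv b Φ l := by
  induction hn : l.length using Nat.strong_induction_on generalizing Φ l with
  | _ n ih =>
    by_cases hl : l = []
    · simp [hl, subdivHtpy_nil, subdiv_nil]
    · rw [subdivHtpy_of_ne_nil _ _ hl, subdiv_of_ne_nil _ _ hl]
      have h1 : bd (subdivHtpy b fun l' => bd Φ (b l :: l')) l =
          bd (fun l' => subdivHtpy b Φ l' + bd (subdivHtpy b fun l' => Φ (b l :: l')) l' -
            (Φ (b l :: l') - subdiv b (fun l' => Φ (b l :: l')) l')) l := by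
        refine bd_congr fun l' hl' => ?_
        simp only [bd_cons, subdivHtpy_sub]
        rw [← ih l'.length (by omega) (fun l' => Φ (b l :: l')) l' rfl]
        ring
      rw [h1, bd_sub, bd_add, bd_bd, bd_sub, bd_cons]
      ring

lemma subdivHtpy_bd_of_bd_eq_zero (b : List K → K) {Φ : List K → R} (h : ∀ l, bd Φ l = 0)
    (l : List K) : bd (subdivHtpy b Φ) l = Φ l - subdiv b Φ l := by
  rw [← bd_subdivHtpy, show bd Φ = fun _ => 0 from funext h, subdivHtpy_zero, add_zero]

/-- For a cocycle the homotopy formula exhibits the subdivision as the cocycle minus a coboundary,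
so a separate chain map property is not needed. -/
lemma bd_subdiv_eq_zero (b : List K → K) {Φ : List K → R} (h : ∀ l, bd Φ l = 0) (l : List K) :
    bd (subdiv b Φ) l = 0 := by
  have : subdiv b Φ = fun l => Φ l - bd (subdivHtpy b Φ) l := by
    funext l
    rw [subdivHtpy_bd_of_bd_eq_zero b h]
    ring
  rw [this, bd_sub, bd_bd, h, sub_zero]

lemma subdiv_map {b : List K → K} {b' : List L → L} {f : K → L}
    (hf : ∀ l ≠ [], f (b l) = b' (l.map f)) (Φ : List L → R) (l : List K) :
    subdiv b (fun l => Φ (l.map f)) l = subdiv b' Φ (l.map f) := by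
  induction hn : l.length using Nat.strong_induction_on generalizing Φ l with
  | _ n ih =>
    by_cases hl : l = []
    · simp [hl, subdiv_nil]
    · rw [subdiv_of_ne_nil _ _ hl, subdiv_of_ne_nil _ _ (by simpa using hl), ← bd_map]
      refine bd_congr fun l' hl' => ?_
      simp only [List.map_cons, hf l hl]
      exact ih l'.length (by omega) (fun l' => Φ (b' (l.map f) :: l')) l' rfl

lemma subdivHtpy_map {b : List K → K} {b' : List L → L} {f : K → L}
    (hf : ∀ l ≠ [], f (b l) = b' (l.map f)) (Φ : List L → R) (l : List K) :
    subdivHtpy b (fun l => Φ (l.map f)) l = subdivHtpy b' Φ (l.map f) := by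
  induction hn : l.length using Nat.strong_induction_on generalizing Φ l with
  | _ n ih =>
    by_cases hl : l = []
    · simp [hl, subdivHtpy_nil]
    · rw [subdivHtpy_of_ne_nil _ _ hl, subdivHtpy_of_ne_nil _ _ (by simpa using hl), ← bd_map]
      simp only [List.map_cons, hf l hl]
      congr 1
      exact bd_congr fun l' hl' =>
        ih l'.length (by omega) (fun l' => Φ (b' (l.map f) :: l')) l' rfl

/-- The value of the subdivision at `l` only involves lists of barycenters of sublists of `l`, each
of which is a sublist of the preceding one. -/
lemma subdiv_eq_zero (b : List K → K) {Φ : List K → R} {l : List K} (P : K → K → Prop)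
    (hP : ∀ s t, List.Sublist s l → List.Sublist t s → t ≠ [] → P (b s) (b t))
    (hΦ : ∀ l', l'.length = l.length → l'.Pairwise P → Φ l' = 0) : subdiv b Φ l = 0 := by
  -- The induction must remember that the entries are barycenters of nonempty sublists: only then
  -- can `hP` compare them with the newly prepended `b l`.
  suffices H : ∀ (n : ℕ) (l : List K) (Φ : List K → R), l.length = n →
      (∀ s t, List.Sublist s l → List.Sublist t s → t ≠ [] → P (b s) (b t)) →
      (∀ l', l'.length = l.length → (∀ x ∈ l', ∃ s, List.Sublist s l ∧ s ≠ [] ∧ x = b s) →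
        l'.Pairwise P → Φ l' = 0) → subdiv b Φ l = 0 from
    H _ l Φ rfl hP fun l' h1 _ h2 => hΦ l' h1 h2
  intro n
  induction n with
  | zero =>
    intro l Φ hl _ hΦ
    obtain rfl := List.eq_nil_of_length_eq_zero hl
    exact hΦ [] rfl (by simp) (by simp)
  | succ n ih =>
    intro l Φ hl hP hΦ
    have hne : l ≠ [] := by rintro rfl; simp at hl
    rw [subdiv_of_ne_nil _ _ hne, bd_congr_eraseIdx (Ψ := fun _ => 0), bd_zero]
    intro i hi
    have hlen : (l.eraseIdx i).length = n := by
      rw [List.length_eraseIdx_of_lt hi]; omega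
    have hsub : List.Sublist (l.eraseIdx i) l := List.eraseIdx_sublist l i
    refine ih _ _ hlen (fun s t hs => hP s t (hs.trans hsub)) fun l' h1 h2 h3 => hΦ _ ?_ ?_ ?_
    · simp; omega
    · intro x hx
      rcases List.mem_cons.1 hx with rfl | hx
      · exact ⟨l, List.Sublist.refl l, hne, rfl⟩
      · obtain ⟨s, hs, hs'⟩ := h2 x hx
        exact ⟨s, hs.trans hsub, hs'⟩
    · refine List.pairwise_cons.2 ⟨fun x hx => ?_, h3⟩
      obtain ⟨s, hs, hs', rfl⟩ := h2 x hx
      exact hP l s (List.Sublist.refl l) (hs.trans hsub) hs'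

end Lists

/-! ### Shuffle product -/

section Shuffle

variable {A B A' B' : Type*} {R : Type*} [CommRing R]

/-- Evaluation of a function on lists of pairs on the shuffle product of two lists, that is, the
signed sum over all lattice paths from the first to the last pair of entries. -/
def shuffle : (List (A × B) → R) → List A → List B → R
  | _, [], _ => 0
  | _, _ :: _, [] => 0
  | Φ, x :: xs, y :: ys =>
    -- The first term is the end of a path. A step in the second direction has to pass all remaining
    -- steps in the first direction, of which there are `xs.length`; this is its sign.
    (if xs = [] ∧ ys = [] then Φ [(x, y)] else 0) +
      (shuffle (fun l => Φ ((x, y) :: l)) xs (y :: ys) +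
        (-1) ^ xs.length * shuffle (fun l => Φ ((x, y) :: l)) (x :: xs) ys)
  termination_by _ X Y => X.length + Y.length

@[simp] lemma shuffle_nil_left (Φ : List (A × B) → R) (Y : List B) : shuffle Φ [] Y = 0 := by
  rw [shuffle]

@[simp] lemma shuffle_nil_right (Φ : List (A × B) → R) (X : List A) : shuffle Φ X [] = 0 := by
  cases X <;> rw [shuffle]

lemma shuffle_cons_cons (Φ : List (A × B) → R) (x : A) (xs : List A) (y : B) (ys : List B) :
    shuffle Φ (x :: xs) (y :: ys) = (if xs = [] ∧ ys = [] then Φ [(x, y)] else 0) +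
      (shuffle (fun l => Φ ((x, y) :: l)) xs (y :: ys) +
        (-1) ^ xs.length * shuffle (fun l => Φ ((x, y) :: l)) (x :: xs) ys) := by
  rw [shuffle]

/-- Induction on the total length of two lists, as in the definition of `shuffle`. -/
lemma shuffle_induction {P : List A → List B → Prop} (hl : ∀ Y, P [] Y) (hr : ∀ X, P X [])
    (h : ∀ x xs y ys, P xs (y :: ys) → P (x :: xs) ys → P (x :: xs) (y :: ys)) (X : List A)
    (Y : List B) : P X Y := by
  induction hn : X.length + Y.length using Nat.strong_induction_on generalizing X Y with
  | _ n ih =>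
    match X, Y with
    | [], Y => exact hl Y
    | X, [] => exact hr X
    | x :: xs, y :: ys =>
      simp only [List.length_cons] at hn
      exact h _ _ _ _ (ih _ (by simp only [List.length_cons]; omega) xs (y :: ys) rfl)
        (ih _ (by simp only [List.length_cons]; omega) (x :: xs) ys rfl)

lemma shuffle_sub (Φ Ψ : List (A × B) → R) (X : List A) (Y : List B) :
    shuffle (fun l => Φ l - Ψ l) X Y = shuffle Φ X Y - shuffle Ψ X Y := by
  induction X, Y using shuffle_induction generalizing Φ Ψ with
  | hl Y => simp
  | hr X => simp
  | h x xs y ys h1 h2 =>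
    simp only [shuffle_cons_cons, h1, h2]
    split_ifs <;> ring

lemma shuffle_mul_left (c : R) (Φ : List (A × B) → R) (X : List A) (Y : List B) :
    shuffle (fun l => c * Φ l) X Y = c * shuffle Φ X Y := by
  induction X, Y using shuffle_induction generalizing Φ with
  | hl Y => simp
  | hr X => simp
  | h x xs y ys h1 h2 =>
    simp only [shuffle_cons_cons, h1, h2]
    split_ifs <;> ring

lemma shuffle_zero (X : List A) (Y : List B) : shuffle (fun _ => (0 : R)) X Y = 0 := by
  simpa using shuffle_sub (fun _ => (0 : R)) (fun _ => 0) X Y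

lemma shuffle_map (f : A → A') (g : B → B') (Φ : List (A' × B') → R) (X : List A) (Y : List B) :
    shuffle (fun l => Φ (l.map (Prod.map f g))) X Y = shuffle Φ (X.map f) (Y.map g) := by
  induction X, Y using shuffle_induction generalizing Φ with
  | hl Y => simp
  | hr X => simp
  | h x xs y ys h1 h2 =>
    simp only [List.map_cons, shuffle_cons_cons, Prod.map, List.map_eq_nil_iff, List.length_map,
      List.map_nil]
    rw [h1 fun l => Φ ((f x, g y) :: l), h2 fun l => Φ ((f x, g y) :: l)]
    simp

/-- The shuffle product involves only finitely many lists. -/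
lemma exists_finset_shuffle_eq_zero (X : List A) (Y : List B) :
    ∃ S : Set (List (A × B)), S.Finite ∧ ∀ Φ : List (A × B) → R, (∀ l ∈ S, Φ l = 0) →
      shuffle Φ X Y = 0 := by
  induction X, Y using shuffle_induction with
  | hl Y => exact ⟨∅, Set.finite_empty, by simp⟩
  | hr X => exact ⟨∅, Set.finite_empty, by simp⟩
  | h x xs y ys h1 h2 =>
    obtain ⟨S, hS, h1⟩ := h1
    obtain ⟨T, hT, h2⟩ := h2
    refine ⟨{[(x, y)]} ∪ (List.cons (x, y) '' S ∪ List.cons (x, y) '' T),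
      (Set.finite_singleton _).union ((hS.image _).union (hT.image _)), fun Φ hΦ => ?_⟩
    rw [shuffle_cons_cons, h1, h2, hΦ]
    · simp
    · simp
    · exact fun l hl => hΦ _ (Or.inr (Or.inr ⟨l, hl, rfl⟩))
    · exact fun l hl => hΦ _ (Or.inr (Or.inl ⟨l, hl, rfl⟩))

/-- The Leibniz rule for the shuffle product. -/
lemma shuffle_bd (Φ : List (A × B) → R) (X : List A) (Y : List B) :
    shuffle (bd Φ) X Y = bd (fun X' => shuffle Φ X' Y) X +
      (-1) ^ (X.length + 1) * bd (fun Y' => shuffle Φ X Y') Y +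
      -- Effect of the augmentation: the face of a single pair is `[]`, whereas a shuffle with `[]`
      -- is zero.
      (if X.length = 1 ∧ Y.length = 1 then Φ [] else 0) := by
  induction X, Y using shuffle_induction generalizing Φ with
  | hl Y => simp [bd_zero]
  | hr X => simp [bd_zero]
  | h x xs y ys h1 h2 =>
    -- The faces of `xs` are shorter by one, so the shuffle sign flips when it is pulled out of the
    -- coboundary.
    have key' : ∀ g : List A → R, bd (fun l' => (-1) ^ l'.length * g l') xs =
        - ((-1) ^ xs.length * bd g xs) := by
      intro g
      rw [← neg_mul, ← bd_mul_left]
      refine bd_congr fun l' hl' => ?_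
      rw [← hl', pow_succ]
      ring
    rw [shuffle_cons_cons]
    simp only [bd_cons, shuffle_sub, bd_nil]
    rw [h1, h2]
    have e1 : bd (fun l' => shuffle Φ (x :: l') (y :: ys)) xs =
        (if xs.length = 1 ∧ ys = [] then Φ [(x, y)] else 0) +
        (bd (fun X' => shuffle (fun l => Φ ((x, y) :: l)) X' (y :: ys)) xs -
          (-1) ^ xs.length *
            bd (fun X' => shuffle (fun l => Φ ((x, y) :: l)) (x :: X') ys) xs) := by
      simp only [shuffle_cons_cons]
      rw [bd_add, bd_add, key', ← sub_eq_add_neg]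
      congr 1
      by_cases hy : ys = []
      · simp only [hy, and_true]
        exact bd_indicator_nil _ _
      · simp [hy, bd_zero]
    have e2 : bd (fun l' => shuffle Φ (x :: xs) (y :: l')) ys =
        (if xs = [] ∧ ys.length = 1 then Φ [(x, y)] else 0) +
        (bd (fun Y' => shuffle (fun l => Φ ((x, y) :: l)) xs (y :: Y')) ys +
          (-1) ^ xs.length *
            bd (fun Y' => shuffle (fun l => Φ ((x, y) :: l)) (x :: xs) Y') ys) := by
      simp only [shuffle_cons_cons]
      rw [bd_add, bd_add, bd_mul_left]
      congr 1
      by_cases hx : xs = []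
      · simp only [hx, true_and]
        exact bd_indicator_nil _ _
      · simp [hx, bd_zero]
    rw [e1, e2]
    simp only [bd_cons, List.length_cons, Nat.add_eq_right, List.length_eq_zero_iff, pow_succ]
    ring_nf

lemma shuffle_singleton_left (Φ : List (A × B) → R) (x : A) {Y : List B} (hY : Y ≠ []) :
    shuffle Φ [x] Y = Φ (Y.map fun y => (x, y)) := by
  induction Y generalizing Φ with
  | nil => exact absurd rfl hY
  | cons y ys ih =>
    rw [shuffle_cons_cons]
    by_cases h : ys = []
    · simp [h]
    · simp [h, ih]

lemma shuffle_singleton_right (Φ : List (A × B) → R) (y : B) {X : List A} (hX : X ≠ []) :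
    shuffle Φ X [y] = Φ (X.map fun x => (x, y)) := by
  induction X generalizing Φ with
  | nil => exact absurd rfl hX
  | cons x xs ih =>
    rw [shuffle_cons_cons]
    by_cases h : xs = []
    · simp [h]
    · simp [h, ih]

/-- If `Φ` kills all lists of pairs whose first components have a repetition early on, then only the
lattice path which first runs through the first list counts. -/
lemma shuffle_eq_of_repetition (Φ : List (A × B) → R) (X : List A) (a : A) (y : B) (ys : List B)
    (hΦ : ∀ pre x y y' post, List.length pre < X.length →
      Φ (pre ++ (x, y) :: (x, y') :: post) = 0) :
    shuffle Φ (X ++ [a]) (y :: ys) =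
      Φ (X.map (fun x => (x, y)) ++ (y :: ys).map fun z => (a, z)) := by
  induction X generalizing Φ with
  | nil => rw [List.nil_append, shuffle_singleton_left _ _ (by simp), List.map_nil, List.nil_append]
  | cons x X ih =>
    -- Paths that begin with a step in the second direction repeat `x` immediately.
    have h0 : shuffle (fun l => Φ ((x, y) :: l)) (x :: (X ++ [a])) ys = 0 := by
      cases ys with
      | nil => simp
      | cons z zs =>
        have : (fun l => Φ ((x, y) :: (x, z) :: l)) = fun _ => 0 :=
          funext fun l => hΦ [] x y z l (by simp)
        simp [shuffle_cons_cons, this, shuffle_zero]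
    rw [List.cons_append, shuffle_cons_cons, h0, ih]
    · simp
    · intro pre x' y1 y2 post h
      exact hΦ ((x, y) :: pre) x' y1 y2 post (by simpa using h)

end Shuffle

end SingCoh

end

noncomputable section

namespace SingCoh

universe u v w

/-! ### Affine simplices -/

/-- A space in which affine simplices with given vertices are available. -/
class AffineModel (K : Type*) [TopologicalSpace K] where
  /-- A base point. -/
  base : K
  /-- The affine simplex with given vertices. -/
  aff {k : ℕ} : (Fin (k + 1) → K) → Simplex K k
  aff_restrict {m k : ℕ} (v : Fin (k + 1) → K) (g : Fin (m + 1) → Fin (k + 1)) :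
    (aff v).restrict g = aff (v ∘ g)

open AffineModel

lemma Simplex.comp_restrict {X : Type*} [TopologicalSpace X] {Y : Type*} [TopologicalSpace Y]
    {m k : ℕ} (f : C(X, Y)) (σ : Simplex X k) (g : Fin (m + 1) → Fin (k + 1)) :
    f.comp (σ.restrict g) = Simplex.restrict g (f.comp σ) := rfl

lemma stdSimplex_map_apply {m k : ℕ} (g : Fin (m + 1) → Fin (k + 1))
    (t : stdSimplex ℝ (Fin (m + 1))) (j : Fin (k + 1)) :
    (stdSimplex.map g t).1 j = ∑ i, if g i = j then t.1 i else 0 := by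
  change (FunOnFinite.linearMap ℝ ℝ g t) j = _
  rw [FunOnFinite.linearMap_apply_apply, Finset.sum_filter]
  rfl

instance stdSimplex.instAffineModel (n : ℕ) : AffineModel (stdSimplex ℝ (Fin (n + 1))) where
  base := stdSimplex.vertex 0
  aff v := ⟨fun t => ⟨∑ i, t.1 i • (v i).1, (convex_stdSimplex ℝ _).sum_mem
    (fun i _ => t.2.1 i) t.2.2 fun i _ => (v i).2⟩,
    Continuous.subtype_mk (continuous_finsetSum _ fun i _ =>
      ((continuous_apply i).comp continuous_subtype_val).smul continuous_const) _⟩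
  aff_restrict v g := by
    ext t j
    simp only [Simplex.restrict, ContinuousMap.comp_apply, ContinuousMap.coe_mk]
    change (∑ i, (stdSimplex.map g t).1 i • (v i).1) j = (∑ i, t.1 i • (v (g i)).1) j
    simp only [stdSimplex_map_apply, Finset.sum_smul, ite_smul, zero_smul]
    rw [Finset.sum_comm]
    simp

instance Prod.instAffineModel (K L : Type*) [TopologicalSpace K] [TopologicalSpace L]
    [AffineModel K] [AffineModel L] : AffineModel (K × L) where
  base := (base, base)
  aff v := (aff fun i => (v i).1).prodMk (aff fun i => (v i).2)
  aff_restrict v g := by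
    have h1 := aff_restrict (fun i => (v i).1) g
    have h2 := aff_restrict (fun i => (v i).2) g
    ext t
    · exact congrArg (fun σ => σ t) h1
    · exact congrArg (fun σ => σ t) h2

lemma coe_aff {n k : ℕ} (v : Fin (k + 1) → stdSimplex ℝ (Fin (n + 1)))
    (t : stdSimplex ℝ (Fin (k + 1))) : (aff v t).1 = ∑ i, t.1 i • (v i).1 := rfl

lemma aff_vertex_comp {n k : ℕ} (g : Fin (k + 1) → Fin (n + 1)) :
    aff (fun i => stdSimplex.vertex (S := ℝ) (g i)) =
      ⟨stdSimplex.map g, stdSimplex.continuous_map g⟩ := by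
  ext t j
  change (∑ i, t.1 i • (Pi.single (g i) 1 : Fin (n + 1) → ℝ)) j = (stdSimplex.map g t).1 j
  rw [stdSimplex_map_apply]
  simp [Pi.single_apply, eq_comm]

lemma comp_aff_vertex_comp {X : Type*} [TopologicalSpace X] {n k : ℕ} (σ : Simplex X n)
    (g : Fin (k + 1) → Fin (n + 1)) :
    σ.comp (aff fun i => stdSimplex.vertex (S := ℝ) (g i)) = σ.restrict g := by
  rw [aff_vertex_comp]; rfl

lemma Simplex.restrict_id {X : Type*} [TopologicalSpace X] {n : ℕ} (σ : Simplex X n) :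
    σ.restrict id = σ := by
  ext t
  simp [Simplex.restrict]

lemma comp_aff_vertex {X : Type*} [TopologicalSpace X] {n : ℕ} (σ : Simplex X n) :
    σ.comp (aff (stdSimplex.vertex (S := ℝ))) = σ := by
  have := comp_aff_vertex_comp σ id
  rwa [Simplex.restrict_id] at this

/-- The map of standard simplices given by `g` on vertices, as a continuous map. -/
def simplexMap {m k : ℕ} (g : Fin (m + 1) → Fin (k + 1)) :
    C(stdSimplex ℝ (Fin (m + 1)), stdSimplex ℝ (Fin (k + 1))) :=
  ⟨stdSimplex.map g, stdSimplex.continuous_map g⟩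

lemma simplexMap_vertex {m k : ℕ} (g : Fin (m + 1) → Fin (k + 1)) (i : Fin (m + 1)) :
    simplexMap g (stdSimplex.vertex i) = stdSimplex.vertex (g i) := stdSimplex.map_vertex g i

/-- A continuous map of affine models which maps affine simplices to affine simplices. -/
def IsAffine {K L : Type*} [TopologicalSpace K] [TopologicalSpace L] [AffineModel K]
    [AffineModel L] (f : C(K, L)) : Prop :=
  ∀ {k : ℕ} (v : Fin (k + 1) → K), f.comp (aff v) = aff (f ∘ v)

lemma isAffine_id {K : Type*} [TopologicalSpace K] [AffineModel K] :
    IsAffine (ContinuousMap.id K) := fun _ => rfl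

lemma coe_simplexMap {m k : ℕ} (g : Fin (m + 1) → Fin (k + 1))
    (t : stdSimplex ℝ (Fin (m + 1))) :
    (simplexMap g t).1 = FunOnFinite.linearMap ℝ ℝ g t.1 := rfl

lemma isAffine_simplexMap {m k : ℕ} (g : Fin (m + 1) → Fin (k + 1)) :
    IsAffine (simplexMap g) := by
  intro l v
  ext1 t
  apply Subtype.ext
  simp only [ContinuousMap.comp_apply, coe_simplexMap, coe_aff, map_sum, map_smul,
    Function.comp_apply]

lemma IsAffine.prodMap {K L K' L' : Type*} [TopologicalSpace K] [TopologicalSpace L]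
    [AffineModel K] [AffineModel L] [TopologicalSpace K'] [TopologicalSpace L']
    [AffineModel K'] [AffineModel L'] {f : C(K, K')} {g : C(L, L')} (hf : IsAffine f)
    (hg : IsAffine g) : IsAffine (f.prodMap g) := by
  intro k v
  ext t
  · exact congrArg (fun σ => σ t) (hf fun i => (v i).1)
  · exact congrArg (fun σ => σ t) (hg fun i => (v i).2)

/-! ### Singular cochains as functions on lists of vertices -/

section Lev

variable {X : Type u} [TopologicalSpace X] {R : Type v} [CommRing R]
  {K L : Type*} [TopologicalSpace K] [AffineModel K] [TopologicalSpace L] [AffineModel L]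

/-- Evaluation of a cochain on the images of affine simplices under a map `G : K → X`. -/
def lev {k : ℕ} (φ : Cochain X R k) (G : C(K, X)) (l : List K) : R :=
  if l.length = k + 1 then φ (G.comp (aff fun i : Fin (k + 1) => l.getD i base)) else 0

lemma lev_of_length_eq {k : ℕ} (φ : Cochain X R k) (G : C(K, X)) {l : List K}
    (h : l.length = k + 1) :
    lev φ G l = φ (G.comp (aff fun i : Fin (k + 1) => l.getD i base)) := if_pos h

lemma lev_ofFn {k : ℕ} (φ : Cochain X R k) (G : C(K, X)) (v : Fin (k + 1) → K) :
    lev φ G (List.ofFn v) = φ (G.comp (aff v)) := by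
  rw [lev_of_length_eq _ _ (by simp)]
  congr 3
  funext i
  rw [List.getD_eq_getElem _ _ (by rw [List.length_ofFn]; exact i.2), List.getElem_ofFn]

/-- Extension by zero to lists of the wrong length makes this hold for every `l`. The augmentation
does no harm, since `lev` is zero at `[]`. -/
lemma bd_lev {k : ℕ} (φ : Cochain X R k) (G : C(K, X)) (l : List K) :
    bd (lev φ G) l = lev (coboundary X R k φ) G l := by
  by_cases h : l.length = k + 2
  · rw [bd_eq_sum _ h, lev_of_length_eq _ _ h, coboundary_apply]
    refine Finset.sum_congr rfl fun i _ => ?_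
    rw [lev_of_length_eq _ _ (by rw [List.length_eraseIdx_of_lt (by omega), h]; rfl),
      ← Simplex.comp_restrict, aff_restrict]
    congr 4
    funext j
    simp only [Function.comp, List.getD_eq_getElem?_getD, List.getElem?_eraseIdx, Fin.succAbove,
      Fin.lt_def, Fin.val_castSucc]
    split_ifs <;> simp
  · rw [lev, if_neg h]
    cases l with
    | nil => rfl
    | cons a l =>
      rw [bd_congr (Ψ := fun _ => 0), bd_zero]
      intro l' hl'
      rw [lev, if_neg]
      simp only [List.length_cons] at *
      omega

lemma lev_zero {k : ℕ} (G : C(K, X)) (l : List K) : lev (0 : Cochain X R k) G l = 0 := by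
  simp [lev]

lemma lev_smul {k : ℕ} (c : R) (φ : Cochain X R k) (G : C(K, X)) (l : List K) :
    lev (c • φ) G l = c * lev φ G l := by
  unfold lev; split_ifs <;> simp

lemma lev_comp {k : ℕ} (φ : Cochain X R k) (G : C(L, X)) {f : C(K, L)} (hf : IsAffine f)
    (l : List K) : lev φ (G.comp f) l = lev φ G (l.map f) := by
  unfold lev
  rw [List.length_map]
  split_ifs with h
  · rw [ContinuousMap.comp_assoc, hf]
    congr 3
    funext i
    have hi : (i : ℕ) < l.length := by omega
    simp [List.getD_eq_getElem?_getD, hi]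
  · rfl

end Lev

/-! ### Barycenters -/

section Bary

/-- The barycenter of a list of points of a standard simplex. -/
def bary {n : ℕ} (l : List (stdSimplex ℝ (Fin (n + 1)))) : stdSimplex ℝ (Fin (n + 1)) :=
  -- Truncated subtraction turns `[]` into the single vertex `base`, so no nonemptiness hypothesis
  -- is needed.
  aff (fun i : Fin (l.length - 1 + 1) => l.getD i base) stdSimplex.barycenter

lemma coe_bary {n : ℕ} {l : List (stdSimplex ℝ (Fin (n + 1)))} (hl : l ≠ []) :
    (bary l).1 = (l.length : ℝ)⁻¹ • (l.map Subtype.val).sum := by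
  obtain ⟨m, hm⟩ : ∃ m, l.length = m + 1 := Nat.exists_eq_succ_of_ne_zero (by simpa using hl)
  have h : l.length - 1 + 1 = l.length := by omega
  rw [bary, coe_aff]
  simp only [stdSimplex.barycenter_apply, Fintype.card_fin, h]
  rw [← Finset.smul_sum]
  congr 1
  rw [← (finCongr h).symm.sum_comp, ← Fin.sum_univ_getElem]
  rw [← (finCongr (show (l.map Subtype.val).length = l.length by simp)).symm.sum_comp]
  refine Finset.sum_congr rfl fun i _ => ?_
  simp [List.getD_eq_getElem?_getD]

lemma simplexMap_bary {m k : ℕ} (g : Fin (m + 1) → Fin (k + 1))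
    {l : List (stdSimplex ℝ (Fin (m + 1)))} (hl : l ≠ []) :
    simplexMap g (bary l) = bary (l.map (simplexMap g)) := by
  apply Subtype.ext
  rw [coe_simplexMap, coe_bary hl, coe_bary (by simpa using hl), map_smul, map_list_sum]
  simp [Function.comp_def, coe_simplexMap]

lemma norm_sum_sub_le {E : Type*} [SeminormedAddCommGroup E] {l : List E} {x : E} {r : ℝ}
    (h : ∀ y ∈ l, dist y x ≤ r) : ‖l.sum - l.length • x‖ ≤ l.length * r := by
  induction l with
  | nil => simp
  | cons a l ih =>
    have h1 : (a :: l).sum - (a :: l).length • x = (a - x) + (l.sum - l.length • x) := by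
      simp only [List.sum_cons, List.length_cons, succ_nsmul]; abel
    rw [h1]
    refine (norm_add_le _ _).trans ?_
    have h2 := ih fun y hy => h y (List.mem_cons_of_mem _ hy)
    have h3 := h a (by simp)
    rw [dist_eq_norm] at h3
    simp only [List.length_cons, Nat.cast_succ]
    linarith

lemma dist_mean_le {E : Type*} [SeminormedAddCommGroup E] [NormedSpace ℝ E] {l : List E}
    (hl : l ≠ []) {x : E} {r : ℝ} (h : ∀ y ∈ l, dist y x ≤ r) :
    dist ((l.length : ℝ)⁻¹ • l.sum) x ≤ r := by
  have hpos : (0 : ℝ) < l.length := by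
    exact_mod_cast List.length_pos_iff.2 hl
  have h1 : (l.length : ℝ)⁻¹ • l.sum - x = (l.length : ℝ)⁻¹ • (l.sum - l.length • x) := by
    rw [smul_sub, ← Nat.cast_smul_eq_nsmul ℝ, smul_smul, inv_mul_cancel₀ hpos.ne', one_smul]
  rw [dist_eq_norm, h1, norm_smul, Real.norm_eq_abs, abs_of_pos (inv_pos.2 hpos),
    inv_mul_le_iff₀ hpos]
  exact norm_sum_sub_le h

/-- One occurrence of `x` contributes nothing to the sum of the differences `y - x`, so only
`l.length - 1` of the `l.length` terms count. This is the source of the shrinking factor of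
barycentric subdivision. -/
lemma dist_mean_le_of_mem {E : Type*} [SeminormedAddCommGroup E] [NormedSpace ℝ E] {l : List E}
    {x : E} (hx : x ∈ l) {r : ℝ} (hr : 0 ≤ r) (h : ∀ y ∈ l, dist y x ≤ r) {m : ℕ}
    (hm : l.length ≤ m + 1) :
    dist ((l.length : ℝ)⁻¹ • l.sum) x ≤ (m / (m + 1 : ℝ)) * r := by
  classical
  have hpos : 0 < l.length := List.length_pos_of_mem hx
  have hpos' : (0 : ℝ) < l.length := by exact_mod_cast hpos
  have h1 : (l.length : ℝ)⁻¹ • l.sum - x = (l.length : ℝ)⁻¹ • (l.sum - l.length • x) := by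
    rw [smul_sub, ← Nat.cast_smul_eq_nsmul ℝ, smul_smul, inv_mul_cancel₀ hpos'.ne', one_smul]
  have hlen : (l.erase x).length + 1 = l.length := by
    rw [List.length_erase_of_mem hx]; omega
  have h2 : l.sum - l.length • x = (l.erase x).sum - (l.erase x).length • x := by
    rw [(List.perm_cons_erase hx).sum_eq, ← hlen, List.sum_cons, succ_nsmul]
    abel
  have h3 := norm_sum_sub_le (l := l.erase x) (x := x) (r := r)
    fun y hy => h y (List.mem_of_mem_erase hy)
  rw [dist_eq_norm, h1, norm_smul, Real.norm_eq_abs, abs_of_pos (inv_pos.2 hpos'),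
    inv_mul_le_iff₀ hpos', h2]
  refine h3.trans ?_
  rw [← mul_assoc]
  refine mul_le_mul_of_nonneg_right ?_ hr
  rw [mul_div_assoc', le_div_iff₀ (by positivity)]
  have h4 : ((l.erase x).length : ℝ) + 1 = l.length := by exact_mod_cast hlen
  have h5 : (l.length : ℝ) ≤ m + 1 := by exact_mod_cast hm
  nlinarith

/-- Every point of `t` is a point of `l`, hence this close to the mean of `l`; so is the mean of
`t`, by convexity of balls. -/
lemma dist_bary_le {n m : ℕ} {l t : List (stdSimplex ℝ (Fin (n + 1)))} (ht : t ≠ [])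
    (htl : ∀ x ∈ t, x ∈ l) {r : ℝ} (hr : 0 ≤ r) (h : ∀ x ∈ l, ∀ y ∈ l, dist x y ≤ r)
    (hm : l.length ≤ m + 1) : dist (bary l) (bary t) ≤ (m / (m + 1 : ℝ)) * r := by
  have hl : l ≠ [] := by
    obtain ⟨x, hx⟩ := List.exists_mem_of_ne_nil t ht
    exact List.ne_nil_of_mem (htl x hx)
  rw [Subtype.dist_eq, coe_bary hl, coe_bary ht, dist_comm]
  have h1 : ∀ y ∈ t.map Subtype.val, dist y ((l.length : ℝ)⁻¹ • (l.map Subtype.val).sum) ≤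
      (m / (m + 1 : ℝ)) * r := by
    intro y hy
    obtain ⟨y', hy', rfl⟩ := List.mem_map.1 hy
    have h2 : ∀ z ∈ l.map Subtype.val, dist z y'.1 ≤ r := by
      intro z hz
      obtain ⟨z', hz', rfl⟩ := List.mem_map.1 hz
      exact h z' hz' y' (htl y' hy')
    have h3 := dist_mean_le_of_mem (List.mem_map_of_mem (htl y' hy')) hr h2 (m := m)
      (by rwa [List.length_map])
    rwa [List.length_map, dist_comm] at h3
  have h4 := dist_mean_le (by rwa [ne_eq, List.map_eq_nil_iff]) h1
  rwa [List.length_map] at h4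

lemma dist_aff_le {n k : ℕ} (v : Fin (k + 1) → stdSimplex ℝ (Fin (n + 1)))
    (x : stdSimplex ℝ (Fin (n + 1))) {r : ℝ} (h : ∀ i, dist (v i) x ≤ r)
    (t : stdSimplex ℝ (Fin (k + 1))) : dist (aff v t) x ≤ r := by
  have := (convex_closedBall x.1 r).sum_mem (t := Finset.univ) (w := t.1)
    (z := fun i => (v i).1) (fun i _ => t.2.1 i) t.2.2 fun i _ => h i
  exact this

end Bary

/-! ### Iterated subdivision -/

section Iterate

variable {R : Type v} [CommRing R]

/-- All pairs of entries of `l` have distance at most `r`. -/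
def Small {n : ℕ} (r : ℝ) (l : List (stdSimplex ℝ (Fin (n + 1)))) : Prop :=
  ∀ x ∈ l, ∀ y ∈ l, dist x y ≤ r

lemma subdiv_eq_zero_of_small {n m : ℕ} {r : ℝ} (hr : 0 ≤ r)
    {Φ : List (stdSimplex ℝ (Fin (n + 1))) → R}
    (hΦ : ∀ l, l.length = m + 1 → Small ((m / (m + 1 : ℝ)) * r) l → Φ l = 0)
    {l : List (stdSimplex ℝ (Fin (n + 1)))} (hl : l.length = m + 1) (hs : Small r l) :
    subdiv bary Φ l = 0 := by
  have hr' : 0 ≤ (m / (m + 1 : ℝ)) * r := by positivity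
  refine subdiv_eq_zero bary (fun x y => dist x y ≤ (m / (m + 1 : ℝ)) * r)
    (fun s t hsl hts ht => ?_) fun l' hl' hp => hΦ l' (hl'.trans hl) ?_
  · refine dist_bary_le ht (fun x hx => hts.subset hx) hr
      (fun x hx y hy => hs x (hsl.subset hx) y (hsl.subset hy)) ?_
    rw [← hl]
    exact hsl.length_le
  · intro x hx y hy
    by_cases hxy : x = y
    · rw [hxy, dist_self]; exact hr'
    · have : Std.Symm fun x y : stdSimplex ℝ (Fin (n + 1)) => dist x y ≤ (m / (m + 1 : ℝ)) * r :=
        ⟨fun x y h => by rwa [dist_comm]⟩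
      exact hp.forall hx hy hxy

lemma iterate_subdiv_eq_zero_of_small {n m : ℕ} (N : ℕ) {r : ℝ} (hr : 0 ≤ r)
    {Φ : List (stdSimplex ℝ (Fin (n + 1))) → R}
    (hΦ : ∀ l, l.length = m + 1 → Small ((m / (m + 1 : ℝ)) ^ N * r) l → Φ l = 0)
    {l : List (stdSimplex ℝ (Fin (n + 1)))} (hl : l.length = m + 1) (hs : Small r l) :
    (subdiv bary)^[N] Φ l = 0 := by
  induction N generalizing Φ with
  | zero => exact hΦ l hl (by simpa using hs)
  | succ N ih =>
    rw [Function.iterate_succ_apply]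
    refine ih fun l' hl' hs' => subdiv_eq_zero_of_small (by positivity) ?_ hl' hs'
    intro l'' h1 h2
    refine hΦ l'' h1 ?_
    rwa [pow_succ', mul_assoc]

/-- The homotopy between the `N`-fold barycentric subdivision and the identity. -/
def subdivHtpyIter {K : Type*} (b : List K → K) : ℕ → (List K → R) → List K → R
  | 0, _, _ => 0
  | N + 1, Φ, l => subdivHtpy b Φ l + subdivHtpyIter b N (subdiv b Φ) l

/-- The one-step homotopy formulas telescope, because each subdivision of a cocycle is again a
cocycle. -/
lemma bd_subdivHtpyIter {K : Type*} (b : List K → K) (N : ℕ) {Φ : List K → R}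
    (h : ∀ l, bd Φ l = 0) (l : List K) :
    bd (subdivHtpyIter b N Φ) l = Φ l - (subdiv b)^[N] Φ l := by
  induction N generalizing Φ with
  | zero => simp [subdivHtpyIter, bd_zero]
  | succ N ih =>
    simp only [subdivHtpyIter, bd_add]
    rw [ih (bd_subdiv_eq_zero b h), subdivHtpy_bd_of_bd_eq_zero b h, Function.iterate_succ_apply]
    ring

/-- Naturality under face inclusions is what turns a construction on the standard simplex into an
operation on singular cochains. -/
lemma subdivHtpyIter_map {K L : Type*} {b : List K → K} {b' : List L → L} {f : K → L}
    (hf : ∀ l ≠ [], f (b l) = b' (l.map f)) (N : ℕ) (Φ : List L → R) (l : List K) :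
    subdivHtpyIter b N (fun l => Φ (l.map f)) l = subdivHtpyIter b' N Φ (l.map f) := by
  induction N generalizing Φ with
  | zero => rfl
  | succ N ih =>
    simp only [subdivHtpyIter]
    rw [subdivHtpy_map hf, ← ih]
    congr 2
    funext l
    exact subdiv_map hf Φ l

end Iterate

/-! ### Cocycles vanishing on small simplices -/

section SmallSimplices

variable {X : Type u} [TopologicalSpace X] {R : Type v} [CommRing R]

/-- The list of vertices of the standard simplex. -/
def vertices (n : ℕ) : List (stdSimplex ℝ (Fin (n + 1))) := List.ofFn stdSimplex.vertex

lemma length_vertices (n : ℕ) : (vertices n).length = n + 1 := by simp [vertices]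

lemma lev_vertices {n : ℕ} (φ : Cochain X R n) (σ : Simplex X n) :
    lev φ σ (vertices n) = φ σ := by
  rw [vertices, lev_ofFn, comp_aff_vertex]

lemma vertices_eraseIdx (n : ℕ) (i : Fin (n + 2)) :
    (vertices (n + 1)).eraseIdx i = (vertices n).map (simplexMap i.succAbove) := by
  apply List.ext_getElem
  · rw [List.length_eraseIdx_of_lt (by simp [length_vertices]; omega)]
    simp [length_vertices]
  · intro j h1 h2
    simp only [vertices, List.map_ofFn, List.getElem_ofFn, List.getElem_eraseIdx,
      Function.comp_apply, simplexMap_vertex]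
    have hj : j < n + 1 := by simpa [vertices] using h2
    simp only [Fin.succAbove, Fin.lt_def, Fin.castSucc_mk, Fin.succ_mk]
    split_ifs <;> rfl

lemma bd_vertices (n : ℕ) (Φ : List (stdSimplex ℝ (Fin (n + 2))) → R) :
    bd Φ (vertices (n + 1)) =
      ∑ i : Fin (n + 2), (-1 : R) ^ (i : ℕ) * Φ ((vertices n).map (simplexMap i.succAbove)) := by
  rw [bd_eq_sum Φ (length_vertices (n + 1))]
  simp only [vertices_eraseIdx]

lemma small_vertices (n : ℕ) : Small 1 (vertices n) := by
  intro x _ y _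
  have h := Metric.dist_le_diam_of_mem (bounded_stdSimplex (ι := Fin (n + 1))) x.2 y.2
  exact h.trans (diam_stdSimplex_le (ι := Fin (n + 1)))

/-- For given finitely many simplices, a cocycle that vanishes on all simplices which are contained
in a member of an open cover is cohomologous to a cochain that vanishes on these simplices. -/
lemma exists_sub_coboundary_eq_zero {ι : Type*} {U : ι → Set X} (hU : ∀ j, IsOpen (U j))
    (hcov : ⋃ j, U j = Set.univ) {n : ℕ} {z : Cochain X R (n + 1)}
    (hz : z ∈ cocycles X R (n + 1))
    (hsmall : ∀ σ : Simplex X (n + 1), ∀ j, (∀ t, σ t ∈ U j) → z σ = 0)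
    {S : Set (Simplex X (n + 1))} (hS : S.Finite) :
    ∃ y : Cochain X R n, ∀ σ ∈ S, (z - coboundary X R n y) σ = 0 := by
  rw [cocycles, LinearMap.mem_ker] at hz
  -- A Lebesgue number for the pulled back cover is eventually larger than the mesh `((n + 1) / (n +
  -- 2)) ^ N` of the subdivision.
  have step : ∀ (σ : Simplex X (n + 1)), ∃ N₀, ∀ N ≥ N₀,
      (subdiv bary)^[N] (lev z σ) (vertices (n + 1)) = 0 := by
    intro σ
    obtain ⟨δ, hδ, H⟩ := lebesgue_number_lemma_of_metric (s := Set.univ)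
      (c := fun j => σ ⁻¹' U j) isCompact_univ (fun j => (hU j).preimage σ.continuous) (by
        rw [← Set.preimage_iUnion, hcov, Set.preimage_univ])
    have hlim := tendsto_pow_atTop_nhds_zero_of_lt_one
      (r := ((n + 1 : ℕ) / ((n + 1 : ℕ) + 1 : ℝ))) (by positivity)
      (by rw [div_lt_one (by positivity)]; linarith)
    obtain ⟨N₀, hN₀⟩ := Filter.eventually_atTop.1 (hlim.eventually_lt_const hδ)
    refine ⟨N₀, fun N hN => iterate_subdiv_eq_zero_of_small N zero_le_one (fun l hl hs => ?_)
      (length_vertices (n + 1)) (small_vertices (n + 1))⟩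
    rw [mul_one] at hs
    rw [lev_of_length_eq _ _ hl]
    have hmem : ∀ i : Fin (n + 1 + 1), l.getD i base ∈ l := by
      intro i
      have hi : (i : ℕ) < l.length := by omega
      rw [List.getD_eq_getElem _ _ hi]
      exact List.getElem_mem hi
    -- The ball around the first vertex contains all vertices, hence by convexity the whole affine
    -- simplex.
    obtain ⟨j, hj⟩ := H (l.getD (0 : Fin (n + 1 + 1)) base) trivial
    refine hsmall _ j fun t => hj ?_
    refine lt_of_le_of_lt (dist_aff_le _ _ (fun i => ?_) t) (hN₀ N hN)
    exact hs _ (hmem i) _ (hmem 0)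
  choose N₀ hN₀ using step
  -- Finiteness of `S` gives one number of subdivisions that serves all its simplices.
  obtain ⟨N, hN⟩ : ∃ N, ∀ σ ∈ S, N₀ σ ≤ N := by
    obtain ⟨N, hN⟩ := (hS.image N₀).bddAbove
    exact ⟨N, fun σ hσ => hN ⟨σ, hσ, rfl⟩⟩
  refine ⟨fun ρ => subdivHtpyIter bary N (lev z ρ) (vertices n), fun σ hσ => ?_⟩
  have hbd : ∀ l, bd (lev z σ) l = 0 := fun l => by rw [bd_lev, hz, lev_zero]
  have h1 := bd_subdivHtpyIter bary N hbd (vertices (n + 1))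
  rw [hN₀ σ N (hN σ hσ), lev_vertices, sub_zero, bd_vertices] at h1
  rw [Pi.sub_apply, coboundary_apply, ← h1, sub_eq_zero]
  refine Finset.sum_congr rfl fun i _ => ?_
  congr 1
  rw [← subdivHtpyIter_map fun l hl => simplexMap_bary i.succAbove hl]
  congr 1
  funext l
  exact (lev_comp z σ (isAffine_simplexMap i.succAbove) l).symm

end SmallSimplices

end SingCoh

end

noncomputable section

namespace SingCoh

universe u v w

open AffineModel

/-! ### Evaluation on products of simplices -/

section Product

variable {X : Type u} [TopologicalSpace X] {Y : Type w} [TopologicalSpace Y]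
variable {R : Type v} [CommRing R]

/-- Evaluation of a cochain of `X × Y` on the product of a simplex of `X` and one of `Y`, which is
cut into simplices by shuffles. -/
def prodEval {p q n : ℕ} (z : Cochain (X × Y) R n) (σ : Simplex X p) (τ : Simplex Y q) : R :=
  shuffle (lev z (σ.prodMap τ)) (vertices p) (vertices q)

lemma shuffle_lev_map_left {p p' q n : ℕ} (z : Cochain (X × Y) R n) (σ : Simplex X p)
    (τ : Simplex Y q) (g : Fin (p' + 1) → Fin (p + 1)) :
    shuffle (lev z (σ.prodMap τ)) ((vertices p').map (simplexMap g)) (vertices q) =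
      prodEval z (σ.restrict g) τ := by
  have h := shuffle_map (simplexMap g) id (lev z (σ.prodMap τ)) (vertices p') (vertices q)
  rw [List.map_id] at h
  rw [← h, prodEval]
  congr 1
  funext l
  exact (lev_comp z (σ.prodMap τ) (IsAffine.prodMap (isAffine_simplexMap g) isAffine_id) l).symm

lemma shuffle_lev_map_right {p q q' n : ℕ} (z : Cochain (X × Y) R n) (σ : Simplex X p)
    (τ : Simplex Y q) (g : Fin (q' + 1) → Fin (q + 1)) :
    shuffle (lev z (σ.prodMap τ)) (vertices p) ((vertices q').map (simplexMap g)) =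
      prodEval z σ (τ.restrict g) := by
  have h := shuffle_map id (simplexMap g) (lev z (σ.prodMap τ)) (vertices p) (vertices q')
  rw [List.map_id] at h
  rw [← h, prodEval]
  congr 1
  funext l
  exact (lev_comp z (σ.prodMap τ) (IsAffine.prodMap isAffine_id (isAffine_simplexMap g)) l).symm

/-- The shuffle Leibniz rule, dual to ∂(σ × τ) = ∂σ × τ ± σ × ∂τ. Both dimensions are positive, so
the augmentation term is absent. -/
lemma prodEval_coboundary {p q n : ℕ} (y : Cochain (X × Y) R n) (σ : Simplex X (p + 1))
    (τ : Simplex Y (q + 1)) :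
    prodEval (coboundary (X × Y) R n y) σ τ =
      coboundary X R p (fun ρ => prodEval y ρ τ) σ +
        (-1) ^ (p + 1) * coboundary Y R q (fun ρ => prodEval y σ ρ) τ := by
  have h : lev (coboundary (X × Y) R n y) (σ.prodMap τ) = bd (lev y (σ.prodMap τ)) :=
    funext fun l => (bd_lev y _ l).symm
  rw [prodEval, h, shuffle_bd, bd_vertices, bd_vertices, coboundary_apply, coboundary_apply,
    if_neg (by simp [length_vertices]), length_vertices]
  simp only [shuffle_lev_map_left, shuffle_lev_map_right]
  rw [pow_succ _ (p + 1 + 1), pow_succ _ (p + 1)]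
  ring

lemma prodEval_sub {p q n : ℕ} (y z : Cochain (X × Y) R n) (σ : Simplex X p) (τ : Simplex Y q) :
    prodEval (y - z) σ τ = prodEval y σ τ - prodEval z σ τ := by
  rw [prodEval, prodEval, prodEval, ← shuffle_sub]
  congr 1
  funext l
  unfold lev
  split_ifs <;> simp

lemma prodEval_smul {p q n : ℕ} (c : R) (z : Cochain (X × Y) R n) (σ : Simplex X p)
    (τ : Simplex Y q) : prodEval (c • z) σ τ = c * prodEval z σ τ := by
  rw [prodEval, prodEval, ← shuffle_mul_left]
  congr 1
  funext l
  exact lev_smul c z _ l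

lemma exists_finite_prodEval_eq_zero {p q : ℕ} (n : ℕ) (σ : Simplex X p) (τ : Simplex Y q) :
    ∃ S : Set (Simplex (X × Y) n), S.Finite ∧ ∀ z : Cochain (X × Y) R n,
      (∀ ρ ∈ S, z ρ = 0) → prodEval z σ τ = 0 := by
  obtain ⟨S, hS, H⟩ := exists_finset_shuffle_eq_zero (R := R) (vertices p) (vertices q)
  refine ⟨(fun l => (σ.prodMap τ).comp (aff fun i : Fin (n + 1) => l.getD i base)) '' S,
    hS.image _, fun z hz => H _ fun l hl => ?_⟩
  unfold lev
  split_ifs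
  · exact hz _ ⟨l, hl, rfl⟩
  · rfl

/-- The map which sends the vertex `i + 1` to `i` and fixes all other vertices. -/
def collapse {p : ℕ} (i : Fin p) (j : Fin (p + 1)) : Fin (p + 1) :=
  if j = i.succ then i.castSucc else j

/-- A cochain is normalized if it vanishes on degenerate simplices. -/
def IsNormalized {p : ℕ} (φ : Cochain X R p) : Prop :=
  ∀ (σ : Simplex X p) (i : Fin p), σ.restrict (collapse i) = σ → φ σ = 0

lemma IsNormalized.apply_comp_aff {K : Type*} [TopologicalSpace K] [AffineModel K] {p : ℕ}
    {φ : Cochain X R p} (hφ : IsNormalized φ) (G : C(K, X)) {v : Fin (p + 1) → K} (i : Fin p)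
    (hv : v i.succ = v i.castSucc) : φ (G.comp (aff v)) = 0 := by
  refine hφ _ i ?_
  rw [← Simplex.comp_restrict, aff_restrict]
  congr 2
  funext j
  simp only [Function.comp, collapse]
  split_ifs with h
  · rw [h, hv]
  · rfl

/-- Unless a lattice path first runs through all of `σ`, its front `p`-face projects to a degenerate
simplex of `X`, which `φ` kills. The surviving path splits into exactly `σ` and `τ`. -/
lemma prodEval_cochainCup {p q n : ℕ} (h : p + q = n) {φ : Cochain X R p} (hφ : IsNormalized φ)
    (ψ : Cochain Y R q) (σ : Simplex X p) (τ : Simplex Y q) :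
    prodEval (cochainCup h (cochainPullback ContinuousMap.fst p φ)
      (cochainPullback ContinuousMap.snd q ψ)) σ τ = φ σ * ψ τ := by
  subst h
  have e : ∀ l : List (stdSimplex ℝ (Fin (p + 1)) × stdSimplex ℝ (Fin (q + 1))),
      l.length = p + q + 1 →
      lev (cochainCup rfl (cochainPullback ContinuousMap.fst p φ)
        (cochainPullback ContinuousMap.snd q ψ)) (σ.prodMap τ) l =
      φ (σ.comp (aff fun i : Fin (p + 1) => (l.getD i base).1)) *
        ψ (τ.comp (aff fun i : Fin (q + 1) => (l.getD (p + i) base).2)) := by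
    intro l hl
    rw [lev_of_length_eq _ _ hl, cochainCup_apply, ← Simplex.comp_restrict,
      ← Simplex.comp_restrict, aff_restrict, aff_restrict]
    rfl
  have hX : vertices p =
      List.ofFn (fun i : Fin p => stdSimplex.vertex (S := ℝ) i.castSucc) ++
        [stdSimplex.vertex (Fin.last p)] := by
    rw [vertices, List.ofFn_succ', List.concat_eq_append]
  have hY : vertices q = stdSimplex.vertex 0 ::
      List.ofFn (fun i : Fin q => stdSimplex.vertex (S := ℝ) i.succ) := by
    rw [vertices, List.ofFn_succ]
  rw [prodEval, hX, hY, shuffle_eq_of_repetition, ← hY, e _ (by simp [length_vertices]; omega)]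
  · have h1 : (fun i : Fin (p + 1) => (((List.ofFn fun i : Fin p =>
        stdSimplex.vertex (S := ℝ) i.castSucc).map (fun x => (x, stdSimplex.vertex 0)) ++
        (vertices q).map fun z => (stdSimplex.vertex (Fin.last p), z)).getD i base).1) =
        stdSimplex.vertex := by
      funext i
      refine Fin.lastCases ?_ (fun i => ?_) i
      · rw [List.getD_append_right _ _ _ _ (by simp), List.getD_eq_getElem _ _
          (by simp [length_vertices])]
        simp
      · rw [List.getD_append _ _ _ _ (by simp), List.getD_eq_getElem _ _ (by simp)]
        simp
    have h2 : (fun i : Fin (q + 1) => (((List.ofFn fun i : Fin p =>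
        stdSimplex.vertex (S := ℝ) i.castSucc).map (fun x => (x, stdSimplex.vertex 0)) ++
        (vertices q).map fun z => (stdSimplex.vertex (Fin.last p), z)).getD (p + i) base).2) =
        stdSimplex.vertex := by
      funext i
      rw [List.getD_append_right _ _ _ _ (by simp), List.getD_eq_getElem _ _
        (by simp [length_vertices]; omega)]
      simp only [List.getElem_map, vertices, List.getElem_ofFn]
      congr 1
      ext
      simp
    rw [h1, h2, comp_aff_vertex, comp_aff_vertex]
  · intro pre x y y' post hpre
    rw [List.length_ofFn] at hpre
    by_cases hl : (pre ++ (x, y) :: (x, y') :: post).length = p + q + 1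
    · rw [e _ hl, hφ.apply_comp_aff σ ⟨pre.length, hpre⟩, zero_mul]
      simp [List.getD_eq_getElem?_getD]
    · rw [lev, if_neg hl]

end Product

/-! ### Pairing with cycles -/

section Cycle

variable {X : Type u} [TopologicalSpace X] {F : Type v} [Field F]

/-- The boundary of singular chains. -/
def boundary (X : Type u) [TopologicalSpace X] (F : Type v) [Field F] (n : ℕ) :
    (Simplex X (n + 1) →₀ F) →ₗ[F] (Simplex X n →₀ F) :=
  Finsupp.linearCombination F fun σ =>
    ∑ i : Fin (n + 2), (-1 : F) ^ (i : ℕ) • Finsupp.single (σ.restrict i.succAbove) 1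

lemma linearCombination_boundary {n : ℕ} (g : Cochain X F n) (a : Simplex X (n + 1) →₀ F) :
    Finsupp.linearCombination F g (boundary X F n a) =
      Finsupp.linearCombination F (coboundary X F n g) a := by
  rw [← LinearMap.comp_apply]
  congr 1
  ext σ
  simp [boundary, coboundary_apply]

/-- A cochain which is not a coboundary is detected by a cycle. -/
lemma exists_cycle {n : ℕ} {φ : Cochain X F (n + 1)} (hφ : φ ∉ coboundaries X F (n + 1)) :
    ∃ a : Simplex X (n + 1) →₀ F,
      (∀ g : Cochain X F n, ∑ σ ∈ a.support, a σ * coboundary X F n g σ = 0) ∧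
        ∑ σ ∈ a.support, a σ * φ σ ≠ 0 := by
  by_contra! H
  apply hφ
  have h1 : (Finsupp.linearCombination F φ : Module.Dual F _) ∈
      (LinearMap.ker (boundary X F n)).dualAnnihilator := by
    rw [Submodule.mem_dualAnnihilator]
    intro a ha
    have := H a fun g => ?_
    · simpa [Finsupp.linearCombination_apply, Finsupp.sum] using this
    · have h2 := linearCombination_boundary g a
      rw [LinearMap.mem_ker.1 ha, map_zero] at h2
      simpa [Finsupp.linearCombination_apply, Finsupp.sum] using h2.symm
  -- Over a field, a functional that vanishes on all cycles factors through the boundary map. The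
  -- factor `G`, evaluated on single simplices, is a primitive of `φ`.
  rw [← LinearMap.range_dualMap_eq_dualAnnihilator_ker] at h1
  obtain ⟨G, hG⟩ := h1
  refine ⟨fun σ => G (Finsupp.single σ 1), ?_⟩
  funext σ
  have := LinearMap.congr_fun hG (Finsupp.single σ 1)
  simp only [LinearMap.dualMap_apply, boundary, Finsupp.linearCombination_single, one_smul, map_sum,
    map_smul, smul_eq_mul] at this
  rw [coboundary_apply, this, one_mul]

/-- If `φ` is a normalized cocycle which is not a coboundary then there is a linear functional on
cochains of `X × X` which vanishes on coboundaries, only depends on the values on finitely many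
simplices and does not vanish on `φ × φ`. -/
lemma exists_functional {p : ℕ} {φ : Cochain X F (p + 1)} (hn : IsNormalized φ)
    (hφ : φ ∉ coboundaries X F (p + 1)) {n : ℕ} (h : p + 1 + (p + 1) = n + 1) :
    ∃ L : Cochain (X × X) F (n + 1) →ₗ[F] F,
      (∀ y, L (coboundary (X × X) F n y) = 0) ∧
      (∃ S : Set (Simplex (X × X) (n + 1)), S.Finite ∧ ∀ z, (∀ ρ ∈ S, z ρ = 0) → L z = 0) ∧
      L (cochainCup h (cochainPullback ContinuousMap.fst (p + 1) φ)
        (cochainPullback ContinuousMap.snd (p + 1) φ)) ≠ 0 := by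
  obtain ⟨a, ha, haφ⟩ := exists_cycle hφ
  have hsub := fun y z : Cochain (X × X) F (n + 1) =>
    prodEval_sub (p := p + 1) (q := p + 1) y z
  -- Evaluation on the cross product of the cycle `a` with itself; on `φ × φ` it gives the square of
  -- the pairing of `φ` with `a`.
  let L : Cochain (X × X) F (n + 1) →ₗ[F] F :=
    { toFun := fun z => ∑ σ ∈ a.support, ∑ τ ∈ a.support, a σ * a τ * prodEval z σ τ
      map_add' := fun y z => by
        have h0 : ∀ σ τ : Simplex X (p + 1),
            prodEval (y + z) σ τ = prodEval y σ τ + prodEval z σ τ := by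
          intro σ τ
          have := prodEval_sub (y + z) z σ τ
          rw [add_sub_cancel_right] at this
          rw [this]; ring
        simp only [h0, mul_add, Finset.sum_add_distrib]
      map_smul' := fun c z => by
        simp only [prodEval_smul, Finset.mul_sum, RingHom.id_apply, smul_eq_mul]
        exact Finset.sum_congr rfl fun σ _ => Finset.sum_congr rfl fun τ _ => by ring }
  have hL : ∀ z, L z = ∑ σ ∈ a.support, ∑ τ ∈ a.support, a σ * a τ * prodEval z σ τ := fun _ => rfl
  refine ⟨L, fun y => ?_, ?_, ?_⟩
  · rw [hL]
    simp only [prodEval_coboundary, mul_add, Finset.sum_add_distrib]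
    have h1 : ∑ σ ∈ a.support, ∑ τ ∈ a.support,
        a σ * a τ * coboundary X F p (fun ρ => prodEval y ρ τ) σ = 0 := by
      rw [Finset.sum_comm]
      refine Finset.sum_eq_zero fun τ _ => ?_
      have := ha fun ρ => prodEval y ρ τ
      rw [← mul_zero (a τ), ← this, Finset.mul_sum]
      exact Finset.sum_congr rfl fun σ _ => by ring
    have h2 : ∑ σ ∈ a.support, ∑ τ ∈ a.support, a σ * a τ * ((-1) ^ (p + 1) *
        coboundary X F p (fun ρ => prodEval y σ ρ) τ) = 0 := by
      refine Finset.sum_eq_zero fun σ _ => ?_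
      have := ha fun ρ => prodEval y σ ρ
      rw [← mul_zero (a σ * (-1) ^ (p + 1)), ← this, Finset.mul_sum]
      exact Finset.sum_congr rfl fun σ _ => by ring
    rw [h1, h2, add_zero]
  · choose S hS H using fun σ τ : Simplex X (p + 1) =>
      exists_finite_prodEval_eq_zero (R := F) (n + 1) σ τ
    refine ⟨⋃ σ ∈ a.support, ⋃ τ ∈ a.support, S σ τ,
      a.support.finite_toSet.biUnion fun σ _ => a.support.finite_toSet.biUnion fun τ _ => hS σ τ,
      fun z hz => ?_⟩
    rw [hL]
    refine Finset.sum_eq_zero fun σ hσ => Finset.sum_eq_zero fun τ hτ => ?_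
    rw [H σ τ z fun ρ hρ => hz ρ (Set.mem_biUnion hσ (Set.mem_biUnion hτ hρ)), mul_zero]
  · rw [hL]
    simp only [prodEval_cochainCup h hn]
    have : ∑ σ ∈ a.support, ∑ τ ∈ a.support, a σ * a τ * (φ σ * φ τ) =
        (∑ σ ∈ a.support, a σ * φ σ) * ∑ σ ∈ a.support, a σ * φ σ := by
      rw [Finset.sum_mul_sum]
      exact Finset.sum_congr rfl fun σ _ => Finset.sum_congr rfl fun τ _ => by ring
    rw [this]
    exact mul_ne_zero haφ haφ

end Cycle

end SingCoh

end

noncomputable section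

namespace SingCoh

universe u v w

/-! ### Cup products of classes of degree two -/

section CupTwo

variable {X : Type u} [TopologicalSpace X] {R : Type v} [CommRing R]

lemma mem_cocycles_iff {k : ℕ} {φ : Cochain X R k} :
    φ ∈ cocycles X R k ↔ coboundary X R k φ = 0 := Iff.rfl

lemma coboundary_mem_coboundaries {k : ℕ} (φ : Cochain X R k) :
    coboundary X R k φ ∈ coboundaries X R (k + 1) := ⟨φ, rfl⟩

/-- The cocycle condition on the simplex with vertices `i, j, k, l` of `σ`. The indices may repeat,
which gives the relations on degenerate simplices. -/
lemma sum_restrict_of_mem_cocycles {φ : Cochain X R 2} (hφ : φ ∈ cocycles X R 2) {n : ℕ}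
    (σ : Simplex X n) (i j k l : Fin (n + 1)) :
    φ (σ.restrict ![j, k, l]) - φ (σ.restrict ![i, k, l]) + φ (σ.restrict ![i, j, l]) -
      φ (σ.restrict ![i, j, k]) = 0 := by
  have h := congrFun hφ (σ.restrict ![i, j, k, l])
  have h0 : ![i, j, k, l] ∘ Fin.succAbove 0 = ![j, k, l] := by
    funext x; fin_cases x <;> rfl
  have h1 : ![i, j, k, l] ∘ Fin.succAbove 1 = ![i, k, l] := by
    funext x; fin_cases x <;> rfl
  have h2 : ![i, j, k, l] ∘ Fin.succAbove 2 = ![i, j, l] := by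
    funext x; fin_cases x <;> rfl
  have h3 : ![i, j, k, l] ∘ Fin.succAbove 3 = ![i, j, k] := by
    funext x; fin_cases x <;> rfl
  rw [coboundary_apply, Fin.sum_univ_four] at h
  simp only [Simplex.restrict_restrict, h0, h1, h2, h3] at h
  simpa [pow_succ, ← sub_eq_add_neg] using h

/-- Every cocycle of degree two is cohomologous to a normalized one. -/
lemma exists_isNormalized {φ : Cochain X R 2} (hφ : φ ∈ cocycles X R 2) :
    ∃ g : Cochain X R 1, IsNormalized (φ - coboundary X R 1 g) := by
  -- The correction is the value of `φ` on the constant triangle at the initial vertex. Its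
  -- coboundary at `σ` is the value on the constant triangle at the middle vertex, which the cocycle
  -- relations identify with `φ σ` when `σ` is degenerate.
  refine ⟨fun e => φ (e.restrict ![0, 0, 0]), fun σ i hσ => ?_⟩
  have e0 : Fin.succAbove (0 : Fin 3) ∘ ![(0 : Fin 2), 0, 0] = ![1, 1, 1] := by decide
  have e1 : Fin.succAbove (1 : Fin 3) ∘ ![(0 : Fin 2), 0, 0] = ![0, 0, 0] := by decide
  have e2 : Fin.succAbove (2 : Fin 3) ∘ ![(0 : Fin 2), 0, 0] = ![0, 0, 0] := by decide
  have h : (φ - coboundary X R 1 fun e => φ (e.restrict ![0, 0, 0])) σ =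
      φ σ - φ (σ.restrict ![1, 1, 1]) := by
    rw [Pi.sub_apply, coboundary_apply, Fin.sum_univ_three]
    simp only [Simplex.restrict_restrict, e0, e1, e2]
    simp
  rw [h]
  fin_cases i
  · have hc : collapse (0 : Fin 2) = ![0, 0, 2] := by decide
    have hc' : ![(0 : Fin 3), 0, 2] ∘ ![1, 1, 1] = ![0, 0, 0] := by decide
    have := sum_restrict_of_mem_cocycles hφ σ 0 0 0 2
    rw [Fin.mk_zero, hc] at hσ
    rw [← hσ, Simplex.restrict_restrict, hc']
    linear_combination this
  · have hc : collapse (1 : Fin 2) = ![0, 1, 1] := by decide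
    have hc' : ![(0 : Fin 3), 1, 1] ∘ ![1, 1, 1] = ![1, 1, 1] := by decide
    have := sum_restrict_of_mem_cocycles hφ σ 0 1 1 1
    rw [Fin.mk_one, hc] at hσ
    rw [← hσ, Simplex.restrict_restrict, hc']
    linear_combination - this

/-- Cup products of cocycles of degree two commute up to a coboundary. -/
lemma cochainCup_sub_cochainCup_mem_coboundaries {a b : Cochain X R 2}
    (ha : a ∈ cocycles X R 2) (hb : b ∈ cocycles X R 2) (h : 2 + 2 = 4) :
    cochainCup h a b - cochainCup h b a ∈ coboundaries X R 4 := by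
  -- Up to sign this is Steenrod's cup-one product of `a` and `b`.
  refine ⟨fun σ => a (σ.restrict ![0, 1, 3]) * b (σ.restrict ![1, 2, 3]) -
    a (σ.restrict ![0, 2, 3]) * b (σ.restrict ![0, 1, 2]), ?_⟩
  funext σ
  have ef : frontVertices h = ![0, 1, 2] := by funext i; fin_cases i <;> rfl
  have eb : backVertices h = ![2, 3, 4] := by funext i; fin_cases i <;> rfl
  rw [coboundary_apply, Pi.sub_apply, cochainCup_apply, cochainCup_apply, ef, eb,
    Fin.sum_univ_five]
  simp only [Simplex.restrict_restrict]
  rw [show (0 : Fin 5).succAbove ∘ ![0, 1, 3] = ![1, 2, 4] by decide,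
    show (0 : Fin 5).succAbove ∘ ![1, 2, 3] = ![2, 3, 4] by decide,
    show (0 : Fin 5).succAbove ∘ ![0, 2, 3] = ![1, 3, 4] by decide,
    show (0 : Fin 5).succAbove ∘ ![0, 1, 2] = ![1, 2, 3] by decide,
    show (1 : Fin 5).succAbove ∘ ![0, 1, 3] = ![0, 2, 4] by decide,
    show (1 : Fin 5).succAbove ∘ ![1, 2, 3] = ![2, 3, 4] by decide,
    show (1 : Fin 5).succAbove ∘ ![0, 2, 3] = ![0, 3, 4] by decide,
    show (1 : Fin 5).succAbove ∘ ![0, 1, 2] = ![0, 2, 3] by decide,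
    show (2 : Fin 5).succAbove ∘ ![0, 1, 3] = ![0, 1, 4] by decide,
    show (2 : Fin 5).succAbove ∘ ![1, 2, 3] = ![1, 3, 4] by decide,
    show (2 : Fin 5).succAbove ∘ ![0, 2, 3] = ![0, 3, 4] by decide,
    show (2 : Fin 5).succAbove ∘ ![0, 1, 2] = ![0, 1, 3] by decide,
    show (3 : Fin 5).succAbove ∘ ![0, 1, 3] = ![0, 1, 4] by decide,
    show (3 : Fin 5).succAbove ∘ ![1, 2, 3] = ![1, 2, 4] by decide,
    show (3 : Fin 5).succAbove ∘ ![0, 2, 3] = ![0, 2, 4] by decide,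
    show (3 : Fin 5).succAbove ∘ ![0, 1, 2] = ![0, 1, 2] by decide,
    show (4 : Fin 5).succAbove ∘ ![0, 1, 3] = ![0, 1, 3] by decide,
    show (4 : Fin 5).succAbove ∘ ![1, 2, 3] = ![1, 2, 3] by decide,
    show (4 : Fin 5).succAbove ∘ ![0, 2, 3] = ![0, 2, 3] by decide,
    show (4 : Fin 5).succAbove ∘ ![0, 1, 2] = ![0, 1, 2] by decide]
  have b1 := sum_restrict_of_mem_cocycles hb σ 0 1 2 3
  have b2 := sum_restrict_of_mem_cocycles hb σ 1 2 3 4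
  have a1 := sum_restrict_of_mem_cocycles ha σ 0 2 3 4
  have a2 := sum_restrict_of_mem_cocycles ha σ 0 1 3 4
  have a3 := sum_restrict_of_mem_cocycles ha σ 0 1 2 4
  simp only [Fin.val_zero, Fin.val_one, Fin.val_two, pow_zero, pow_one,
    show ((3 : Fin 5) : ℕ) = 3 from rfl, show ((4 : Fin 5) : ℕ) = 4 from rfl]
  set A := fun s => a (σ.restrict s)
  set B := fun s => b (σ.restrict s)
  change _ = A ![0, 1, 2] * B ![2, 3, 4] - B ![0, 1, 2] * A ![2, 3, 4]
  change B _ - B _ + B _ - B _ = 0 at b1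
  change B _ - B _ + B _ - B _ = 0 at b2
  change A _ - A _ + A _ - A _ = 0 at a1
  change A _ - A _ + A _ - A _ = 0 at a2
  change A _ - A _ + A _ - A _ = 0 at a3
  linear_combination B ![2, 3, 4] * a3 - A ![0, 1, 4] * b2 + B ![0, 1, 2] * a1 -
    B ![1, 2, 3] * a2 - A ![0, 3, 4] * b1

lemma cochainCup_assoc {p q r s t n : ℕ} (h : p + q = s) (h' : s + r = n) (h₁ : q + r = t)
    (h₂ : p + t = n) (a : Cochain X R p) (b : Cochain X R q) (c : Cochain X R r) :
    cochainCup h' (cochainCup h a b) c = cochainCup h₂ a (cochainCup h₁ b c) := by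
  subst h h₁ h'
  funext σ
  simp only [cochainCup_apply, Simplex.restrict_restrict]
  rw [mul_assoc]
  congr 3
  congr 1
  funext i
  ext
  simp [backVertices, Nat.add_assoc]

lemma one_cochainCup {p n : ℕ} (h : 0 + p = n) (b : Cochain X R p) (σ : Simplex X n) :
    cochainCup h (fun _ => 1) b σ = b (σ.restrict (backVertices h)) := by
  rw [cochainCup_apply, one_mul]

/-- The cup product of a list of cochains of degree two, in degree `n`; it is only meaningful if
`n` is twice the length of the list. -/
def cupList : List (Cochain X R 2) → (n : ℕ) → Cochain X R n
  | [], _ => fun _ => 1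
  | a :: l, n + 2 => cochainCup (Nat.add_comm 2 n) a (cupList l n)
  | _ :: _, 0 => 0
  | _ :: _, 1 => 0

lemma cupList_cons (a : Cochain X R 2) (l : List (Cochain X R 2)) {m n : ℕ} (h : 2 + m = n) :
    cupList (a :: l) n = cochainCup h a (cupList l m) := by
  obtain rfl : n = m + 2 := by omega
  rfl

lemma cupList_mem_cocycles {l : List (Cochain X R 2)} (hl : ∀ a ∈ l, a ∈ cocycles X R 2) {n : ℕ}
    (hn : 2 * l.length = n) : cupList l n ∈ cocycles X R n := by
  induction l generalizing n with
  | nil =>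
    obtain rfl : n = 0 := by simpa using hn.symm
    exact one_mem_cocycles
  | cons a l ih =>
    have h : 2 + 2 * l.length = n := by simp at hn; omega
    rw [cupList_cons a l h]
    exact cochainCup_mem_cocycles h (hl a (by simp))
      (ih (fun b hb => hl b (List.mem_cons_of_mem _ hb)) rfl)

lemma cupList_append (l l' : List (Cochain X R 2)) {p q n : ℕ} (hp : 2 * l.length = p)
    (h : p + q = n) : cupList (l ++ l') n = cochainCup h (cupList l p) (cupList l' q) := by
  induction l generalizing p n with
  | nil =>
    obtain rfl : p = 0 := by simpa using hp.symm
    obtain rfl : q = n := by omega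
    funext σ
    have : backVertices h = id := by funext i; ext; simp [backVertices]
    rw [cupList, one_cochainCup, this, Simplex.restrict_id]
    rfl
  | cons a l ih =>
    have h1 : 2 + 2 * l.length = p := by simp at hp; omega
    have h2 : 2 + (2 * l.length + q) = n := by omega
    rw [List.cons_append, cupList_cons a _ h2, cupList_cons a _ h1, ih rfl rfl,
      cochainCup_assoc]

/-- Front and back face share the vertex `p`, so the two collapsed neighbouring vertices lie
together in one of the two faces, which is then degenerate. -/
lemma isNormalized_cochainCup {p q n : ℕ} (h : p + q = n) {a : Cochain X R p}
    {b : Cochain X R q} (ha : IsNormalized a) (hb : IsNormalized b) :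
    IsNormalized (cochainCup h a b) := by
  subst h
  intro σ i hσ
  rw [cochainCup_apply]
  by_cases hi : (i : ℕ) < p
  · rw [ha _ ⟨i, hi⟩, zero_mul]
    conv_rhs => rw [← hσ]
    rw [Simplex.restrict_restrict, Simplex.restrict_restrict]
    congr 1
    funext j
    ext
    simp only [Function.comp, collapse, frontVertices, Fin.ext_iff, Fin.val_succ]
    split_ifs <;> rfl
  · rw [hb _ ⟨i - p, by omega⟩, mul_zero]
    conv_rhs => rw [← hσ]
    rw [Simplex.restrict_restrict, Simplex.restrict_restrict]
    congr 1
    funext j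
    ext
    simp only [Function.comp, collapse, backVertices, Fin.ext_iff, Fin.val_succ]
    split_ifs <;> simp <;> omega

lemma isNormalized_cupList {l : List (Cochain X R 2)} (hl : ∀ a ∈ l, IsNormalized a) {n : ℕ}
    (hn : 2 * l.length = n) : IsNormalized (cupList l n) := by
  induction l generalizing n with
  | nil =>
    obtain rfl : n = 0 := by simpa using hn.symm
    exact fun σ i => i.elim0
  | cons a l ih =>
    have h : 2 + 2 * l.length = n := by simp at hn; omega
    rw [cupList_cons a l h]
    exact isNormalized_cochainCup h (hl a (by simp))
      (ih (fun b hb => hl b (List.mem_cons_of_mem _ hb)) rfl)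

lemma cochainPullback_cupList {Y : Type w} [TopologicalSpace Y] (f : C(Y, X))
    (l : List (Cochain X R 2)) (n : ℕ) :
    cochainPullback f n (cupList l n) = cupList (l.map (cochainPullback f 2)) n := by
  induction l, n using cupList.induct with
  | case1 => rfl
  | case2 a l n ih =>
    rw [List.map_cons, cupList, cupList, ← ih]
    rfl
  | case3 => rfl
  | case4 => rfl

/-- Replacing the factors by cohomologous ones does not change the class of the product. -/
lemma cupList_sub_cupList_mem_coboundaries {l l' : List (Cochain X R 2)}
    (h : List.Forall₂ (fun a b => a ∈ cocycles X R 2 ∧ a - b ∈ coboundaries X R 2) l l') {n : ℕ}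
    (hn : 2 * l.length = n) : cupList l n - cupList l' n ∈ coboundaries X R n := by
  induction h generalizing n with
  | nil => rw [sub_self]; exact Submodule.zero_mem _
  | @cons a b l l' hab hll ih =>
    have h : 2 + 2 * l.length = n := by simp at hn; omega
    have hb : b ∈ cocycles X R 2 := by
      have := Submodule.sub_mem _ hab.1 (coboundaries_le_cocycles 2 hab.2)
      rwa [sub_sub_cancel] at this
    have hl : ∀ c ∈ l, c ∈ cocycles X R 2 := by
      clear ih hn h
      induction hll with
      | nil => simp
      | cons h _ ih => simpa using ⟨h.1, ih⟩
    rw [cupList_cons a l h, cupList_cons b l' h]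
    have e : cochainCup h a (cupList l (2 * l.length)) -
        cochainCup h b (cupList l' (2 * l.length)) =
        cochainCup h (a - b) (cupList l (2 * l.length)) +
          cochainCup h b (cupList l (2 * l.length) - cupList l' (2 * l.length)) := by
      simp only [map_sub, LinearMap.sub_apply]; abel
    rw [e]
    exact Submodule.add_mem _
      (cochainCup_mem_coboundaries_left h hab.2 (cupList_mem_cocycles hl rfl))
      (cochainCup_mem_coboundaries_right h hb (ih rfl))

/-- The class of a product of cocycles of degree two does not depend on the order. -/
lemma cupList_sub_cupList_mem_coboundaries_of_perm {l l' : List (Cochain X R 2)}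
    (h : l.Perm l') (hl : ∀ a ∈ l, a ∈ cocycles X R 2) {n : ℕ} (hn : 2 * l.length = n) :
    cupList l n - cupList l' n ∈ coboundaries X R n := by
  induction h generalizing n with
  | nil => rw [sub_self]; exact Submodule.zero_mem _
  | @cons a l l' hll ih =>
    have h : 2 + 2 * l.length = n := by simp at hn; omega
    rw [cupList_cons a l h, cupList_cons a l' h, ← map_sub]
    exact cochainCup_mem_coboundaries_right h (hl a (by simp))
      (ih (fun b hb => hl b (List.mem_cons_of_mem _ hb)) rfl)
  | swap a b l =>
    have h : 2 + (2 + 2 * l.length) = n := by simp at hn; omega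
    have h4 : 4 + 2 * l.length = n := by omega
    rw [cupList_cons _ _ h, cupList_cons _ _ h, cupList_cons _ _ rfl, cupList_cons _ _ rfl,
      ← cochainCup_assoc (rfl : 2 + 2 = 4) h4 rfl h, ← cochainCup_assoc (rfl : 2 + 2 = 4) h4 rfl h,
      ← LinearMap.sub_apply, ← map_sub]
    exact cochainCup_mem_coboundaries_left h4 (cochainCup_sub_cochainCup_mem_coboundaries
      (hl b (by simp)) (hl a (by simp)) rfl)
      (cupList_mem_cocycles (fun c hc => hl c (by simp [hc])) rfl)
  | @trans l₁ l₂ l₃ h1 _ ih1 ih2 =>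
    have e : cupList l₁ n - cupList l₃ n =
        (cupList l₁ n - cupList l₂ n) + (cupList l₂ n - cupList l₃ n) := by abel
    rw [e]
    exact Submodule.add_mem _ (ih1 hl hn)
      (ih2 (fun a ha => hl a (h1.mem_iff.2 ha)) (by rw [← h1.length_eq, hn]))

/-- Replacing pairs of factors `c, c` with `c = b - a`, where `a` and `b` have square zero, by the
pairs `a, b` changes the product by powers of `-2`, up to coboundaries. -/
lemma cupList_flatMap_sub_mem_coboundaries (l : List (Cochain X R 2 × Cochain X R 2))
    (hl : ∀ x ∈ l, (x.1 ∈ cocycles X R 2 ∧ x.2 ∈ cocycles X R 2) ∧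
      cochainCup (rfl : 2 + 2 = 4) x.1 x.1 ∈ coboundaries X R 4 ∧
      cochainCup (rfl : 2 + 2 = 4) x.2 x.2 ∈ coboundaries X R 4) {n : ℕ}
    (hn : 4 * l.length = n) :
    cupList (l.flatMap fun x => [x.2 - x.1, x.2 - x.1]) n -
      (-2 : R) ^ l.length • cupList (l.flatMap fun x => [x.1, x.2]) n ∈ coboundaries X R n := by
  induction l generalizing n with
  | nil => simp
  | cons x l ih =>
    have h : 2 + (2 + 4 * l.length) = n := by simp at hn; omega
    have h4 : 4 + 4 * l.length = n := by omega
    obtain ⟨⟨ha, hb⟩, haa, hbb⟩ := hl x (by simp)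
    have hl' := fun y hy => hl y (List.mem_cons_of_mem x hy)
    have key : ∀ f : Cochain X R 2 × Cochain X R 2 → List (Cochain X R 2),
        (∀ y, (f y).length = 2) → 2 * (l.flatMap f).length = 4 * l.length := by
      intro f hf
      simp only [List.length_flatMap, hf, List.map_const', List.sum_replicate, smul_eq_mul]
      omega
    have hc := cupList_mem_cocycles (l := l.flatMap fun x => [x.2 - x.1, x.2 - x.1]) (by
      intro c hc
      obtain ⟨y, hy, hc⟩ := List.mem_flatMap.1 hc
      have : c = y.2 - y.1 := by simpa using hc
      rw [this]
      exact Submodule.sub_mem _ (hl' y hy).1.2 (hl' y hy).1.1) (key _ fun _ => rfl)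
    have hab := cochainCup_sub_cochainCup_mem_coboundaries ha hb rfl
    simp only [List.flatMap_cons, List.cons_append, List.nil_append]
    rw [cupList_cons _ _ h, cupList_cons _ _ h, cupList_cons _ _ rfl, cupList_cons _ _ rfl,
      ← cochainCup_assoc (rfl : 2 + 2 = 4) h4 rfl h, ← cochainCup_assoc (rfl : 2 + 2 = 4) h4 rfl h]
    set P := cupList (l.flatMap fun x => [x.2 - x.1, x.2 - x.1]) (4 * l.length)
    set Q := cupList (l.flatMap fun x => [x.1, x.2]) (4 * l.length)
    -- With `a = x.1` and `b = x.2`: (b - a)² = b² + a² + (ab - ba) - 2ab, where all but the last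
    -- term are coboundaries.
    have hsq : cochainCup (rfl : 2 + 2 = 4) (x.2 - x.1) (x.2 - x.1) =
        (cochainCup (rfl : 2 + 2 = 4) x.2 x.2 + cochainCup (rfl : 2 + 2 = 4) x.1 x.1 +
        (cochainCup rfl x.1 x.2 - cochainCup rfl x.2 x.1)) +
        (-2 : R) • cochainCup rfl x.1 x.2 := by
      simp only [map_sub, LinearMap.sub_apply, neg_smul, two_smul]
      abel
    have e : cochainCup h4 (cochainCup (rfl : 2 + 2 = 4) (x.2 - x.1) (x.2 - x.1)) P -
        (-2 : R) ^ (x :: l).length • cochainCup h4 (cochainCup (rfl : 2 + 2 = 4) x.1 x.2) Q =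
        cochainCup h4 (cochainCup (rfl : 2 + 2 = 4) x.2 x.2 +
          cochainCup (rfl : 2 + 2 = 4) x.1 x.1 +
          (cochainCup rfl x.1 x.2 - cochainCup rfl x.2 x.1)) P +
        (-2 : R) • cochainCup h4 (cochainCup (rfl : 2 + 2 = 4) x.1 x.2)
          (P - (-2 : R) ^ l.length • Q) := by
      rw [hsq, map_add, LinearMap.add_apply, map_smul, LinearMap.smul_apply, map_sub, map_smul,
        smul_sub, smul_smul, List.length_cons, pow_succ']
      abel
    rw [e]
    exact Submodule.add_mem _ (cochainCup_mem_coboundaries_left h4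
      (Submodule.add_mem _ (Submodule.add_mem _ hbb haa) hab) hc)
      (Submodule.smul_mem _ _ (cochainCup_mem_coboundaries_right h4
        (cochainCup_mem_cocycles rfl ha hb) (ih hl' rfl)))

lemma flatMap_pair_perm {A : Type*} (l : List (A × A)) :
    (l.flatMap fun x => [x.1, x.2]).Perm (l.map Prod.fst ++ l.map Prod.snd) := by
  induction l with
  | nil => simp
  | cons x l ih =>
    simp only [List.flatMap_cons, List.cons_append, List.nil_append, List.map_cons]
    refine List.Perm.cons _ ?_
    exact (List.Perm.cons _ ih).trans List.perm_middle.symm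

end CupTwo

end SingCoh

end

noncomputable section

namespace SingCoh

universe u v w

open AffineModel

/-! ### Cocycles of degree one which vanish on loops -/

section Loops

variable {W : Type u} [TopologicalSpace W] {R : Type v} [CommRing R]

/-- The singular simplex given by a path. -/
def pathSimplex {x y : W} (γ : Path x y) : Simplex W 1 :=
  γ.toContinuousMap.comp
    ⟨stdSimplexHomeomorphUnitInterval, stdSimplexHomeomorphUnitInterval.continuous⟩

lemma pathSimplex_apply {x y : W} (γ : Path x y) (t : stdSimplex ℝ (Fin 2)) :
    pathSimplex γ t = γ (stdSimplexHomeomorphUnitInterval t) := rfl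

lemma coe_stdSimplexHomeomorphUnitInterval (t : stdSimplex ℝ (Fin 2)) :
    (stdSimplexHomeomorphUnitInterval t : ℝ) = t.1 1 := rfl

/-- The path given by a singular simplex. -/
def simplexPath (e : Simplex W 1) : Path (e (stdSimplex.vertex 0)) (e (stdSimplex.vertex 1)) where
  toFun t := e (stdSimplexHomeomorphUnitInterval.symm t)
  continuous_toFun := by fun_prop
  source' := by
    congr 1
    rw [Homeomorph.symm_apply_eq]
    exact stdSimplexHomeomorphUnitInterval_zero.symm
  target' := by
    congr 1
    rw [Homeomorph.symm_apply_eq]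
    exact stdSimplexHomeomorphUnitInterval_one.symm

lemma pathSimplex_simplexPath (e : Simplex W 1) : pathSimplex (simplexPath e) = e := by
  ext t
  change e (stdSimplexHomeomorphUnitInterval.symm (stdSimplexHomeomorphUnitInterval t)) = e t
  rw [Homeomorph.symm_apply_apply]

lemma pathSimplex_vertex_zero {x y : W} (γ : Path x y) :
    pathSimplex γ (stdSimplex.vertex 0) = x := by
  rw [pathSimplex_apply, stdSimplexHomeomorphUnitInterval_zero, γ.source]

lemma pathSimplex_vertex_one {x y : W} (γ : Path x y) :
    pathSimplex γ (stdSimplex.vertex 1) = y := by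
  rw [pathSimplex_apply, stdSimplexHomeomorphUnitInterval_one, γ.target]

/-- The affine function on the triangle with the values `0`, `1/2`, `1` on the vertices. -/
def triangleToInterval : C(stdSimplex ℝ (Fin 3), unitInterval) where
  toFun t := ⟨t.1 1 / 2 + t.1 2, by
    have h := t.2.2
    rw [Fin.sum_univ_three] at h
    have h0 := t.2.1 0
    have h1 := t.2.1 1
    have h2 := t.2.1 2
    constructor <;> linarith⟩
  continuous_toFun := by
    refine Continuous.subtype_mk ?_ _
    have h : ∀ i : Fin 3, Continuous fun t : stdSimplex ℝ (Fin 3) => t.1 i :=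
      fun i => (continuous_apply i).comp continuous_subtype_val
    exact ((h 1).div_const 2).add (h 2)

/-- Folding the triangle onto the interval with its middle vertex at `1/2` gives a singular triangle
with faces `β`, `α.trans β` and `α`; the claim is the cocycle condition on it. -/
lemma apply_pathSimplex_trans {κ : Cochain W R 1} (hκ : κ ∈ cocycles W R 1) {x y z : W}
    (α : Path x y) (β : Path y z) :
    κ (pathSimplex (α.trans β)) = κ (pathSimplex α) + κ (pathSimplex β) := by
  let σ : Simplex W 2 := (α.trans β).toContinuousMap.comp triangleToInterval
  have hσ : ∀ t, σ t = (α.trans β) (triangleToInterval t) := fun _ => rfl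
  have hval : ∀ t, (triangleToInterval t : ℝ) = t.1 1 / 2 + t.1 2 := fun _ => rfl
  have hsum : ∀ t : stdSimplex ℝ (Fin 2), t.1 0 = 1 - t.1 1 := fun t => by
    have := t.2.2
    rw [Fin.sum_univ_two] at this
    linarith
  have hnn : ∀ t : stdSimplex ℝ (Fin 2), 0 ≤ t.1 1 := fun t => t.2.1 1
  have hle : ∀ t : stdSimplex ℝ (Fin 2), t.1 1 ≤ 1 := fun t => by
    have := t.2.1 0; rw [hsum] at this; linarith
  have h0 : σ.restrict (Fin.succAbove 0) = pathSimplex β := by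
    ext t
    change σ (stdSimplex.map _ t) = _
    have e : ((triangleToInterval (stdSimplex.map (Fin.succAbove (0 : Fin 3)) t) :
        unitInterval) : ℝ) =
        (1 + t.1 1) / 2 := by
      rw [hval, stdSimplex_map_apply, stdSimplex_map_apply]
      simp [Fin.sum_univ_two, Fin.succAbove, hsum]
      ring
    rw [hσ, Path.trans_apply, pathSimplex_apply]
    split_ifs with h
    · have h1 : t.1 1 = 0 := by
        have := hnn t
        rw [e] at h; linarith
      have h2 : stdSimplexHomeomorphUnitInterval t = 0 := Subtype.ext h1
      rw [h2, β.source]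
      convert α.target using 2
      apply Subtype.ext
      simp only [e, h1]
      norm_num
    · congr 1
      apply Subtype.ext
      simp only [e, coe_stdSimplexHomeomorphUnitInterval]
      ring
  have h1 : σ.restrict (Fin.succAbove 1) = pathSimplex (α.trans β) := by
    ext t
    change σ (stdSimplex.map _ t) = _
    rw [hσ, pathSimplex_apply]
    congr 1
    apply Subtype.ext
    rw [hval, stdSimplex_map_apply, stdSimplex_map_apply, coe_stdSimplexHomeomorphUnitInterval]
    simp [Fin.sum_univ_two, Fin.succAbove]
  have h2 : σ.restrict (Fin.succAbove 2) = pathSimplex α := by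
    ext t
    change σ (stdSimplex.map _ t) = _
    have e : ((triangleToInterval (stdSimplex.map (Fin.succAbove (2 : Fin 3)) t) :
        unitInterval) : ℝ) =
        t.1 1 / 2 := by
      rw [hval, stdSimplex_map_apply, stdSimplex_map_apply]
      simp [Fin.sum_univ_two, Fin.succAbove]
    rw [hσ, Path.trans_apply, pathSimplex_apply, dif_pos]
    · congr 1
      apply Subtype.ext
      simp only [e, coe_stdSimplexHomeomorphUnitInterval]
      ring
    · rw [e]
      linarith [hle t]
  have h := congrFun hκ σ
  rw [coboundary_apply, Fin.sum_univ_three, h0, h1, h2] at h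
  simp only [Fin.val_zero, Fin.val_one, Fin.val_two, pow_zero, pow_one, Pi.zero_apply] at h
  linear_combination -h

/-- A cocycle of degree one which vanishes on loops is a coboundary. -/
lemma mem_coboundaries_of_loops {κ : Cochain W R 1} (hκ : κ ∈ cocycles W R 1)
    (h : ∀ e : Simplex W 1, e (stdSimplex.vertex 0) = e (stdSimplex.vertex 1) → κ e = 0) :
    κ ∈ coboundaries W R 1 := by
  have hloop : ∀ {x : W} (γ : Path x x), κ (pathSimplex γ) = 0 := fun γ => h _ (by
    rw [pathSimplex_vertex_zero, pathSimplex_vertex_one])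
  have hends : ∀ {x y : W} (α β : Path x y), κ (pathSimplex α) = κ (pathSimplex β) := by
    intro x y α β
    have h1 := hloop (α.trans β.symm)
    have h2 := hloop (β.trans β.symm)
    rw [apply_pathSimplex_trans hκ] at h1 h2
    linear_combination h1 - h2
  -- A base point in each path component. The primitive at `x` is the value of `κ` on a path from `r
  -- x` to `x`, which is independent of the path by `hends`.
  let r : W → W := fun x => (Quotient.out (Quotient.mk (pathSetoid W) x))
  have hr : ∀ x, Joined (r x) x := fun x =>
    Quotient.exact (Quotient.out_eq (Quotient.mk (pathSetoid W) x))
  refine ⟨fun σ => κ (pathSimplex (hr (σ (stdSimplex.vertex 0))).somePath), ?_⟩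
  funext e
  have h0 : (e.restrict (Fin.succAbove 0)) (stdSimplex.vertex 0) = e (stdSimplex.vertex 1) := by
    change e (stdSimplex.map _ _) = _
    rw [stdSimplex.map_vertex]
    rfl
  have h1 : (e.restrict (Fin.succAbove 1)) (stdSimplex.vertex 0) = e (stdSimplex.vertex 0) := by
    change e (stdSimplex.map _ _) = _
    rw [stdSimplex.map_vertex]
    rfl
  rw [coboundary_apply, Fin.sum_univ_two, h0, h1]
  simp only [Fin.val_zero, Fin.val_one, pow_zero, pow_one]
  have hj : r (e (stdSimplex.vertex 0)) = r (e (stdSimplex.vertex 1)) := by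
    change Quotient.out _ = Quotient.out _
    congr 1
    exact Quotient.sound ⟨simplexPath e⟩
  -- The base points of the two ends of `e` are only propositionally equal, so they are generalized
  -- in order to compose paths.
  have key : ∀ (a b : W) (hab : a = b) (γ : Path a (e (stdSimplex.vertex 0)))
      (δ : Path b (e (stdSimplex.vertex 1))),
      1 * κ (pathSimplex δ) + -1 * κ (pathSimplex γ) = κ e := by
    rintro a b rfl γ δ
    rw [hends δ (γ.trans (simplexPath e)), apply_pathSimplex_trans hκ, pathSimplex_simplexPath]
    ring
  exact key _ _ hj _ _

end Loops

/-! ### The prism operator -/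

section Prism

variable {X : Type u} [TopologicalSpace X] {W : Type w} [TopologicalSpace W]
  {R : Type v} [CommRing R]

lemma aff_const {n k : ℕ} (x : stdSimplex ℝ (Fin (n + 1))) (t : stdSimplex ℝ (Fin (k + 1))) :
    aff (fun _ => x) t = x := by
  apply Subtype.ext
  rw [coe_aff, ← Finset.sum_smul, t.2.2, one_smul]

lemma lev_vertices_left {p q : ℕ} (φ : Cochain X R p)
    (G : C(stdSimplex ℝ (Fin (p + 1)) × stdSimplex ℝ (Fin (q + 1)), X))
    (b : stdSimplex ℝ (Fin (q + 1))) :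
    lev φ G ((vertices p).map fun x => (x, b)) =
      φ (G.comp ((ContinuousMap.id _).prodMk (ContinuousMap.const _ b))) := by
  rw [vertices, List.map_ofFn, lev_ofFn]
  congr 2
  ext t : 1
  exact Prod.ext (congrArg (fun σ => σ t)
    (comp_aff_vertex (ContinuousMap.id (stdSimplex ℝ (Fin (p + 1)))))) (aff_const b t)

lemma lev_vertices_right {p q : ℕ} (φ : Cochain X R q)
    (G : C(stdSimplex ℝ (Fin (p + 1)) × stdSimplex ℝ (Fin (q + 1)), X))
    (a : stdSimplex ℝ (Fin (p + 1))) :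
    lev φ G ((vertices q).map fun y => (a, y)) =
      φ (G.comp ((ContinuousMap.const _ a).prodMk (ContinuousMap.id _))) := by
  rw [vertices, List.map_ofFn, lev_ofFn]
  congr 2
  ext t : 1
  exact Prod.ext (aff_const a t) (congrArg (fun σ => σ t)
    (comp_aff_vertex (ContinuousMap.id (stdSimplex ℝ (Fin (q + 1))))))

/-- The homotopy traced by a family of paths over a singular simplex. -/
def track {k : ℕ} (s : C(W, C(unitInterval, X))) (σ : Simplex W k) :
    C(stdSimplex ℝ (Fin (k + 1)) × stdSimplex ℝ (Fin 2), X) :=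
  (ContinuousMap.uncurry (s.comp σ)).comp ((ContinuousMap.id _).prodMap
    ⟨stdSimplexHomeomorphUnitInterval, stdSimplexHomeomorphUnitInterval.continuous⟩)

/-- The prism operator of a family of paths. -/
def prism {n : ℕ} (s : C(W, C(unitInterval, X))) (φ : Cochain X R n) (k : ℕ) : Cochain W R k :=
  fun σ => shuffle (lev φ (track s σ)) (vertices k) (vertices 1)

/-- Evaluation of a family of paths at a time. -/
def evalAt (s : C(W, C(unitInterval, X))) (t : unitInterval) : C(W, X) where
  toFun x := s x t
  continuous_toFun := (continuous_eval_const t).comp s.continuous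

lemma bd_vertices_one (g : List (stdSimplex ℝ (Fin 2)) → R) :
    bd g (vertices 1) = g [stdSimplex.vertex 1] - g [stdSimplex.vertex 0] := by
  simp [vertices, bd_cons]

/-- The shuffle Leibniz rule for `σ` times the interval: the total term vanishes for a cocycle, the
faces of `σ` give the left side, and the two ends of the interval give the right side, in the order
start minus end. -/
lemma coboundary_prism (s : C(W, C(unitInterval, X))) {φ : Cochain X R 2}
    (hφ : φ ∈ cocycles X R 2) :
    coboundary W R 1 (prism s φ 1) =
      cochainPullback (evalAt s 0) 2 φ - cochainPullback (evalAt s 1) 2 φ := by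
  funext σ
  have h1 : ∀ i : Fin 3, prism s φ 1 (σ.restrict i.succAbove) =
      shuffle (lev φ (track s σ)) ((vertices 1).map (simplexMap i.succAbove)) (vertices 1) := by
    intro i
    have h := shuffle_map (simplexMap i.succAbove) id (lev φ (track s σ)) (vertices 1) (vertices 1)
    rw [List.map_id] at h
    rw [← h, prism]
    congr 1
    funext l
    exact lev_comp φ (track s σ) (IsAffine.prodMap (isAffine_simplexMap i.succAbove) isAffine_id) l
  have h2 := shuffle_bd (lev φ (track s σ)) (vertices 2) (vertices 1)
  have h3 : bd (lev φ (track s σ)) = fun _ => 0 := by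
    funext l
    rw [bd_lev, mem_cocycles_iff.1 hφ, lev_zero]
  rw [h3, shuffle_zero, bd_vertices, bd_vertices_one,
    if_neg (by simp [length_vertices]), shuffle_singleton_right _ _ (by simp [vertices]),
    shuffle_singleton_right _ _ (by simp [vertices]), lev_vertices_left, lev_vertices_left,
    length_vertices] at h2
  rw [coboundary_apply]
  simp only [h1]
  have e0 : (track s σ).comp ((ContinuousMap.id _).prodMk
      (ContinuousMap.const _ (stdSimplex.vertex 0))) = (evalAt s 0).comp σ := by
    ext t
    exact congrArg (s (σ t)) stdSimplexHomeomorphUnitInterval_zero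
  have e1 : (track s σ).comp ((ContinuousMap.id _).prodMk
      (ContinuousMap.const _ (stdSimplex.vertex 1))) = (evalAt s 1).comp σ := by
    ext t
    exact congrArg (s (σ t)) stdSimplexHomeomorphUnitInterval_one
  rw [e0, e1] at h2
  change _ = φ _ - φ _
  have e4 : (-1 : R) ^ (2 + 1 + 1) = 1 := by norm_num
  rw [e4] at h2
  linear_combination -h2

/-! ### Tori -/

/-- The parametrization of the torus by the square. -/
def squareToTorus : C(unitInterval × unitInterval, UnitAddTorus (Fin 2)) where
  toFun p := ![((p.1 : ℝ) : UnitAddCircle), ((p.2 : ℝ) : UnitAddCircle)]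
  continuous_toFun := by
    refine continuous_pi fun i => ?_
    fin_cases i
    · exact (AddCircle.continuous_mk' 1).comp (continuous_subtype_val.comp continuous_fst)
    · exact (AddCircle.continuous_mk' 1).comp (continuous_subtype_val.comp continuous_snd)

lemma exists_unitInterval_coe_eq (x : UnitAddCircle) :
    ∃ t : unitInterval, ((t : ℝ) : UnitAddCircle) = x := by
  obtain ⟨t, ht, rfl⟩ : x ∈ ((↑) : ℝ → UnitAddCircle) '' Set.Ico 0 (0 + 1) := by
    rw [AddCircle.coe_image_Ico_eq]; trivial
  exact ⟨⟨t, ht.1, by linarith [ht.2]⟩, rfl⟩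

lemma unitInterval_coe_eq_coe {s t : unitInterval}
    (h : ((s : ℝ) : UnitAddCircle) = ((t : ℝ) : UnitAddCircle)) :
    s = t ∨ (s = 0 ∧ t = 1) ∨ (s = 1 ∧ t = 0) := by
  rw [← sub_eq_zero, ← AddCircle.coe_sub, AddCircle.coe_eq_zero_iff] at h
  obtain ⟨n, hn⟩ := h
  rw [zsmul_eq_mul, mul_one] at hn
  have hs := s.2
  have ht := t.2
  have h1 : (-2 : ℝ) < n := by rw [hn]; linarith [hs.1, ht.2]
  have h2 : (n : ℝ) < 2 := by rw [hn]; linarith [hs.2, ht.1]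
  have h1' : -2 < n := by exact_mod_cast h1
  have h2' : n < 2 := by exact_mod_cast h2
  obtain rfl | rfl | rfl : n = -1 ∨ n = 0 ∨ n = 1 := by omega
  · refine Or.inr (Or.inl ⟨Subtype.ext ?_, Subtype.ext ?_⟩) <;> push_cast at * <;>
      linarith [hs.1, ht.2]
  · refine Or.inl (Subtype.ext ?_)
    push_cast at hn
    linarith
  · refine Or.inr (Or.inr ⟨Subtype.ext ?_, Subtype.ext ?_⟩) <;> push_cast at * <;>
      linarith [hs.2, ht.1]

/-- A continuous surjection from a compact space to a Hausdorff space is closed. -/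
lemma isQuotientMap_squareToTorus : Topology.IsQuotientMap squareToTorus := by
  refine IsClosedMap.isQuotientMap squareToTorus.continuous.isClosedMap squareToTorus.continuous ?_
  intro x
  obtain ⟨s, hs⟩ := exists_unitInterval_coe_eq (x 0)
  obtain ⟨t, ht⟩ := exists_unitInterval_coe_eq (x 1)
  refine ⟨(s, t), ?_⟩
  funext i
  fin_cases i
  · exact hs
  · exact ht

/-- A map of the square which is compatible with the gluing of opposite sides factors through the
torus. -/
lemma exists_torus_map (G : C(unitInterval × unitInterval, X)) (h1 : ∀ t, G (0, t) = G (1, t))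
    (h2 : ∀ t, G (t, 0) = G (t, 1)) :
    ∃ f : C(UnitAddTorus (Fin 2), X), f.comp squareToTorus = G := by
  refine ⟨isQuotientMap_squareToTorus.lift G ?_, isQuotientMap_squareToTorus.lift_comp G _⟩
  rintro ⟨a, b⟩ ⟨c, d⟩ h
  have ha : ((a : ℝ) : UnitAddCircle) = ((c : ℝ) : UnitAddCircle) := congrFun h 0
  have hb : ((b : ℝ) : UnitAddCircle) = ((d : ℝ) : UnitAddCircle) := congrFun h 1
  have e1 : G (a, b) = G (c, b) := by
    rcases unitInterval_coe_eq_coe ha with rfl | ⟨rfl, rfl⟩ | ⟨rfl, rfl⟩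
    · rfl
    · exact h1 b
    · exact (h1 b).symm
  rw [e1]
  rcases unitInterval_coe_eq_coe hb with rfl | ⟨rfl, rfl⟩ | ⟨rfl, rfl⟩
  · rfl
  · exact h2 c
  · exact (h2 c).symm

lemma cochainPullback_mem_coboundaries_of_pullback_eq_zero {k : ℕ} {Y : Type*}
    [TopologicalSpace Y] (f : C(Y, X)) (φ : cocycles X R k)
    (h : pullback R f k (Submodule.Quotient.mk φ) = 0) :
    cochainPullback f k φ.1 ∈ coboundaries Y R k := by
  have h' : (Submodule.Quotient.mk ⟨cochainPullback f k φ.1,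
      cochainPullback_mem_cocycles f k φ.1 φ.2⟩ : Cohomology Y R k) = 0 := h
  exact (Submodule.Quotient.mk_eq_zero ((coboundaries Y R k).submoduleOf (cocycles Y R k))).1 h'

/-- Stokes' formula on the square: the coboundary of `β`, evaluated on both triangles, is the signed
sum over the four sides. -/
lemma shuffle_bd_lev_vertices_one {Y : Type*} [TopologicalSpace Y] (β : Cochain Y R 1)
    (G : C(stdSimplex ℝ (Fin 2) × stdSimplex ℝ (Fin 2), Y)) :
    shuffle (bd (lev β G)) (vertices 1) (vertices 1) =
      β (G.comp ((ContinuousMap.const _ (stdSimplex.vertex 1)).prodMk (ContinuousMap.id _))) -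
      β (G.comp ((ContinuousMap.const _ (stdSimplex.vertex 0)).prodMk (ContinuousMap.id _))) -
      (β (G.comp ((ContinuousMap.id _).prodMk (ContinuousMap.const _ (stdSimplex.vertex 1)))) -
      β (G.comp ((ContinuousMap.id _).prodMk (ContinuousMap.const _ (stdSimplex.vertex 0))))) := by
  have hne : vertices 1 ≠ [] := by simp [vertices]
  rw [shuffle_bd, bd_vertices_one,
    bd_vertices_one, if_neg (by simp [length_vertices]),
    shuffle_singleton_right _ _ hne, shuffle_singleton_right _ _ hne,
    shuffle_singleton_left _ _ hne, shuffle_singleton_left _ _ hne, lev_vertices_left,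
    lev_vertices_left, lev_vertices_right, lev_vertices_right, length_vertices]
  ring

/-- Two families of paths with the same end points have the same prism operator on loops, if the
cocycle vanishes on tori. -/
lemma prism_eq_prism_of_loop (s s' : C(W, C(unitInterval, X))) (h0 : ∀ x, s x 0 = s' x 0)
    (h1 : ∀ x, s x 1 = s' x 1) (φ : cocycles X R 2)
    (hφ : IsAtoroidal (Submodule.Quotient.mk φ : Cohomology X R 2)) (e : Simplex W 1)
    (he : e (stdSimplex.vertex 0) = e (stdSimplex.vertex 1)) :
    prism s φ.1 1 e = prism s' φ.1 1 e := by
  let θ := stdSimplexHomeomorphUnitInterval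
  have hθ0 : θ (stdSimplex.vertex 0) = 0 := stdSimplexHomeomorphUnitInterval_zero
  have hθ1 : θ (stdSimplex.vertex 1) = 1 := stdSimplexHomeomorphUnitInterval_one
  let γ : C(unitInterval, W) := ⟨fun t => e (θ.symm t), by fun_prop⟩
  have hγ : ∀ t, γ (θ t) = e t := fun t => congrArg e (θ.symm_apply_apply t)
  have hγ01 : γ 0 = γ 1 := by rw [← hθ0, ← hθ1, hγ, hγ, he]
  let lower : C(unitInterval, unitInterval) := ⟨fun t => ⟨t.1 / 2, by
    have := t.2; constructor <;> linarith [this.1, this.2]⟩, by fun_prop⟩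
  let upper : C(unitInterval, unitInterval) := ⟨fun t => ⟨1 - t.1 / 2, by
    have := t.2; constructor <;> linarith [this.1, this.2]⟩, by fun_prop⟩
  -- Over each point of the loop, `G` travels along `s` and returns along `s'`. Equal end points
  -- make it continuous at height `1/2` and periodic in height; `lower` and `upper` parametrize the
  -- halves, the latter backwards.
  let G : C(unitInterval × unitInterval, X) :=
    { toFun := fun p => if (p.2 : ℝ) ≤ 1 / 2 then
          s (γ p.1) (Set.projIcc 0 1 zero_le_one (2 * p.2 : ℝ))
        else s' (γ p.1) (Set.projIcc 0 1 zero_le_one (2 - 2 * p.2 : ℝ))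
      continuous_toFun := by
        refine Continuous.if_le ?_ ?_ (by fun_prop) (by fun_prop) ?_
        · have : Continuous fun p : unitInterval × unitInterval =>
            ((ContinuousMap.uncurry s) (γ p.1, Set.projIcc 0 1 zero_le_one (2 * p.2 : ℝ))) := by
            fun_prop
          exact this
        · have : Continuous fun p : unitInterval × unitInterval =>
            ((ContinuousMap.uncurry s')
              (γ p.1, Set.projIcc 0 1 zero_le_one (2 - 2 * p.2 : ℝ))) := by
            fun_prop
          exact this
        · intro p hp
          rw [hp, show (2 : ℝ) * (1 / 2) = 1 by norm_num, show (2 : ℝ) - 1 = 1 by norm_num,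
            Set.projIcc_right]
          exact h1 _ }
  have hlow : ∀ x t, G (x, lower t) = s (γ x) t := by
    intro x t
    have h : ((lower t : unitInterval) : ℝ) = t.1 / 2 := rfl
    change (if ((lower t : unitInterval) : ℝ) ≤ 1 / 2 then _ else _) = _
    rw [if_pos (by rw [h]; linarith [t.2.2]), h, mul_div_cancel₀ _ two_ne_zero]
    congr 1
    exact Set.projIcc_val zero_le_one t
  have hupp : ∀ x t, G (x, upper t) = s' (γ x) t := by
    intro x t
    have h : ((upper t : unitInterval) : ℝ) = 1 - t.1 / 2 := rfl
    change (if ((upper t : unitInterval) : ℝ) ≤ 1 / 2 then _ else _) = _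
    split_ifs with hc
    · have ht : t = 1 := Subtype.ext (by
        rw [h] at hc
        have := t.2.2
        simp only [Set.Icc.coe_one]
        linarith)
      subst ht
      rw [h]
      simp only [Set.Icc.coe_one]
      rw [show (2 : ℝ) * (1 - 1 / 2) = 1 by norm_num, Set.projIcc_right]
      exact h1 _
    · rw [h, show (2 : ℝ) - 2 * (1 - t.1 / 2) = t.1 by ring]
      congr 1
      exact Set.projIcc_val zero_le_one t
  have hl0 : lower 0 = 0 := Subtype.ext (by simp [lower])
  have hu0 : upper 0 = 1 := Subtype.ext (by simp [upper])
  have hlu : lower 1 = upper 1 := Subtype.ext (by simp [lower, upper]; norm_num)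
  obtain ⟨f, hf⟩ := exists_torus_map G
    (fun t => by
      change (if (t : ℝ) ≤ 1 / 2 then s (γ 0) _ else s' (γ 0) _) =
        (if (t : ℝ) ≤ 1 / 2 then s (γ 1) _ else s' (γ 1) _)
      rw [hγ01])
    (fun t => by
      have e0 := hlow t 0
      have e1 := hupp t 0
      rw [hl0] at e0
      rw [hu0] at e1
      rw [e0, e1, h0])
  -- Atoroidality enters here: the pullback of `φ` to the torus has a primitive `β`.
  obtain ⟨β, hβ⟩ := cochainPullback_mem_coboundaries_of_pullback_eq_zero f φ (hφ f)
  let sq (r : C(unitInterval, unitInterval)) :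
      C(stdSimplex ℝ (Fin 2) × stdSimplex ℝ (Fin 2), UnitAddTorus (Fin 2)) :=
    squareToTorus.comp (ContinuousMap.prodMap ⟨θ, θ.continuous⟩ (r.comp ⟨θ, θ.continuous⟩))
  -- By Stokes a prism over the loop is given by `β` on the sides of half of the square. The sides
  -- over the two ends of the loop coincide in the torus and cancel; only the circles at constant
  -- height remain.
  have key : ∀ (r : C(unitInterval, unitInterval)) (S : C(W, C(unitInterval, X))),
      (∀ x t, G (x, r t) = S (γ x) t) → prism S φ.1 1 e =
        - (β ((sq r).comp ((ContinuousMap.id _).prodMk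
            (ContinuousMap.const _ (stdSimplex.vertex 1)))) -
          β ((sq r).comp ((ContinuousMap.id _).prodMk
            (ContinuousMap.const _ (stdSimplex.vertex 0))))) := by
    intro r S hr
    have e1 : track S e = f.comp (sq r) := by
      ext p
      change S (e p.1) (θ p.2) = (f.comp squareToTorus) (θ p.1, r (θ p.2))
      rw [hf, hr, hγ]
    have e2 : lev φ.1 (track S e) = bd (lev β (sq r)) := by
      funext l
      rw [bd_lev, hβ, e1]
      rfl
    have e3 : (sq r).comp ((ContinuousMap.const _ (stdSimplex.vertex 1)).prodMk
        (ContinuousMap.id _)) = (sq r).comp ((ContinuousMap.const _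
          (stdSimplex.vertex 0)).prodMk (ContinuousMap.id _)) := by
      ext1 t
      change squareToTorus (θ (stdSimplex.vertex 1), r (θ t)) =
        squareToTorus (θ (stdSimplex.vertex 0), r (θ t))
      rw [hθ0, hθ1]
      funext i
      fin_cases i
      · change ((((1 : unitInterval) : ℝ)) : UnitAddCircle) = (((0 : unitInterval) : ℝ))
        simp
      · rfl
    rw [prism, e2, shuffle_bd_lev_vertices_one, e3]
    ring
  rw [key lower s hlow, key upper s' hupp]
  -- Both halves have the same circles at their ends: height `1/2` is common, and heights `0` and
  -- `1` are identified in the torus.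
  have f1 : (sq lower).comp ((ContinuousMap.id _).prodMk
      (ContinuousMap.const _ (stdSimplex.vertex 1))) = (sq upper).comp
      ((ContinuousMap.id _).prodMk (ContinuousMap.const _ (stdSimplex.vertex 1))) := by
    ext1 t
    change squareToTorus (θ t, lower (θ (stdSimplex.vertex 1))) =
      squareToTorus (θ t, upper (θ (stdSimplex.vertex 1)))
    rw [hθ1, hlu]
  have f0 : (sq lower).comp ((ContinuousMap.id _).prodMk
      (ContinuousMap.const _ (stdSimplex.vertex 0))) = (sq upper).comp
      ((ContinuousMap.id _).prodMk (ContinuousMap.const _ (stdSimplex.vertex 0))) := by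
    ext1 t
    change squareToTorus (θ t, lower (θ (stdSimplex.vertex 0))) =
      squareToTorus (θ t, upper (θ (stdSimplex.vertex 0)))
    rw [hθ0, hl0, hu0]
    funext i
    fin_cases i
    · rfl
    · change ((((0 : unitInterval) : ℝ)) : UnitAddCircle) = (((1 : unitInterval) : ℝ))
      simp only [Set.Icc.coe_zero, Set.Icc.coe_one, QuotientAddGroup.mk_zero]
      exact (AddCircle.coe_period (1 : ℝ)).symm
  rw [f1, f0]

end Prism

/-! ### Classes of weight two -/

section Weight

variable {Z : Type u} [TopologicalSpace Z] {R : Type v} [CommRing R]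

/-- The inclusion of a subset as a continuous map. -/
def inclusionMap (A : Set Z) : C(A, Z) := ⟨Subtype.val, continuous_subtype_val⟩

open Classical in
/-- Extension by zero of a cochain of a subset. -/
def extendCochain (A : Set Z) {k : ℕ} (g : Cochain A R k) : Cochain Z R k := fun σ =>
  if h : ∀ t, σ t ∈ A then g ⟨fun t => ⟨σ t, h t⟩, σ.continuous.subtype_mk h⟩ else 0

lemma extendCochain_comp (A : Set Z) {k : ℕ} (g : Cochain A R k) (σ : Simplex A k) :
    extendCochain A g ((inclusionMap A).comp σ) = g σ :=
  dif_pos fun t => (σ t).2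

lemma cochainPullback_extendCochain (A : Set Z) {k : ℕ} (g : Cochain A R k) :
    cochainPullback (inclusionMap A) k (extendCochain A g) = g :=
  funext fun σ => extendCochain_comp A g σ

lemma exists_comp_inclusionMap {A : Set Z} {k : ℕ} {σ : Simplex Z k} (h : ∀ t, σ t ∈ A) :
    ∃ τ : Simplex A k, (inclusionMap A).comp τ = σ :=
  ⟨⟨fun t => ⟨σ t, h t⟩, σ.continuous.subtype_mk h⟩, rfl⟩

lemma sub_apply_eq_zero_of_cochainPullback {A : Set Z} {φ : Cochain Z R 2} {h : Cochain Z R 1}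
    (hA : cochainPullback (inclusionMap A) 2 φ =
      coboundary A R 1 (cochainPullback (inclusionMap A) 1 h)) {σ : Simplex Z 2}
    (hσ : ∀ t, σ t ∈ A) : (φ - coboundary Z R 1 h) σ = 0 := by
  obtain ⟨τ, rfl⟩ := exists_comp_inclusionMap hσ
  rw [Pi.sub_apply, sub_eq_zero]
  exact congrFun hA τ

/-- If `φ` represents an atoroidal class then the difference of its pullbacks along the two
projections has a representative which vanishes on two given sets with motion planners. -/
lemma exists_sub_coboundary_eq_zero_of_isAtoroidal {X : Type u} [TopologicalSpace X]
    {A B : Set (X × X)} (s : C(A, C(unitInterval, X))) (s' : C(B, C(unitInterval, X)))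
    (hs : ∀ p, (s p 0, s p 1) = (p : X × X)) (hs' : ∀ p, (s' p 0, s' p 1) = (p : X × X))
    (φ : cocycles X R 2) (hφ : IsAtoroidal (Submodule.Quotient.mk φ : Cohomology X R 2)) :
    ∃ h : Cochain (X × X) R 1, ∀ σ : Simplex (X × X) 2, (∀ t, σ t ∈ A) ∨ (∀ t, σ t ∈ B) →
      (cochainPullback ContinuousMap.snd 2 φ.1 - cochainPullback ContinuousMap.fst 2 φ.1 -
        coboundary (X × X) R 1 h : Cochain (X × X) R 2) σ = 0 := by
  classical
  let iA : C((A ∩ B : Set (X × X)), A) := ⟨Set.inclusion Set.inter_subset_left,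
    continuous_inclusion _⟩
  let iB : C((A ∩ B : Set (X × X)), B) := ⟨Set.inclusion Set.inter_subset_right,
    continuous_inclusion _⟩
  have e0 : ∀ x, (s.comp iA) x 0 = (s'.comp iB) x 0 := fun x =>
    (congrArg Prod.fst (hs (iA x))).trans (congrArg Prod.fst (hs' (iB x))).symm
  have e1 : ∀ x, (s.comp iA) x 1 = (s'.comp iB) x 1 := fun x =>
    (congrArg Prod.snd (hs (iA x))).trans (congrArg Prod.snd (hs' (iB x))).symm
  -- On the overlap the two prisms have the same coboundary, as the planners have the same ends, and
  -- the same values on loops.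
  obtain ⟨μ, hμ⟩ : prism (s.comp iA) φ.1 1 - prism (s'.comp iB) φ.1 1 ∈
      coboundaries (A ∩ B : Set (X × X)) R 1 := by
    refine mem_coboundaries_of_loops ?_ fun e he => ?_
    · rw [mem_cocycles_iff, map_sub, coboundary_prism _ φ.2, coboundary_prism _ φ.2, sub_eq_zero]
      have h0 : evalAt (s.comp iA) 0 = evalAt (s'.comp iB) 0 := ContinuousMap.ext e0
      have h1 : evalAt (s.comp iA) 1 = evalAt (s'.comp iB) 1 := ContinuousMap.ext e1
      rw [h0, h1]
    · rw [Pi.sub_apply, sub_eq_zero]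
      exact prism_eq_prism_of_loop _ _ e0 e1 φ hφ e he
  -- Adding the coboundary of an extension of `μ` keeps this a primitive on `A` and makes it agree
  -- with `gB` on the overlap.
  let gA : Cochain A R 1 := - prism s φ.1 1 + coboundary A R 0
    (cochainPullback (inclusionMap A) 0 (extendCochain (A ∩ B) μ))
  let gB : Cochain B R 1 := - prism s' φ.1 1
  have hgA : coboundary A R 1 gA = cochainPullback (inclusionMap A) 2
      (cochainPullback ContinuousMap.snd 2 φ.1 - cochainPullback ContinuousMap.fst 2 φ.1) := by
    have h0 : evalAt s 0 = ContinuousMap.fst.comp (inclusionMap A) :=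
      ContinuousMap.ext fun x => congrArg Prod.fst (hs x)
    have h1 : evalAt s 1 = ContinuousMap.snd.comp (inclusionMap A) :=
      ContinuousMap.ext fun x => congrArg Prod.snd (hs x)
    rw [map_add, coboundary_coboundary, map_neg, coboundary_prism _ φ.2, h0, h1, add_zero, neg_sub]
    rfl
  have hgB : coboundary B R 1 gB = cochainPullback (inclusionMap B) 2
      (cochainPullback ContinuousMap.snd 2 φ.1 - cochainPullback ContinuousMap.fst 2 φ.1) := by
    have h0 : evalAt s' 0 = ContinuousMap.fst.comp (inclusionMap B) :=
      ContinuousMap.ext fun x => congrArg Prod.fst (hs' x)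
    have h1 : evalAt s' 1 = ContinuousMap.snd.comp (inclusionMap B) :=
      ContinuousMap.ext fun x => congrArg Prod.snd (hs' x)
    rw [map_neg, coboundary_prism _ φ.2, h0, h1, neg_sub]
    rfl
  -- Cochains are arbitrary functions on simplices, so agreement on simplices of `A ∩ B` suffices
  -- for gluing; the sets need not be open.
  let h : Cochain (X × X) R 1 := fun e =>
    if ∀ t, e t ∈ A then extendCochain A gA e else extendCochain B gB e
  have hA : cochainPullback (inclusionMap A) 1 h = gA := by
    funext e
    change (if _ then _ else _) = _
    rw [if_pos (show ∀ t, ((inclusionMap A).comp e) t ∈ A from fun t => (e t).2),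
      extendCochain_comp]
  have hB : cochainPullback (inclusionMap B) 1 h = gB := by
    funext e
    change (if _ then _ else _) = _
    rw [extendCochain_comp]
    split_ifs with he
    · obtain ⟨τ, hτ⟩ := exists_comp_inclusionMap (A := A ∩ B)
        (σ := (inclusionMap B).comp e) fun t => ⟨he t, (e t).2⟩
      have t1 : (inclusionMap B).comp e = (inclusionMap A).comp (iA.comp τ) := hτ.symm
      have t2 : e = iB.comp τ := by
        ext1 t
        exact Subtype.ext (congrArg (fun σ => σ t) hτ.symm)
      rw [t1, extendCochain_comp, t2]
      have h3 : coboundary A R 0 (cochainPullback (inclusionMap A) 0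
          (extendCochain (A ∩ B) μ)) (iA.comp τ) = coboundary (A ∩ B : Set (X × X)) R 0 μ τ := by
        conv_rhs => rw [← cochainPullback_extendCochain (A ∩ B) μ]
        rfl
      change - prism s φ.1 1 (iA.comp τ) + _ = - prism s' φ.1 1 (iB.comp τ)
      rw [h3, hμ]
      change - prism s φ.1 1 (iA.comp τ) +
        (prism s φ.1 1 (iA.comp τ) - prism s' φ.1 1 (iB.comp τ)) = _
      ring
    · rfl
  refine ⟨h, fun σ hσ => ?_⟩
  rcases hσ with hσ | hσ
  · exact sub_apply_eq_zero_of_cochainPullback (by rw [hA, hgA]) hσ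
  · exact sub_apply_eq_zero_of_cochainPullback (by rw [hB, hgB]) hσ

end Weight

end SingCoh

end

noncomputable section

namespace SingCoh

universe u v w

/-! ### The lower bound -/

section LowerBound

variable {X : Type u} [TopologicalSpace X] {R : Type v} [CommRing R]

lemma cupList_singleton (a : Cochain X R 2) : cupList [a] 2 = a := by
  rw [cupList_cons a [] (rfl : 2 + 0 = 2)]
  funext σ
  have : frontVertices (rfl : 2 + 0 = 2) = id := by funext i; rfl
  rw [cochainCup_apply, this, Simplex.restrict_id]
  exact mul_one _

/-- The two products are bracketed from opposite ends; strict associativity of the cochain cup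
product makes the representatives equal. -/
lemma cupProd_mk (n : ℕ) (φ : Fin n → cocycles X R 2) :
    cupProd n (fun j => (Submodule.Quotient.mk (φ j) : Cohomology X R 2)) =
      Submodule.Quotient.mk ⟨cupList (List.ofFn fun j => (φ j).1) (2 * n),
        cupList_mem_cocycles (by simp [List.mem_ofFn]) (by simp)⟩ := by
  induction n with
  | zero =>
    simp only [cupProd, one, List.ofFn_zero]
    rfl
  | succ n ih =>
    rw [cupProd, ih, cup_mk]
    congr 1
    apply Subtype.ext
    simp only
    rw [List.ofFn_succ', List.concat_eq_append]
    have := cupList_append (List.ofFn fun j : Fin n => (φ j.castSucc).1) [(φ (Fin.last n)).1]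
      (p := 2 * n) (by simp) (rfl : 2 * n + 2 = 2 * (n + 1))
    rw [cupList_singleton] at this
    exact this.symm

/-- Faces of a simplex in `A` stay in `A`, so one vanishing factor kills the product there. -/
lemma cupList_apply_eq_zero {l : List (Cochain X R 2)} {a : Cochain X R 2} (ha : a ∈ l)
    {A : Set X} (h : ∀ σ : Simplex X 2, (∀ t, σ t ∈ A) → a σ = 0) {n : ℕ}
    (hn : 2 * l.length = n) {σ : Simplex X n} (hσ : ∀ t, σ t ∈ A) : cupList l n σ = 0 := by
  induction l generalizing n with
  | nil => simp at ha
  | cons b l ih =>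
    have h2 : 2 + 2 * l.length = n := by simp at hn; omega
    rw [cupList_cons b l h2, cochainCup_apply]
    rcases List.mem_cons.1 ha with rfl | ha
    · rw [h _ fun t => hσ _, zero_mul]
    · rw [ih ha rfl fun t => hσ _, mul_zero]

lemma exists_isNormalized_mk_eq (u : Cohomology X R 2) :
    ∃ φ : cocycles X R 2, IsNormalized φ.1 ∧ Submodule.Quotient.mk φ = u := by
  induction u using Submodule.Quotient.induction_on with
  | H ψ =>
    obtain ⟨g, hg⟩ := exists_isNormalized ψ.2
    refine ⟨⟨ψ.1 - coboundary X R 1 g, Submodule.sub_mem _ ψ.2 (coboundary_coboundary g)⟩, hg, ?_⟩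
    rw [Submodule.Quotient.eq]
    refine ⟨-g, ?_⟩
    simp

/-- Each class supplies two factors of weight two, hence deals with four sets of the cover. With at
most `4 * n` sets the product would pair to zero, against the nonvanishing of the cross square. -/
theorem le_of_hasMotionPlanners {F : Type v} [Field F] (h2 : (2 : F) ≠ 0) (n : ℕ)
    (u : Fin n → Cohomology X F 2) (hator : ∀ j, IsAtoroidal (u j))
    (hsq : ∀ j, cup X F 2 2 (u j) (u j) = 0) (hprod : cupProd n u ≠ 0) {k : ℕ}
    (hk : HasMotionPlanners X k) : 4 * n ≤ k := by
  by_contra! hlt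
  obtain ⟨p, hp⟩ : ∃ p, 2 * n = p + 1 := ⟨2 * n - 1, by omega⟩
  obtain ⟨m, hm⟩ : ∃ m, p + 1 + (p + 1) = m + 1 := ⟨p + 1 + p, by omega⟩
  choose φ hφn hφu using fun j => exists_isNormalized_mk_eq (u j)
  obtain rfl : (fun j => Submodule.Quotient.mk (φ j)) = u := funext hφu
  set l : List (Cochain X F 2) := (List.finRange n).map fun j => (φ j).1 with hl
  have hlen : 2 * l.length = p + 1 := by simp [hl, hp]
  have hnot : ∀ N, 2 * n = N → cupList l N ∉ coboundaries X F N := by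
    rintro N rfl hmem
    rw [cupProd_mk] at hprod
    apply hprod
    rw [Submodule.Quotient.mk_eq_zero]
    rw [hl, ← List.ofFn_eq_map] at hmem
    exact hmem
  obtain ⟨L, hL, ⟨S, hS, hLS⟩, hLne⟩ := exists_functional
    (isNormalized_cupList (l := l) (by
      intro a ha
      obtain ⟨j, _, rfl⟩ := List.mem_map.1 ha
      exact hφn j) hlen) (hnot _ hp) hm
  have hLc : ∀ {y z : Cochain (X × X) F (m + 1)}, y - z ∈ coboundaries (X × X) F (m + 1) →
      L y = L z := by
    rintro y z ⟨w, hw⟩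
    rw [← sub_eq_zero, ← map_sub, ← hw, hL]
  let a : Fin n → Cochain (X × X) F 2 := fun j => cochainPullback ContinuousMap.fst 2 (φ j).1
  let b : Fin n → Cochain (X × X) F 2 := fun j => cochainPullback ContinuousMap.snd 2 (φ j).1
  have ha : ∀ j, a j ∈ cocycles (X × X) F 2 :=
    fun j => cochainPullback_mem_cocycles _ 2 _ (φ j).2
  have hb : ∀ j, b j ∈ cocycles (X × X) F 2 :=
    fun j => cochainPullback_mem_cocycles _ 2 _ (φ j).2
  have hsq' : ∀ j, cochainCup (rfl : 2 + 2 = 4) (φ j).1 (φ j).1 ∈ coboundaries X F 4 := by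
    intro j
    have := hsq j
    rw [cup_mk, Submodule.Quotient.mk_eq_zero] at this
    exact this
  obtain ⟨U, hUo, hUc, hs⟩ := hk
  choose s hs using hs
  -- There may be fewer than `4 * n` sets; indices beyond the last one are clamped to it.
  let idx : ℕ → Fin (k + 1) := fun i => ⟨min i k, by omega⟩
  have hw := fun (i i' : ℕ) (j : Fin n) => exists_sub_coboundary_eq_zero_of_isAtoroidal
    (s (idx i)) (s (idx i')) (hs _) (hs _) (φ j) (hator j)
  choose h hh using hw
  -- Two representatives of the same class, the first vanishing on sets `4j`, `4j + 1` and the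
  -- second on `4j + 2`, `4j + 3`.
  let c : Fin n → List (Cochain (X × X) F 2) := fun j =>
    [b j - a j - coboundary (X × X) F 1 (h (4 * j) (4 * j + 1) j),
      b j - a j - coboundary (X × X) F 1 (h (4 * j + 2) (4 * j + 3) j)]
  have hlen2 : ∀ f : Fin n → List (Cochain (X × X) F 2), (∀ j, (f j).length = 2) →
      2 * ((List.finRange n).flatMap f).length = m + 1 := by
    intro f hf
    simp only [List.length_flatMap, hf, List.map_const', List.sum_replicate, smul_eq_mul,
      List.length_finRange]
    omega
  have hba : ∀ j, b j - a j ∈ cocycles (X × X) F 2 := fun j => Submodule.sub_mem _ (hb j) (ha j)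
  -- On a simplex inside any `U i` some factor vanishes. Subdivision then makes the product zero on
  -- the finite set `S` that determines `L`, without changing `L`.
  have hvanish : L (cupList ((List.finRange n).flatMap c) (m + 1)) = 0 := by
    obtain ⟨y, hy⟩ := exists_sub_coboundary_eq_zero hUo hUc
      (z := cupList ((List.finRange n).flatMap c) (m + 1))
      (cupList_mem_cocycles (by
        intro x hx
        obtain ⟨j, _, hx⟩ := List.mem_flatMap.1 hx
        rcases List.mem_pair.1 hx with rfl | rfl <;>
        exact Submodule.sub_mem _ (hba j) (coboundary_coboundary _)) (hlen2 c fun _ => rfl))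
      (by
        intro σ i hσ
        have hi : (i : ℕ) < 4 * n := by omega
        have hidx : idx i = i := Fin.ext (by simp [idx]; omega)
        let j : Fin n := ⟨i / 4, by omega⟩
        have hj : (j : ℕ) = i / 4 := rfl
        have hmem : ∀ x ∈ c j, x ∈ (List.finRange n).flatMap c :=
          fun x hx => List.mem_flatMap.2 ⟨j, List.mem_finRange j, hx⟩
        by_cases hcase : (i : ℕ) % 4 < 2
        · refine cupList_apply_eq_zero (hmem _ List.mem_cons_self) (fun τ hτ => hh _ _ _ τ ?_)
            (hlen2 c fun _ => rfl) hσ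
          rcases (by omega : (i : ℕ) = 4 * j ∨ (i : ℕ) = 4 * j + 1) with e | e
          · rw [← e, hidx]; exact Or.inl hτ
          · rw [← e, hidx]; exact Or.inr hτ
        · refine cupList_apply_eq_zero (hmem _ (List.mem_cons_of_mem _ List.mem_cons_self))
            (fun τ hτ => hh _ _ _ τ ?_) (hlen2 c fun _ => rfl) hσ
          rcases (by omega : (i : ℕ) = 4 * j + 2 ∨ (i : ℕ) = 4 * j + 3) with e | e
          · rw [← e, hidx]; exact Or.inl hτ
          · rw [← e, hidx]; exact Or.inr hτ) hS
    have := hLS _ hy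
    rwa [map_sub, hL, sub_zero] at this
  have step1 : L (cupList ((List.finRange n).flatMap fun j => [b j - a j, b j - a j]) (m + 1)) =
      L (cupList ((List.finRange n).flatMap c) (m + 1)) := by
    refine hLc (cupList_sub_cupList_mem_coboundaries ?_ (hlen2 _ fun _ => rfl))
    refine List.rel_flatMap (R := Eq) (List.forall₂_same.2 fun _ _ => rfl) ?_
    rintro j _ rfl
    refine List.Forall₂.cons ⟨hba j, ?_⟩ (List.Forall₂.cons ⟨hba j, ?_⟩ List.Forall₂.nil) <;>
    · rw [sub_sub_cancel]
      exact coboundary_mem_coboundaries _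
  have step2 := hLc (cupList_flatMap_sub_mem_coboundaries
    ((List.finRange n).map fun j => (a j, b j)) (by
      intro x hx
      obtain ⟨j, _, rfl⟩ := List.mem_map.1 hx
      exact ⟨⟨ha j, hb j⟩, cochainPullback_mem_coboundaries ContinuousMap.fst 4 _ (hsq' j),
        cochainPullback_mem_coboundaries ContinuousMap.snd 4 _ (hsq' j)⟩)
    (n := m + 1) (by simp; omega))
  rw [List.flatMap_map, map_smul] at step2
  have step3 := hLc (cupList_sub_cupList_mem_coboundaries_of_perm
    (flatMap_pair_perm ((List.finRange n).map fun j => (a j, b j))) (by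
      intro x hx
      obtain ⟨y, hy, hx⟩ := List.mem_flatMap.1 hx
      obtain ⟨j, _, rfl⟩ := List.mem_map.1 hy
      rcases List.mem_pair.1 hx with rfl | rfl
      · exact ha j
      · exact hb j) (n := m + 1) (by
      rw [List.flatMap_map]
      exact hlen2 _ fun _ => rfl))
  have e1 : ((List.finRange n).map fun j => (a j, b j)).map Prod.fst =
      l.map (cochainPullback ContinuousMap.fst 2) := by
    simp [hl, a, Function.comp_def]
  have e2 : ((List.finRange n).map fun j => (a j, b j)).map Prod.snd =
      l.map (cochainPullback ContinuousMap.snd 2) := by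
    simp [hl, b, Function.comp_def]
  rw [e1, e2, cupList_append _ _ (by rw [List.length_map]; exact hlen) hm,
    ← cochainPullback_cupList, ← cochainPullback_cupList] at step3
  rw [step3, step1, hvanish] at step2
  exact (smul_ne_zero (pow_ne_zero _ (neg_ne_zero.2 h2)) hLne) step2.symm

end LowerBound

end SingCoh

end

noncomputable section

/-! ### The upper bound -/

section UpperBound

open Topology Set

variable {X : Type*} [TopologicalSpace X]

/-- A connected CW-complex is path connected. -/
lemma pathConnectedSpace_of_cwComplex [T2Space X] [ConnectedSpace X]
    [CWComplex (univ : Set X)] : PathConnectedSpace X := by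
  have hcell : ∀ (k : ℕ) (e : RelCWComplex.cell (univ : Set X) k),
      IsPathConnected (RelCWComplex.closedCell k e) := fun k e =>
    ((convex_closedBall (0 : Fin k → ℝ) 1).isPathConnected
      ⟨0, by simp⟩).image' (RelCWComplex.continuousOn k e)
  -- A union of path components contains or misses each closed cell, hence is closed in the weak
  -- topology. Applied to a path component and its complement, this makes path components clopen.
  have hclosed : ∀ S : Set X, (∀ x y, Joined x y → x ∈ S → y ∈ S) → IsClosed S := by
    intro S hS
    refine (CWComplex.closed univ S (subset_univ _)).2 fun k e => ?_
    by_cases h : (S ∩ RelCWComplex.closedCell k e).Nonempty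
    · obtain ⟨x, hx, hxe⟩ := h
      have : RelCWComplex.closedCell k e ⊆ S := fun y hy =>
        hS x y ((hcell k e).joinedIn x hxe y hy).joined hx
      rw [inter_eq_self_of_subset_right this]
      exact RelCWComplex.isClosed_closedCell
    · rw [not_nonempty_iff_eq_empty.1 h]
      exact isClosed_empty
  refine ⟨inferInstance, fun x y => ?_⟩
  have hcl : IsClopen (pathComponent x) := by
    refine ⟨hclosed _ fun a b hab ha => ?_,
      isClosed_compl_iff.1 (hclosed _ fun a b hab ha hb => ha ?_)⟩
    · exact Joined.trans (show Joined x a from ha) hab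
    · exact Joined.trans (show Joined x b from hb) hab.symm
  have := hcl.eq_univ ⟨x, mem_pathComponent_self x⟩
  exact (this ▸ mem_univ y : y ∈ pathComponent x)

/-! ### Cell attachments and categorical functions -/

/-- `B` arises from `A` by attaching cells along the restrictions of the maps `m e`, which are
extended to the whole space `V` by being constant along rays outside of the unit ball. -/
structure IsCellAttachment {E V : Type*} [NormedAddCommGroup V] [NormedSpace ℝ V]
    (A B : Set X) (m : E → V → X) : Prop where
  isClosed_left : IsClosed A
  subset : A ⊆ B
  continuous : ∀ e, Continuous (m e)
  mem_right : ∀ e v, m e v ∈ B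
  mem_left_iff : ∀ e v, m e v ∈ A ↔ 1 ≤ ‖v‖
  exists_eq : ∀ x ∈ B, x ∈ A ∨ ∃ e v, ‖v‖ < 1 ∧ m e v = x
  injective : ∀ e e' v v', ‖v‖ < 1 → ‖v'‖ < 1 → m e v = m e' v' → e = e' ∧ v = v'
  radial : ∀ e v (t : ℝ), 1 ≤ ‖v‖ → 1 ≤ t → m e (t • v) = m e v
  closed : ∀ S ⊆ B, IsClosed (S ∩ A) → (∀ e, IsClosed (m e ⁻¹' S)) → IsClosed S

/-- The inclusion of a subset as a continuous map. -/
def inclusionMap (S : Set X) : C(S, X) := ⟨Subtype.val, continuous_subtype_val⟩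

/-- On `B`, the function `f` is continuous and its set of positive values is contractible
in `X`. -/
structure IsCategorical (B : Set X) (f : X → ℝ) : Prop where
  continuousOn : ContinuousOn f B
  nullhomotopic : (inclusionMap {x | x ∈ B ∧ 0 < f x}).Nullhomotopic

/-- A family of curves in `X` which depends continuously on its starting point in `S` is a
homotopy. -/
lemma homotopic_of_curves {S : Set X} {ρ : X → C(unitInterval, X)} (hρ : ContinuousOn ρ S)
    (f g : C(S, X)) (h0 : ∀ x : S, ρ x 0 = f x) (h1 : ∀ x : S, ρ x 1 = g x) :
    f.Homotopic g := by
  refine ⟨⟨⟨fun p => ρ p.2 p.1, ?_⟩, h0, h1⟩⟩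
  have : Continuous fun p : unitInterval × S => ρ p.2 :=
    (continuousOn_iff_continuous_domRestrict.1 hρ).comp continuous_snd
  exact this.eval continuous_fst

namespace IsCellAttachment

variable {E V : Type*} [NormedAddCommGroup V] [NormedSpace ℝ V] {A B : Set X} {m : E → V → X}

lemma continuousOn_right {Y : Type*} [TopologicalSpace Y] (h : IsCellAttachment A B m)
    {F : X → Y} (hA : ContinuousOn F A) (hm : ∀ e, Continuous (F ∘ m e)) : ContinuousOn F B := by
  rw [continuousOn_iff_isClosed]
  intro T hT
  refine ⟨F ⁻¹' T ∩ B, h.closed _ inter_subset_right ?_ fun e => ?_, by simp [inter_assoc]⟩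
  · rw [inter_assoc, inter_eq_self_of_subset_right h.subset]
    rw [inter_comm]
    exact hA.preimage_isClosed_of_isClosed h.isClosed_left hT
  · have : m e ⁻¹' (F ⁻¹' T ∩ B) = (F ∘ m e) ⁻¹' T := by
      ext v
      simp [h.mem_right]
    rw [this]
    exact hT.preimage (hm e)

/-- A subset of the union of open cells is relatively open in `B` as soon as it is open in each
cell, since its complement in `B` contains all of `A`. No condition at the boundary of the cells is
needed. -/
lemma continuousOn_diff {Y : Type*} [TopologicalSpace Y] (h : IsCellAttachment A B m)
    {F : X → Y} (hm : ∀ e, ContinuousOn (F ∘ m e) (Metric.ball 0 1)) :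
    ContinuousOn F (B \ A) := by
  rw [continuousOn_iff']
  intro O hO
  refine ⟨(B \ (F ⁻¹' O ∩ (B \ A)))ᶜ, IsClosed.isOpen_compl (self := ?_), ?_⟩
  · refine h.closed _ sdiff_subset ?_ fun e => ?_
    · have : B \ (F ⁻¹' O ∩ (B \ A)) ∩ A = A := by
        ext x
        have := @h.subset x
        simp only [mem_inter_iff, mem_sdiff]
        tauto
      rw [this]
      exact h.isClosed_left
    · have : m e ⁻¹' (B \ (F ⁻¹' O ∩ (B \ A))) = (Metric.ball 0 1 ∩ (F ∘ m e) ⁻¹' O)ᶜ := by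
        ext v
        simp only [mem_preimage, mem_sdiff, h.mem_right, h.mem_left_iff, mem_inter_iff,
          mem_compl_iff, mem_ball_zero_iff, Function.comp_apply, ← not_lt]
        tauto
      rw [this]
      exact ((hm e).isOpen_inter_preimage Metric.isOpen_ball hO).isClosed_compl
  · ext x
    simp only [mem_inter_iff, mem_sdiff, mem_compl_iff]
    tauto

/-- Interior points of cells have unique coordinates and lie outside `A`; for `‖v‖ ≥ 1` the
hypothesis `hag` says that the prescriptions agree. -/
lemma exists_lift {Y : Type*} (h : IsCellAttachment A B m) (a : X → Y) (g : E → V → Y)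
    (hag : ∀ e v, 1 ≤ ‖v‖ → g e v = a (m e v)) :
    ∃ F : X → Y, (∀ x ∈ A, F x = a x) ∧ ∀ e v, F (m e v) = g e v := by
  classical
  let P : X → Prop := fun x => ∃ p : E × V, ‖p.2‖ < 1 ∧ m p.1 p.2 = x
  have hA : ∀ x ∈ A, ¬ P x := by
    rintro _ hx ⟨p, hp, rfl⟩
    exact hp.not_ge ((h.mem_left_iff _ _).1 hx)
  refine ⟨fun x => if hx : P x then g hx.choose.1 hx.choose.2 else a x,
    fun x hx => dif_neg (hA x hx), fun e v => ?_⟩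
  rcases lt_or_ge ‖v‖ 1 with hv | hv
  · have hx : P (m e v) := ⟨(e, v), hv, rfl⟩
    obtain ⟨h1, h2⟩ := hx.choose_spec
    obtain ⟨he, hv'⟩ := h.injective _ _ _ _ h1 hv h2
    dsimp only
    rw [dif_pos hx, he, hv']
  · dsimp only
    rw [dif_neg (hA _ ((h.mem_left_iff _ _).2 hv)), hag e v hv]

lemma exists_continuousOn_lift {Y : Type*} [TopologicalSpace Y] (h : IsCellAttachment A B m)
    (a : X → Y) (g : E → V → Y) (hag : ∀ e v, 1 ≤ ‖v‖ → g e v = a (m e v))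
    (ha : ContinuousOn a A) (hg : ∀ e, Continuous (g e)) :
    ∃ F : X → Y, ContinuousOn F B ∧ (∀ x ∈ A, F x = a x) ∧ ∀ e v, F (m e v) = g e v := by
  obtain ⟨F, hF, hF'⟩ := h.exists_lift a g hag
  refine ⟨F, h.continuousOn_right (ha.congr hF) fun e => ?_, hF, hF'⟩
  rw [show F ∘ m e = g e from funext (hF' e)]
  exact hg e

/-- The deformation of `B` which pushes the outer half of each cell into `A`. -/
lemma exists_push (h : IsCellAttachment A B m) :
    ∃ ρ : X → C(unitInterval, X), ContinuousOn ρ B ∧ (∀ x ∈ B, ρ x 0 = x) ∧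
      (∀ x ∈ A, ρ x 1 = x) ∧ ∀ e v, ρ (m e v) 1 = m e ((2 : ℝ) • v) := by
  -- Stretching by `1 + t` pushes `‖v‖ ≥ 1/2` out of the open ball by time one, and constancy along
  -- outer rays keeps `A` fixed.
  have hcont : ∀ e, Continuous fun p : V × unitInterval => m e ((1 + (p.2 : ℝ)) • p.1) :=
    fun e => (h.continuous e).comp (by fun_prop)
  obtain ⟨ρ, hρ, hA, hm⟩ := h.exists_continuousOn_lift (fun x => ContinuousMap.const _ x)
    (fun e => ContinuousMap.curry ⟨_, hcont e⟩)
    (fun e v hv => by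
      ext t
      exact h.radial e v _ hv (by linarith [t.2.1]))
    (ContinuousMap.continuous_const'.continuousOn) (fun e => ContinuousMap.continuous _)
  refine ⟨ρ, hρ, fun x hx => ?_, fun x hx => by rw [hA x hx]; rfl, fun e v => ?_⟩
  · rcases h.exists_eq x hx with hx | ⟨e, v, -, rfl⟩
    · rw [hA x hx]; rfl
    · rw [hm]; simp
  · rw [hm]
    simp [one_add_one_eq_two]

/-- A categorical function on `A` extends to a categorical function on `B`. -/
lemma exists_isCategorical_extension (h : IsCellAttachment A B m) {f : X → ℝ}
    (hf : IsCategorical A f) : ∃ f' : X → ℝ, IsCategorical B f' ∧ ∀ x ∈ A, f' x = f x := by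
  obtain ⟨ρ, hρ, hρ0, hρA, hρm⟩ := h.exists_push
  have hmem : ∀ e (v : V), 1 / 2 ≤ ‖v‖ → m e ((2 : ℝ) • v) ∈ A := by
    intro e v hv
    rw [h.mem_left_iff, norm_smul, Real.norm_ofNat]
    linarith
  classical
  obtain ⟨f', hf', hA, hm⟩ := h.exists_continuousOn_lift f
    -- The value at the pushed point is damped by a factor that is `1` on the boundary and `0` at
    -- half radius. So the push maps positive points to positive points of `f` in `A`.
    (fun e v => if ‖v‖ ≤ 1 / 2 then 0 else (2 * min 1 ‖v‖ - 1) * f (m e ((2 : ℝ) • v)))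
    (fun e v hv => by
      rw [if_neg (by linarith), min_eq_left hv, h.radial e v 2 hv (by norm_num)]
      ring)
    hf.continuousOn
    (fun e => by
      refine continuous_if_le continuous_norm continuous_const continuousOn_const ?_ ?_
      · refine ContinuousOn.mul (by fun_prop) ?_
        exact hf.continuousOn.comp ((h.continuous e).comp (by fun_prop)).continuousOn
          fun v hv => hmem e v hv
      · intro v hv
        rw [hv]
        norm_num)
  refine ⟨f', ⟨hf', ?_⟩, hA⟩
  set W : Set X := {x | x ∈ B ∧ 0 < f' x} with hW
  have hr : ∀ x ∈ W, ρ x 1 ∈ {x | x ∈ A ∧ 0 < f x} := by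
    rintro x ⟨hx, hpos⟩
    rcases h.exists_eq x hx with hx | ⟨e, v, hv, rfl⟩
    · rw [hρA x hx]
      exact ⟨hx, hA x hx ▸ hpos⟩
    · rw [hm] at hpos
      rw [hρm]
      split_ifs at hpos with h2
      · exact absurd hpos (lt_irrefl _)
      · push Not at h2
        refine ⟨hmem e v h2.le, ?_⟩
        have : 0 < 2 * min 1 ‖v‖ - 1 := by
          rw [min_eq_right hv.le]
          linarith
        exact (mul_pos_iff_of_pos_left this).1 hpos
  have hρW : ContinuousOn ρ W := hρ.mono fun x hx => hx.1
  let r : C(W, {x | x ∈ A ∧ 0 < f x}) := ⟨fun x => ⟨ρ x 1, hr x x.2⟩, by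
    have := continuousOn_iff_continuous_domRestrict.1 hρW
    refine Continuous.subtype_mk ?_ _
    exact (continuous_eval_const (1 : unitInterval)).comp this⟩
  have h1 : (inclusionMap W).Homotopic ((inclusionMap _).comp r) :=
    homotopic_of_curves hρW _ _ (fun x => hρ0 x x.2.1) (fun x => rfl)
  obtain ⟨y, hy⟩ := hf.nullhomotopic.comp_left r
  exact ⟨y, h1.trans hy⟩

/-- The union of the open cells is the set of positive values of a categorical function. -/
lemma exists_isCategorical_diff [PathConnectedSpace X] (h : IsCellAttachment A B m) :
    ∃ f : X → ℝ, IsCategorical B f ∧ ∀ x ∈ B, x ∉ A → 0 < f x := by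
  obtain ⟨f, hf, hA, hm⟩ := h.exists_continuousOn_lift (fun _ => (0 : ℝ))
    (fun _ v => 1 - min 1 ‖v‖) (fun e v hv => by rw [min_eq_left hv, sub_self])
    continuousOn_const (fun e => by fun_prop)
  have hpos : ∀ x ∈ B, x ∉ A → 0 < f x := by
    intro x hx hxA
    rcases h.exists_eq x hx with hx | ⟨e, v, hv, rfl⟩
    · exact absurd hx hxA
    · rw [hm, min_eq_right hv.le]
      linarith
  refine ⟨f, ⟨hf, ?_⟩, hpos⟩
  have hW : {x | x ∈ B ∧ 0 < f x} = B \ A := by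
    ext x
    refine ⟨fun hx => ⟨hx.1, fun hxA => ?_⟩, fun hx => ⟨hx.1, hpos x hx.1 hx.2⟩⟩
    have := hx.2
    rw [hA x hxA] at this
    exact lt_irrefl _ this
  rw [hW]
  obtain ⟨x₀⟩ : Nonempty X := inferInstance
  have hcont : ∀ e, Continuous fun p : V × unitInterval => m e ((1 - (p.2 : ℝ)) • p.1) :=
    fun e => (h.continuous e).comp (by fun_prop)
  -- Only the open cells matter, so outside the unit ball `g` is replaced by constant curves, with
  -- no continuity across the sphere. The curves wanted contract a cell to its centre (`κ`) and then
  -- move the centre to `x₀` (`γ`).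
  have aux : ∀ g : E → V → C(unitInterval, X), (∀ e, ContinuousOn (g e) (Metric.ball 0 1)) →
      ∃ ρ : X → C(unitInterval, X), ContinuousOn ρ (B \ A) ∧
        ∀ e v, ‖v‖ < 1 → ρ (m e v) = g e v := by
    classical
    intro g hg
    obtain ⟨ρ, -, hρ⟩ := h.exists_lift (fun x => ContinuousMap.const _ x)
      (fun e v => if ‖v‖ < 1 then g e v else ContinuousMap.const _ (m e v))
      (fun e v hv => if_neg hv.not_gt)
    have hρ' : ∀ e v, ‖v‖ < 1 → ρ (m e v) = g e v := fun e v hv => by rw [hρ, if_pos hv]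
    refine ⟨ρ, h.continuousOn_diff fun e => (hg e).congr fun v hv => ?_, hρ'⟩
    exact hρ' e v (by simpa using hv)
  obtain ⟨κ, hκ, hκm⟩ := aux (fun e => ContinuousMap.curry ⟨_, hcont e⟩)
    (fun e => (ContinuousMap.continuous _).continuousOn)
  obtain ⟨γ, hγ, hγm⟩ := aux
    (fun e _ => (PathConnectedSpace.somePath (m e 0) x₀ : C(unitInterval, X)))
    (fun e => continuousOn_const)
  have hex : ∀ x : ↑(B \ A), ∃ e v, ‖v‖ < 1 ∧ m e v = x := fun x =>
    (h.exists_eq x x.2.1).resolve_left x.2.2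
  let c : C(↑(B \ A), X) := ⟨fun x => κ x 1,
    (continuous_eval_const (1 : unitInterval)).comp
      (continuousOn_iff_continuous_domRestrict.1 hκ)⟩
  refine ⟨x₀, (homotopic_of_curves hκ _ c (fun x => ?_) fun x => rfl).trans
    (homotopic_of_curves hγ c _ (fun x => ?_) fun x => ?_)⟩ <;>
  obtain ⟨e, v, hv, hx⟩ := hex x
  · rw [← hx, hκm e v hv]
    change m e _ = x.1
    simp [hx]
  · change _ = κ x 1
    rw [← hx, hκm e v hv, hγm e v hv]
    change PathConnectedSpace.somePath (m e 0) x₀ 0 = m e _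
    simp
  · rw [← hx, hγm e v hv]
    exact (PathConnectedSpace.somePath (m e 0) x₀).target

end IsCellAttachment

end UpperBound

end

noncomputable section

/-! ### Categorical covers of skeleta -/

section UpperBound

open Topology Set

variable {X : Type*} [TopologicalSpace X]

/-- Skeleta are obtained by attaching cells. -/
lemma exists_isCellAttachment_skeletonLT [T2Space X] [CWComplex (univ : Set X)] (k : ℕ) :
    ∃ m : RelCWComplex.cell (univ : Set X) k → (Fin k → ℝ) → X,
      IsCellAttachment (RelCWComplex.skeletonLT (univ : Set X) k : Set X)
        (RelCWComplex.skeletonLT (univ : Set X) (k + 1 : ℕ) : Set X) m := by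
  -- Radial retraction onto the unit ball; it extends characteristic maps to the whole space.
  let c : (Fin k → ℝ) → (Fin k → ℝ) := fun v => (max 1 ‖v‖)⁻¹ • v
  have hpos : ∀ v : Fin k → ℝ, 0 < max 1 ‖v‖ := fun v => lt_max_of_lt_left one_pos
  have hc : Continuous c :=
    (Continuous.inv₀ (by fun_prop) fun v => (hpos v).ne').smul continuous_id
  have hcn : ∀ v, ‖c v‖ = (max 1 ‖v‖)⁻¹ * ‖v‖ := fun v => by
    rw [norm_smul, norm_inv, Real.norm_of_nonneg (hpos v).le]
  have hcball : ∀ v, c v ∈ Metric.closedBall (0 : Fin k → ℝ) 1 := fun v => by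
    rw [mem_closedBall_zero_iff, hcn, inv_mul_le_iff₀ (hpos v), mul_one]
    exact le_max_right _ _
  have hcid : ∀ v, ‖v‖ ≤ 1 → c v = v := fun v hv => by
    simp [c, max_eq_left hv]
  have hcsphere : ∀ v, 1 ≤ ‖v‖ → c v ∈ Metric.sphere (0 : Fin k → ℝ) 1 := fun v hv => by
    rw [mem_sphere_zero_iff_norm, hcn, max_eq_right hv, inv_mul_cancel₀ (by linarith)]
  have hopen : ∀ (e : RelCWComplex.cell (univ : Set X) k) (v : Fin k → ℝ), ‖v‖ < 1 →
      RelCWComplex.map k e (c v) ∈ RelCWComplex.openCell k e := fun e v hv => by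
    rw [hcid v hv.le]
    exact ⟨v, by simpa using hv, rfl⟩
  have hcont : ∀ e : RelCWComplex.cell (univ : Set X) k,
      Continuous fun v => RelCWComplex.map k e (c v) := fun e =>
    (RelCWComplex.continuousOn k e).comp_continuous hc hcball
  refine ⟨fun e v => RelCWComplex.map k e (c v), ?_⟩
  constructor
  · exact RelCWComplex.Subcomplex.closed _
  · exact RelCWComplex.skeletonLT_mono (by norm_cast; omega)
  · exact hcont
  · intro e v
    refine RelCWComplex.closedCell_subset_skeletonLT k e ?_
    exact ⟨c v, hcball v, rfl⟩
  · refine fun e v => ⟨fun h => ?_, fun h => ?_⟩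
    · by_contra hv
      exact (RelCWComplex.disjoint_skeletonLT_openCell le_rfl).le_bot
        ⟨h, hopen e v (not_le.1 hv)⟩
    · exact RelCWComplex.cellFrontier_subset_skeletonLT k e ⟨c v, hcsphere v h, rfl⟩
  · intro x hx
    obtain ⟨l, hl, j, hj⟩ := CWComplex.mem_skeletonLT_iff.1 hx
    have hl' : l < k + 1 := by exact_mod_cast hl
    rcases (Nat.lt_succ_iff.1 hl').lt_or_eq with h | rfl
    · exact Or.inl (CWComplex.mem_skeletonLT_iff.2 ⟨l, by exact_mod_cast h, j, hj⟩)
    · obtain ⟨v, hv, rfl⟩ := hj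
      rw [mem_ball_zero_iff] at hv
      exact Or.inr ⟨j, v, hv, by rw [hcid v hv.le]⟩
  · intro e e' v v' hv hv' h
    have he := RelCWComplex.eq_of_not_disjoint_openCell
      (not_disjoint_iff.2 ⟨_, hopen e v hv, h ▸ hopen e' v' hv'⟩)
    obtain rfl : e = e' := by simpa using he
    refine ⟨rfl, ?_⟩
    rw [hcid v hv.le, hcid v' hv'.le] at h
    refine (RelCWComplex.map k e).injOn ?_ ?_ h <;> rw [RelCWComplex.source_eq] <;> simpa
  · intro e v t hv ht
    have htv : 1 ≤ ‖t • v‖ := by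
      rw [norm_smul, Real.norm_of_nonneg (by linarith)]
      nlinarith
    have : c (t • v) = c v := by
      simp only [c]
      rw [max_eq_right hv, max_eq_right htv, norm_smul, Real.norm_of_nonneg (by linarith),
        smul_smul]
      congr 1
      have : ‖v‖ ≠ 0 := by linarith
      have : t ≠ 0 := by linarith
      field_simp
    exact congrArg _ this
  · intro S hS hSA hSm
    -- Lower cells lie in `A`, higher open cells miss `S`, and in dimension `k` the intersection is
    -- the image of a compact set.
    refine CWComplex.isClosed_of_disjoint_openCell_or_isClosed_inter_closedCell (subset_univ S)
      fun l _ j => ?_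
    rcases lt_trichotomy l k with h | rfl | h
    · right
      have : RelCWComplex.closedCell l j ⊆ (RelCWComplex.skeletonLT (univ : Set X) k : Set X) :=
        (RelCWComplex.closedCell_subset_skeletonLT l j).trans
          (RelCWComplex.skeletonLT_mono (by norm_cast))
      rw [← inter_eq_self_of_subset_right this, ← inter_assoc]
      exact hSA.inter RelCWComplex.isClosed_closedCell
    · right
      have : S ∩ RelCWComplex.closedCell l j = (fun v => RelCWComplex.map l j (c v)) ''
          (((fun v => RelCWComplex.map l j (c v)) ⁻¹' S) ∩ Metric.closedBall 0 1) := by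
        ext x
        constructor
        · rintro ⟨hx, v, hv, rfl⟩
          have : c v = v := hcid v (by simpa using hv)
          exact ⟨v, ⟨by simpa [this] using hx, hv⟩, by simp [this]⟩
        · rintro ⟨v, ⟨hv, -⟩, rfl⟩
          exact ⟨hv, c v, hcball v, rfl⟩
      rw [this]
      exact (((isCompact_closedBall _ _).inter_left (hSm j)).image (hcont j)).isClosed
    · left
      exact (RelCWComplex.disjoint_skeletonLT_openCell (by norm_cast)).mono_left hS

/-- The union of the cells of dimension less than `k` is covered by the sets of positive values
of `k` categorical functions. -/
lemma exists_isCategorical_skeletonLT [T2Space X] [PathConnectedSpace X]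
    [CWComplex (univ : Set X)] (k : ℕ) :
    ∃ f : Fin k → X → ℝ,
      (∀ i, IsCategorical (RelCWComplex.skeletonLT (univ : Set X) k : Set X) (f i)) ∧
      ∀ x ∈ (RelCWComplex.skeletonLT (univ : Set X) k : Set X), ∃ i, 0 < f i x := by
  induction k with
  | zero =>
    refine ⟨Fin.elim0, fun i => i.elim0, fun x hx => ?_⟩
    rw [Nat.cast_zero, CWComplex.skeletonLT_zero_eq_empty] at hx
    exact absurd hx (notMem_empty x)
  | succ k ih =>
    obtain ⟨f, hf, hcover⟩ := ih
    obtain ⟨m, hm⟩ := exists_isCellAttachment_skeletonLT (X := X) k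
    choose f' hf' hA using fun i => hm.exists_isCategorical_extension (hf i)
    obtain ⟨g, hg, hgpos⟩ := hm.exists_isCategorical_diff
    refine ⟨Fin.snoc f' g, Fin.lastCases (by simpa using hg) fun i => by simpa using hf' i,
      fun x hx => ?_⟩
    by_cases hxA : x ∈ (RelCWComplex.skeletonLT (univ : Set X) k : Set X)
    · obtain ⟨i, hi⟩ := hcover x hxA
      exact ⟨i.castSucc, by simpa [hA i x hxA] using hi⟩
    · exact ⟨Fin.last k, by simpa using hgpos x hx hxA⟩

lemma skeletonLT_eq_univ_of_cwDimension_eq [T2Space X] [CWComplex (univ : Set X)] {d : ℕ}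
    (hd : cwDimension (univ : Set X) = d) :
    (RelCWComplex.skeletonLT (univ : Set X) (d + 1 : ℕ) : Set X) = univ := by
  refine eq_univ_of_forall fun x => ?_
  have hx : x ∈ (univ : Set X) := mem_univ x
  rw [← CWComplex.iUnion_openCell_eq_complex (C := (univ : Set X))] at hx
  simp only [mem_iUnion] at hx
  obtain ⟨l, j, hj⟩ := hx
  refine CWComplex.mem_skeletonLT_iff.2 ⟨l, ?_, j, hj⟩
  have : (l : ℕ∞) ≤ d := hd ▸ le_iSup₂_of_le (f := fun (k : ℕ) (_ : Nonempty _) => (k : ℕ∞))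
    l ⟨j⟩ le_rfl
  have : l ≤ d := by exact_mod_cast this
  exact_mod_cast Nat.lt_succ_of_le this

/-! ### Motion planners from categorical functions -/

/-- A continuous motion planner on a set of pairs of points. -/
def HasSection (R : Set (X × X)) : Prop :=
  ∃ s : X × X → C(unitInterval, X), ContinuousOn s R ∧ ∀ p ∈ R, (s p 0, s p 1) = p

lemma HasSection.iUnion {ι : Type*} [Nonempty X] {R : ι → Set (X × X)} (hR : ∀ i, IsOpen (R i))
    (hdisj : ∀ i j p, p ∈ R i → p ∈ R j → i = j) (h : ∀ i, HasSection (R i)) :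
    HasSection (⋃ i, R i) := by
  classical
  choose s hs hsp using h
  obtain ⟨x₀⟩ := ‹Nonempty X›
  let F : X × X → C(unitInterval, X) := fun p =>
    if hp : ∃ i, p ∈ R i then s hp.choose p else ContinuousMap.const _ x₀
  have hF : ∀ i, ∀ p ∈ R i, F p = s i p := by
    intro i p hp
    have hex : ∃ i, p ∈ R i := ⟨i, hp⟩
    simp only [F]
    rw [dif_pos hex, hdisj _ _ p hex.choose_spec hp]
  refine ⟨F, ContinuousOn.iUnion_of_isOpen (fun i => (hs i).congr (hF i)) hR, fun p hp => ?_⟩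
  obtain ⟨i, hi⟩ := mem_iUnion.1 hp
  rw [hF i p hi, hsp i p hi]

/-- There is a motion planner on the product of two sets which are contractible in `X`. -/
lemma hasSection_of_nullhomotopic [PathConnectedSpace X] {V W : Set X} {R : Set (X × X)}
    (hV : (inclusionMap V).Nullhomotopic) (hW : (inclusionMap W).Nullhomotopic)
    (hR : ∀ p ∈ R, p.1 ∈ V ∧ p.2 ∈ W) : HasSection R := by
  classical
  let a : C(R, V) := ⟨fun p => ⟨p.1.1, (hR p p.2).1⟩, by fun_prop⟩
  let b : C(R, W) := ⟨fun p => ⟨p.1.2, (hR p p.2).2⟩, by fun_prop⟩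
  obtain ⟨x, hx⟩ := hV.comp_left a
  obtain ⟨y, hy⟩ := hW.comp_left b
  have hxy : (ContinuousMap.const R x).Homotopic (ContinuousMap.const R y) :=
    ⟨⟨⟨fun p => PathConnectedSpace.somePath x y p.1, by fun_prop⟩, by simp, by simp⟩⟩
  obtain ⟨H⟩ := (hx.trans hxy).trans hy.symm
  let s : C(R, C(unitInterval, X)) :=
    (H.toContinuousMap.comp ⟨Prod.swap, continuous_swap⟩).curry
  obtain ⟨x₀⟩ : Nonempty X := inferInstance
  refine ⟨fun p => if hp : p ∈ R then s ⟨p, hp⟩ else ContinuousMap.const _ x₀, ?_,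
    fun p hp => ?_⟩
  · rw [continuousOn_iff_continuous_domRestrict]
    convert s.continuous using 1
    funext p
    simp
  · simp only [dif_pos hp]
    exact Prod.ext (H.map_zero_left ⟨p, hp⟩) (H.map_one_left ⟨p, hp⟩)

/-- A space with `d + 1` categorical functions has topological complexity at most `2 * d`. -/
lemma hasMotionPlanners_of_isCategorical [PathConnectedSpace X] {d : ℕ} {f : Fin (d + 1) → X → ℝ}
    (hf : ∀ i, IsCategorical univ (f i)) (hpos : ∀ x, ∃ i, 0 < f i x) :
    HasMotionPlanners X (2 * d) := by
  have hfc : ∀ i, Continuous (f i) := fun i => continuousOn_univ.1 (hf i).continuousOn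
  let M : X → ℝ := fun x => Finset.univ.sup' Finset.univ_nonempty fun i => f i x
  have hM : Continuous M := Continuous.finset_sup'_apply _ fun i _ => hfc i
  have hle : ∀ i x, f i x ≤ M x := fun i x =>
    Finset.le_sup' (fun i => f i x) (Finset.mem_univ i)
  have hMpos : ∀ x, 0 < M x := fun x => (hpos x).elim fun i hi => hi.trans_le (hle i x)
  have hMex : ∀ x, ∃ i, f i x = M x := fun x => by
    obtain ⟨i, -, hi⟩ := Finset.exists_mem_eq_sup' Finset.univ_nonempty fun i => f i x
    exact ⟨i, hi.symm⟩
  let K := Fin (d + 1) ⊕ Fin (d + 1)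
  -- The factors `M` equalize the maxima over the two coordinates: both are `M p.1 * M p.2`, so the
  -- maximum is always attained by an index of each kind.
  let h : K → X × X → ℝ := Sum.elim (fun i p => f i p.1 * M p.2) fun j p => f j p.2 * M p.1
  have hh : ∀ k, Continuous (h k) := by
    rintro (i | j) <;> simp only [h, Sum.elim_inl, Sum.elim_inr]
    · exact ((hfc i).comp continuous_fst).mul (hM.comp continuous_snd)
    · exact ((hfc j).comp continuous_snd).mul (hM.comp continuous_fst)
  have hhle : ∀ k p, h k p ≤ M p.1 * M p.2 := by
    rintro (i | j) p <;> simp only [h, Sum.elim_inl, Sum.elim_inr]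
    · exact mul_le_mul_of_nonneg_right (hle _ _) (hMpos _).le
    · rw [mul_comm]
      exact mul_le_mul_of_nonneg_left (hle _ _) (hMpos _).le
  let R : Finset K → Set (X × X) := fun S =>
    {p | (∀ k ∈ S, 0 < h k p) ∧ ∀ k ∈ S, ∀ l ∉ S, h l p < h k p}
  have hRo : ∀ S, IsOpen (R S) := by
    intro S
    have : R S = (⋂ k ∈ S, {p | 0 < h k p}) ∩ ⋂ k ∈ S, ⋂ l ∈ Sᶜ, {p | h l p < h k p} := by
      ext p
      simp [R]
    rw [this]
    exact (isOpen_biInter_finset fun k _ => isOpen_lt continuous_const (hh k)).inter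
      (isOpen_biInter_finset fun k _ => isOpen_biInter_finset fun l _ => isOpen_lt (hh l) (hh k))
  -- Distinct sets of equal size each contain an index missing from the other, and these indices
  -- would dominate each other.
  have hRdisj : ∀ S S' p, S.card = S'.card → p ∈ R S → p ∈ R S' → S = S' := by
    intro S S' p hcard hp hp'
    by_contra hne
    obtain ⟨k, hk, hk'⟩ := Finset.not_subset.1 fun hs =>
      hne (Finset.eq_of_subset_of_card_le hs hcard.ge)
    obtain ⟨l, hl, hl'⟩ := Finset.not_subset.1 fun hs =>
      hne (Finset.eq_of_subset_of_card_le hs hcard.le).symm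
    exact lt_asymm (hp.2 k hk l hl') (hp'.2 l hl k hk')
  have hRs : ∀ S i j, Sum.inl i ∈ S → Sum.inr j ∈ S → HasSection (R S) := by
    intro S i j hi hj
    refine hasSection_of_nullhomotopic (hf i).nullhomotopic (hf j).nullhomotopic fun p hp => ?_
    exact ⟨⟨mem_univ _, (pos_iff_pos_of_mul_pos (hp.1 _ hi)).2 (hMpos _)⟩,
      ⟨mem_univ _, (pos_iff_pos_of_mul_pos (hp.1 _ hj)).2 (hMpos _)⟩⟩
  -- A set of maximizers has an index of each kind, so its size is between `2` and `2 * d + 2`. This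
  -- leaves `2 * d + 1` sizes, one open set for each.
  let T : Fin (2 * d + 1) → Type := fun r =>
    {S : Finset K // S.card = r + 2 ∧ ∃ i j, Sum.inl i ∈ S ∧ Sum.inr j ∈ S}
  refine ⟨fun r => ⋃ S : T r, R S.1, fun r => isOpen_iUnion fun S => hRo _, ?_, fun r => ?_⟩
  · refine eq_univ_of_forall fun p => ?_
    classical
    let S : Finset K := {k | h k p = M p.1 * M p.2}
    obtain ⟨i, hi⟩ := hMex p.1
    obtain ⟨j, hj⟩ := hMex p.2
    have hiS : Sum.inl i ∈ S := by simp [S, h, hi]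
    have hjS : Sum.inr j ∈ S := by simp [S, h, hj, mul_comm]
    have hlow : 2 ≤ S.card := by
      have : ({Sum.inl i, Sum.inr j} : Finset K) ⊆ S := by
        intro k
        simp only [Finset.mem_insert, Finset.mem_singleton]
        rintro (rfl | rfl) <;> assumption
      simpa using Finset.card_le_card this
    have hup : S.card ≤ 2 * d + 2 := by
      have := Finset.card_le_univ S
      simp only [K, Fintype.card_sum, Fintype.card_fin] at this
      omega
    refine mem_iUnion.2 ⟨⟨S.card - 2, by omega⟩, mem_iUnion.2
      ⟨⟨S, (Nat.sub_add_cancel hlow).symm, i, j, hiS, hjS⟩, fun k hk => ?_, fun k hk l hl => ?_⟩⟩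
    · rw [(Finset.mem_filter.1 hk).2]
      exact mul_pos (hMpos _) (hMpos _)
    · rw [(Finset.mem_filter.1 hk).2]
      exact lt_of_le_of_ne (hhle l p) fun h' => hl (Finset.mem_filter.2 ⟨Finset.mem_univ _, h'⟩)
  · obtain ⟨s, hs, hsp⟩ := HasSection.iUnion (R := fun S : T r => R S.1) (fun S => hRo _)
      (fun S S' p hp hp' => Subtype.ext (hRdisj _ _ p (S.2.1.trans S'.2.1.symm) hp hp'))
      (fun S => by
        obtain ⟨i, j, hi, hj⟩ := S.2.2
        exact hRs _ i j hi hj)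
    exact ⟨⟨_, continuousOn_iff_continuous_domRestrict.1 hs⟩, fun p => hsp p p.2⟩

/-- The dimensional upper bound for the topological complexity of a connected CW-complex. -/
lemma hasMotionPlanners_of_cwDimension_eq [T2Space X] [ConnectedSpace X]
    [CWComplex (univ : Set X)] {d : ℕ} (hd : cwDimension (univ : Set X) = d) :
    HasMotionPlanners X (2 * d) := by
  have := pathConnectedSpace_of_cwComplex (X := X)
  obtain ⟨f, hf, hpos⟩ := exists_isCategorical_skeletonLT (X := X) (d + 1)
  rw [skeletonLT_eq_univ_of_cwDimension_eq hd] at hf hpos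
  exact hasMotionPlanners_of_isCategorical hf fun x => hpos x (mem_univ x)

end UpperBound

end
theorem theorem1p2 (n : ℕ) (X : Type*) [TopologicalSpace X] [T2Space X] [ConnectedSpace X]
    [Topology.CWComplex (Set.univ : Set X)] (hdim : cwDimension (Set.univ : Set X) = (2 * n : ℕ))
    (F : Type*) [Field F] (hF : ringChar F ≠ 2)
    (u : Fin n → SingCoh.Cohomology X F 2)
    (hator : ∀ j, SingCoh.IsAtoroidal (u j))
    (hsq : ∀ j, SingCoh.cup X F 2 2 (u j) (u j) = 0)
    (hprod : SingCoh.cupProd n u ≠ 0) :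
    topologicalComplexity X = (4 * n : ℕ) := by
  refine le_antisymm (iInf₂_le (4 * n) ?_) (le_iInf₂ fun k hk => ?_)
  · have := hasMotionPlanners_of_cwDimension_eq hdim
    rwa [← mul_assoc] at this
  · exact_mod_cast SingCoh.le_of_hasMotionPlanners (Ring.two_ne_zero hF) n u hator hsq hprod hk
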